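/- Let $R$ be a commutative $\mathbb{Q}$-algebra, let $\tilde t_1,\tilde t_2,\ldots\in R$, and let $\beta\in R$ be such that $1+\beta c$ is invertible in $R$ for every integer $c$. (For example, $\tilde{\mathbf t}$ and $\beta$ may be formal variables, $R=\mathbb{C}[[\beta,\tilde t_1,\tilde t_2,\ldots]]$.) For variables $u_1,u_2,\dots$ let $\sum_k h_k(\mathbf u)z^k=\exp\big(\sum_{j\ge1}u_jz^j\big)$, $h_k=0$ for $k<0$, and for a partition $\lambda=(\lambda_1\ge\dots\ge\lambda_\ell>0)$ let $s_\lambda(\mathbf u)=\det\big(h_{\lambda_i-i+j}(\mathbf u)\big)_{1\le i,j\le\ell}$ be the Schur function. The tau-function of the double monotone Hurwitz numbers is the power series in $\mathbf t=(t_1,t_2,\dots)$ $$\tau_{mm}(\mathbf t,\tilde{\mathbf t})=\sum_\lambda s_\lambda(\mathbf t)\,s_\lambda(\tilde{\mathbf t})\prod_{i=1}^{\ell(\lambda)}\prod_{k=0}^{\lambda_i-1}\frac{1}{1+\beta(k+i-\lambda_i)}\in R[[\mathbf t]].$$ Let $\widehat J_n=\partial/\partial t_n$ for $n>0$, $\widehat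 J_n=-n\,t_{-n}$ for $n<0$, $\widehat J_0=0$, and $\widehat J(x)=\sum_{n\in\mathbb Z}\widehat J_n x^{-n-1}$; let ${:}\cdots{:}$ be the normal ordering that puts all $\widehat J_n$ with $n>0$ to the right of those with $n<0$. Let $D=x\,\partial/\partial x$ and let $w_{1+\infty}$ be the algebra of operators on $R[x,x^{-1}]$ generated over $R$ by $x^{\pm1}$ and $D$; the operators $(xD)^mx^k$, $m\ge0$, $k\in\mathbb Z$, form a basis of it. Let $a\mapsto\widehat Y_a$ be the $R$-linear map from $w_{1+\infty}$ to operators on $R[[\mathbf t]]$ with $$\widehat Y_{(xD)^mx^k}=\mathop{\mathrm{Res}}_{x=0}\Big(x^{-k}\,{:}\frac{(\widehat J(x)+\partial_x)^m}{m+1}\widehat J(x){:}\Big)dx .$$ For $n\ge1$ put $$\widehat R_n=\sum_{k=0}^n(-\beta)^k\sum_{1\le i_1<\dots<i_k\le n}\widehat Y_{x^{-n}(D-i_1)\cdots(D-i_k)} .$$ Then for every $n\ge 1$ $$\widehat R_n\,\tau_{mm}(\mathbf t,\tilde{\mathbf t})=n\tilde t_n\,\tau_{mm}(\mathbf t,\tilde{\mathbf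 t}),$$ and $\widehat R_n=\widehat Y_{b_{mm}^n}$, where $b_{mm}=x^{-1}(1-\beta(D-1))$. Moreover, this system of identities determines $\tau_{mm}$ uniquely up to a factor that is constant in $\mathbf t$: if $f\in R[[\mathbf t]]$ satisfies $\widehat R_nf=n\tilde t_nf$ for all $n\ge1$, then $f=c\,\tau_{mm}$ for a unique $c\in R$. -/

import Mathlib

open scoped LaurentPolynomial

noncomputable section

namespace MonotoneHurwitz

/-! ## Differential operators on the circle -/

section Circle

variable (R : Type*) [CommRing R]

/-- Multiplication by `x ^ k`, `k : ℤ`, on Laurent polynomials in `x`. -/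
def xOp (k : ℤ) : Module.End R R[T;T⁻¹] :=
  LinearMap.mulLeft R (LaurentPolynomial.T k)

/-- The Euler operator `D = x ∂/∂x` on Laurent polynomials, `x ^ n ↦ n x ^ n`. -/
def dOp : Module.End R R[T;T⁻¹] :=
  (AddMonoidAlgebra.coeffLinearEquiv R (M := ℤ)).symm.toLinearMap ∘ₗ
    Finsupp.lsum R (fun n : ℤ => (n : R) • Finsupp.lsingle (M := R) n) ∘ₗ
      (AddMonoidAlgebra.coeffLinearEquiv R (M := ℤ)).toLinearMap

/-- The algebra `w_{1+∞}` of differential operators on the circle: the associative algebra of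
operators on Laurent polynomials generated by all `x ^ k`, `k : ℤ`, and `D`. -/
def W : Subalgebra R (Module.End R R[T;T⁻¹]) :=
  Algebra.adjoin R (insert (dOp R) (Set.range (xOp R)))

/-- The operator `x ^ k` as an element of `w_{1+∞}`. -/
def wx (k : ℤ) : W R :=
  ⟨xOp R k, Algebra.subset_adjoin (Set.mem_insert_of_mem _ ⟨k, rfl⟩)⟩

/-- The operator `D` as an element of `w_{1+∞}`. -/
def wD : W R := ⟨dOp R, Algebra.subset_adjoin (Set.mem_insert _ _)⟩

/-- The operators `(x D) ^ m x ^ k`, `m ≥ 0`, `k ∈ ℤ`. -/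
def wGen (p : ℕ × ℤ) : W R := (wx R 1 * wD R) ^ p.1 * wx R p.2

/-- The polynomial `(X - 1) (X - 2) ⋯ (X - m)`. -/
def fallPoly (m : ℕ) : Polynomial R :=
  ∏ i ∈ Finset.range m, (Polynomial.X - Polynomial.C ((i : R) + 1))

variable {R}

lemma xOp_T (k n : ℤ) :
    xOp R k (LaurentPolynomial.T n) = LaurentPolynomial.T (k + n) := by
  rw [xOp, LinearMap.mulLeft_apply, LaurentPolynomial.T_add]

lemma dOp_T (n : ℤ) :
    dOp R (LaurentPolynomial.T n) = (n : R) • LaurentPolynomial.T n := by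
  apply LaurentPolynomial.ext
  intro a
  have h : (LaurentPolynomial.T n : R[T;T⁻¹]).coeff = Finsupp.single n 1 := rfl
  simp [dOp, h, -LaurentPolynomial.single_eq_C_mul_T]

lemma end_ext {a b : Module.End R R[T;T⁻¹]}
    (h : ∀ n : ℤ, a (LaurentPolynomial.T n) = b (LaurentPolynomial.T n)) : a = b := by
  refine LinearMap.ext fun f => ?_
  induction f using LaurentPolynomial.induction_on' with
  | add p q hp hq => simp only [map_add, hp, hq]
  | C_mul_T n r => simp only [← LaurentPolynomial.smul_eq_C_mul, map_smul, h]

lemma aeval_dOp_T (p : Polynomial R) (n : ℤ) :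
    Polynomial.aeval (dOp R) p (LaurentPolynomial.T n)
      = p.eval (n : R) • LaurentPolynomial.T n := by
  induction p using Polynomial.induction_on' with
  | add p q hp hq => simp [hp, hq, add_smul]
  | monomial k r =>
    have : ∀ k : ℕ, (dOp R ^ k) (LaurentPolynomial.T n)
        = ((n : R) ^ k) • LaurentPolynomial.T n := by
      intro k
      induction k with
      | zero => simp
      | succ k ih =>
        rw [pow_succ', Module.End.mul_apply, ih, map_smul, dOp_T, smul_smul, pow_succ]
    simp [Polynomial.aeval_monomial, this, smul_smul, mul_comm]

lemma coe_aeval_wD (p : Polynomial R) :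
    ((Polynomial.aeval (wD R) p : W R) : Module.End R R[T;T⁻¹])
      = Polynomial.aeval (dOp R) p := by
  rw [← Subalgebra.val_apply, ← Polynomial.aeval_algHom_apply]
  rfl

/-- Commutation relation `x ^ k p(D) = p(D - k) x ^ k`. -/
lemma wx_mul_aeval (k : ℤ) (p : Polynomial R) :
    wx R k * Polynomial.aeval (wD R) p
      = Polynomial.aeval (wD R) (p.comp (Polynomial.X - Polynomial.C (k : R))) * wx R k := by
  apply Subtype.ext
  apply end_ext
  intro n
  simp only [Subalgebra.coe_mul, coe_aeval_wD, Module.End.mul_apply, wx, aeval_dOp_T, map_smul,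
    xOp_T]
  simp

lemma wx_mul (k l : ℤ) : wx R k * wx R l = wx R (k + l) := by
  apply Subtype.ext
  apply end_ext
  intro n
  simp [wx, xOp_T, add_assoc]

lemma wx_zero : wx R 0 = 1 := by
  apply Subtype.ext
  apply end_ext
  intro n
  simp [wx, xOp_T]

/-- `(x D) ^ m x ^ k = (D - 1) ⋯ (D - m) x ^ (m + k)`. -/
lemma wGen_eq (m : ℕ) (k : ℤ) :
    wGen R (m, k) = Polynomial.aeval (wD R) (fallPoly R m) * wx R (m + k) := by
  induction m with
  | zero => simp [wGen, fallPoly]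
  | succ m ih =>
    have h1 : wGen R (m + 1, k) = wx R 1 * (wD R * wGen R (m, k)) := by
      simp only [wGen, pow_succ', mul_assoc]
    have h2 : wD R * Polynomial.aeval (wD R) (fallPoly R m)
        = Polynomial.aeval (wD R) (Polynomial.X * fallPoly R m) := by simp
    have h3 : (Polynomial.X * fallPoly R m).comp (Polynomial.X - Polynomial.C ((1 : ℤ) : R))
        = fallPoly R (m + 1) := by
      simp only [fallPoly, Polynomial.mul_comp, Polynomial.X_comp, Polynomial.prod_comp,
        Polynomial.sub_comp, Polynomial.C_comp, Finset.prod_range_succ']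
      rw [mul_comm]
      congr 1
      · apply Finset.prod_congr rfl
        intro i _
        simp only [Int.cast_one, Nat.cast_add, Nat.cast_one, map_add, map_one]
        ring
      · simp
    rw [h1, ih, ← mul_assoc (wD R), h2, ← mul_assoc, wx_mul_aeval, h3, mul_assoc, wx_mul]
    congr 2
    push_cast
    ring

lemma eval_fallPoly_of_lt {m j : ℕ} (h : j < m) :
    (fallPoly R m).eval ((j : R) + 1) = 0 := by
  rw [fallPoly, Polynomial.eval_prod]
  exact Finset.prod_eq_zero (Finset.mem_range.2 h) (by simp)

lemma eval_fallPoly_self (m : ℕ) :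
    (fallPoly R m).eval ((m : R) + 1) = (m.factorial : R) := by
  have : ∀ m : ℕ, (∏ i ∈ Finset.range m, ((m : R) + 1 - ((i : R) + 1))) = (m.factorial : R) := by
    intro m
    induction m with
    | zero => simp
    | succ m ih =>
      rw [Finset.prod_range_succ', Nat.factorial_succ, Nat.cast_mul, ← ih, mul_comm]
      congr 1
      · push_cast; ring
      · apply Finset.prod_congr rfl
        intro i _
        push_cast; ring
  rw [fallPoly, Polynomial.eval_prod, ← this]
  simp

lemma aeval_mul_wx_mem_span (p : Polynomial R) (N : ℤ) :
    Polynomial.aeval (wD R) p * wx R N ∈ Submodule.span R (Set.range (wGen R)) := by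
  have hq : ∀ m : ℕ, Polynomial.aeval (wD R) (fallPoly R m) * wx R N
      ∈ Submodule.span R (Set.range (wGen R)) := by
    intro m
    refine Submodule.subset_span ⟨(m, N - m), ?_⟩
    rw [wGen_eq]
    congr 2
    ring
  have hsp : p ∈ Submodule.span R (Set.range (fallPoly R)) := by
    have hX : ∀ p ∈ Submodule.span R (Set.range (fallPoly R)),
        Polynomial.X * p ∈ Submodule.span R (Set.range (fallPoly R)) := by
      intro p hp
      induction hp using Submodule.span_induction with
      | mem x hx =>
        obtain ⟨m, rfl⟩ := hx
        have : Polynomial.X * fallPoly R m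
            = fallPoly R (m + 1) + ((m : R) + 1) • fallPoly R m := by
          rw [fallPoly, fallPoly, Finset.prod_range_succ, Polynomial.smul_eq_C_mul]
          ring
        rw [this]
        exact add_mem (Submodule.subset_span ⟨_, rfl⟩)
          (Submodule.smul_mem _ _ (Submodule.subset_span ⟨_, rfl⟩))
      | zero => simp
      | add x y _ _ hx hy => rw [mul_add]; exact add_mem hx hy
      | smul a x _ hx => rw [mul_smul_comm]; exact Submodule.smul_mem _ _ hx
    have hpow : ∀ n : ℕ, (Polynomial.X : Polynomial R) ^ n
        ∈ Submodule.span R (Set.range (fallPoly R)) := by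
      intro n
      induction n with
      | zero => exact Submodule.subset_span ⟨0, by simp [fallPoly]⟩
      | succ n ih => rw [pow_succ']; exact hX _ ih
    induction p using Polynomial.induction_on' with
    | add p q hp hq => exact add_mem hp hq
    | monomial n a =>
      rw [← Polynomial.smul_X_eq_monomial]
      exact Submodule.smul_mem _ _ (hpow n)
  induction hsp using Submodule.span_induction with
  | mem x hx => obtain ⟨m, rfl⟩ := hx; exact hq m
  | zero => simp
  | add x y _ _ hx hy => rw [map_add, add_mul]; exact add_mem hx hy
  | smul a x _ hx => rw [map_smul, smul_mul_assoc]; exact Submodule.smul_mem _ _ hx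

lemma mul_mem_span_wGen {a b : W R} (ha : a ∈ Submodule.span R (Set.range (wGen R)))
    (hb : b ∈ Submodule.span R (Set.range (wGen R))) :
    a * b ∈ Submodule.span R (Set.range (wGen R)) := by
  induction ha using Submodule.span_induction with
  | mem x hx =>
    obtain ⟨⟨m, k⟩, rfl⟩ := hx
    induction hb using Submodule.span_induction with
    | mem y hy =>
      obtain ⟨⟨m', k'⟩, rfl⟩ := hy
      rw [wGen_eq, wGen_eq, mul_assoc, ← mul_assoc (wx R _), wx_mul_aeval, mul_assoc, wx_mul,
        ← mul_assoc, ← map_mul]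
      exact aeval_mul_wx_mem_span _ _
    | zero => rw [mul_zero]; exact zero_mem _
    | add x y _ _ hx hy => rw [mul_add]; exact add_mem hx hy
    | smul r x _ hx => rw [mul_smul_comm]; exact Submodule.smul_mem _ _ hx
  | zero => rw [zero_mul]; exact zero_mem _
  | add x y _ _ hx hy => rw [add_mul]; exact add_mem hx hy
  | smul r x _ hx => rw [smul_mul_assoc]; exact Submodule.smul_mem _ _ hx

lemma exists_mem_span_wGen (a : Module.End R R[T;T⁻¹]) (ha : a ∈ W R) :
    ∃ w : W R, w ∈ Submodule.span R (Set.range (wGen R)) ∧ (w : Module.End R R[T;T⁻¹]) = a := by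
  rw [W] at ha
  induction ha using Algebra.adjoin_induction with
  | mem x hx =>
    rcases hx with rfl | ⟨k, rfl⟩
    · have h := aeval_mul_wx_mem_span (Polynomial.X : Polynomial R) 0
      rw [wx_zero, mul_one, Polynomial.aeval_X] at h
      exact ⟨_, h, rfl⟩
    · have h := aeval_mul_wx_mem_span (1 : Polynomial R) k
      rw [map_one, one_mul] at h
      exact ⟨_, h, rfl⟩
  | algebraMap r =>
    have h := aeval_mul_wx_mem_span (Polynomial.C r : Polynomial R) 0
    rw [wx_zero, mul_one, Polynomial.aeval_C] at h
    exact ⟨_, h, rfl⟩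
  | add x y _ _ h1 h2 =>
    obtain ⟨u, hu, rfl⟩ := h1
    obtain ⟨v, hv, rfl⟩ := h2
    exact ⟨u + v, add_mem hu hv, Subalgebra.coe_add _ _ _⟩
  | mul x y _ _ h1 h2 =>
    obtain ⟨u, hu, rfl⟩ := h1
    obtain ⟨v, hv, rfl⟩ := h2
    exact ⟨u * v, mul_mem_span_wGen hu hv, Subalgebra.coe_mul _ _ _⟩

lemma wGen_span : ⊤ ≤ Submodule.span R (Set.range (wGen R)) := by
  intro a _
  obtain ⟨w, hw, h⟩ := exists_mem_span_wGen (a : Module.End R R[T;T⁻¹]) a.2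
  rwa [← Subtype.ext h]

lemma wGen_linearIndependent [Algebra ℚ R] : LinearIndependent R (wGen R) := by
  refine (injective_iff_map_eq_zero (Finsupp.linearCombination R (wGen R))).2 fun l hl => ?_
  -- Coefficient of `x ^ i` in the image of `x ^ (i - N)`.
  have hcoef : ∀ (N : ℤ) (j : ℕ),
      (l.sum fun p c => if (p.1 : ℤ) + p.2 = N then
        c * (fallPoly R p.1).eval ((j : R) + 1) else 0) = 0 := by
    intro N j
    have h := congrArg (fun a : W R =>
      ((a : Module.End R R[T;T⁻¹]) (LaurentPolynomial.T (j + 1 - N))).coeff ((j : ℤ) + 1)) hl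
    simp only [Finsupp.linearCombination_apply, Finsupp.sum, AddSubmonoidClass.coe_finsetSum,
      LinearMap.sum_apply] at h
    have h0 : (0 : R) = (((0 : W R) : Module.End R R[T;T⁻¹])
      (LaurentPolynomial.T (j + 1 - N))).coeff ((j : ℤ) + 1) := by simp
    refine Eq.trans ?_ (h.trans h0.symm)
    rw [Finsupp.sum, AddMonoidAlgebra.coeff_sum, Finsupp.finsetSum_apply]
    apply Finset.sum_congr rfl
    rintro ⟨m, k⟩ _
    rw [wGen_eq]
    simp only [Subalgebra.coe_smul, Subalgebra.coe_mul, coe_aeval_wD, LinearMap.smul_apply,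
      Module.End.mul_apply, wx, xOp_T, aeval_dOp_T, AddMonoidAlgebra.coeff_smul,
      Finsupp.smul_apply, LaurentPolynomial.T_apply, smul_eq_mul]
    by_cases hN : (m : ℤ) + k = N
    · subst hN
      simp
    · rw [if_neg hN, if_neg (by intro h; apply hN; linarith)]
      simp
  have main : ∀ (m : ℕ) (k : ℤ), l (m, k) = 0 := by
    intro m
    induction m using Nat.strong_induction_on with
    | _ m ih =>
      intro k
      have h := hcoef (m + k) m
      rw [Finsupp.sum, Finset.sum_eq_single (m, k)] at h
      · rw [if_pos rfl, eval_fallPoly_self] at h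
        have hu : IsUnit ((m.factorial : R)) := by
          have : IsUnit (algebraMap ℚ R (m.factorial : ℚ)) :=
            (IsUnit.mk0 _ (by exact_mod_cast m.factorial_ne_zero)).map _
          simpa using this
        exact hu.mul_left_eq_zero.1 h
      · rintro ⟨m', k'⟩ _ hne
        split_ifs with hN
        · rcases lt_trichotomy m' m with hlt | heq | hgt
          · rw [ih m' hlt k', zero_mul]
          · exfalso
            apply hne
            simp only at hN
            subst heq
            rw [show k' = k by linarith]
          · rw [eval_fallPoly_of_lt hgt, mul_zero]
        · rfl
      · intro hn
        rw [Finsupp.notMem_support_iff.1 hn]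
        simp
  ext ⟨m, k⟩
  exact main m k

variable (R) in
/-- The operators `(x D) ^ m x ^ k` form a basis of `w_{1+∞}`. -/
def wBasis [Algebra ℚ R] : Module.Basis (ℕ × ℤ) R (W R) :=
  Module.Basis.mk wGen_linearIndependent wGen_span

end Circle

/-! ## Bosonic operators on power series in the times `t_1, t_2, …` -/

section Bosonic

variable {R : Type*} [CommRing R]

/-- The operators `Ĵ_n`: `∂/∂t_n` for `n > 0`, multiplication by `-n t_{-n}` for `n < 0`,
and `0` for `n = 0`. -/
def J : ℤ → MvPowerSeries ℕ+ R → MvPowerSeries ℕ+ R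
  | Int.ofNat 0, _ => 0
  | Int.ofNat (k + 1), f => MvPowerSeries.pderiv R k.succPNat f
  | Int.negSucc k, f => ((k : R) + 1) • (MvPowerSeries.X k.succPNat * f)

/-- The normally ordered product of `Ĵ_b` with a normally ordered operator `Z`: operators
`Ĵ_b` with `b > 0` stand to the right of those with `b < 0`. -/
def normalMul (b : ℤ) (Z : MvPowerSeries ℕ+ R → MvPowerSeries ℕ+ R)
    (f : MvPowerSeries ℕ+ R) : MvPowerSeries ℕ+ R :=
  if b < 0 then J b (Z f) else Z (J b f)

/-- With `Ĵ(x) = ∑_b Ĵ_b x ^ (-b - 1)`, `currentCoeff m s` is the coefficient of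
`x ^ (-s - m - 1)` in the normally ordered expression `:(Ĵ(x) + ∂_x) ^ m Ĵ(x):`.
The sum over `b` has finitely many nonzero terms in the coefficient of every monomial
(see `currentCoeff_finite`). -/
def currentCoeff : ℕ → ℤ → MvPowerSeries ℕ+ R → MvPowerSeries ℕ+ R
  | 0, s => J s
  | m + 1, s => fun f d =>
      (∑ᶠ b : ℤ, MvPowerSeries.coeff d (normalMul b (currentCoeff m (s - b)) f))
        - ((s : R) + m + 1) * MvPowerSeries.coeff d (currentCoeff m s f)

/-- The weighted degree of a monomial, `t_k` having degree `k`. -/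
def wt (d : ℕ+ →₀ ℕ) : ℕ := Finsupp.weight (fun k : ℕ+ => (k : ℕ)) d

lemma coeff_J_neg (k : ℕ) (f : MvPowerSeries ℕ+ R) (d : ℕ+ →₀ ℕ) :
    MvPowerSeries.coeff d (J (Int.negSucc k) f) =
      if d k.succPNat = 0 then 0 else
        ((k : R) + 1) * MvPowerSeries.coeff (d - Finsupp.single k.succPNat 1) f := by
  classical
  simp only [J, MvPowerSeries.coeff_smul, MvPowerSeries.X, MvPowerSeries.coeff_monomial_mul,
    one_mul, Finsupp.single_le_iff]
  split_ifs with h1 h2 h2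
  · omega
  · rfl
  · simp
  · omega

lemma wt_sub_single {d : ℕ+ →₀ ℕ} {i : ℕ+} (h : d i ≠ 0) :
    wt (d - Finsupp.single i 1) + i = wt d := by
  have h1 : d - Finsupp.single i 1 + Finsupp.single i 1 = d :=
    tsub_add_cancel_of_le (by simpa [Finsupp.single_le_iff] using Nat.one_le_iff_ne_zero.2 h)
  conv_rhs => rw [← h1]
  simp [wt, Finsupp.weight_apply, Finsupp.sum_single_index, Finsupp.sum_add_index', add_mul]

lemma coeff_currentCoeff_eq_zero (m : ℕ) (s : ℤ) (f : MvPowerSeries ℕ+ R) (d : ℕ+ →₀ ℕ)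
    (h : (wt d : ℤ) < -s) : MvPowerSeries.coeff d (currentCoeff m s f) = 0 := by
  induction m generalizing s f d with
  | zero =>
    rcases s with s | k
    · simp only [Int.ofNat_eq_natCast] at h; omega
    · rw [currentCoeff, coeff_J_neg]
      split_ifs with h0
      · rfl
      · have := wt_sub_single h0
        simp only [Nat.succPNat_coe, Int.negSucc_eq] at this h
        omega
  | succ m ih =>
    change (∑ᶠ b : ℤ, MvPowerSeries.coeff d (normalMul b (currentCoeff m (s - b)) f))
        - ((s : R) + m + 1) * MvPowerSeries.coeff d (currentCoeff m s f) = 0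
    rw [ih s f d h, mul_zero, sub_zero]
    apply finsum_eq_zero_of_forall_eq_zero
    intro b
    rcases b with b | k
    · rw [normalMul, if_neg (by simp)]
      apply ih
      simp only [Int.ofNat_eq_natCast]
      omega
    · rw [normalMul, if_pos (Int.negSucc_lt_zero k), coeff_J_neg]
      split_ifs with h0
      · rfl
      · rw [ih, mul_zero]
        have := wt_sub_single h0
        simp only [Nat.succPNat_coe, Int.negSucc_eq] at this ⊢
        omega

/-- The sum over `b` in `currentCoeff` is finite. -/
lemma currentCoeff_finite (m : ℕ) (s : ℤ) (f : MvPowerSeries ℕ+ R) (d : ℕ+ →₀ ℕ) :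
    (Function.support fun b : ℤ =>
      MvPowerSeries.coeff d (normalMul b (currentCoeff m (s - b)) f)).Finite := by
  refine (Set.finite_Icc (-(wt d : ℤ)) (s + wt d)).subset ?_
  intro b hb
  by_contra hn
  apply hb
  rw [Set.mem_Icc, not_and_or] at hn
  simp only
  rcases b with b | k
  · rw [normalMul, if_neg (by simp)]
    apply coeff_currentCoeff_eq_zero
    simp only [Int.ofNat_eq_natCast] at hn ⊢
    omega
  · rw [normalMul, if_pos (Int.negSucc_lt_zero k), coeff_J_neg]
    split_ifs with h0
    · rfl
    · rw [coeff_currentCoeff_eq_zero, mul_zero]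
      have := wt_sub_single h0
      simp only [Nat.succPNat_coe, Int.negSucc_eq] at this hn ⊢
      omega

variable [Algebra ℚ R]

/-- The boson-fermion correspondence `a ↦ Ŷ_a`: the linear map on `w_{1+∞}` with
`Ŷ_{(x D) ^ m x ^ k} = Res_{x = 0} x ^ (-k) :(Ĵ(x) + ∂_x) ^ m Ĵ(x): / (m + 1) dx`. -/
def Yhat : W R →ₗ[R] (MvPowerSeries ℕ+ R → MvPowerSeries ℕ+ R) :=
  (wBasis R).constr R fun p => ((p.1 : ℚ) + 1)⁻¹ • currentCoeff p.1 (-(p.2 + p.1))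

lemma Yhat_wGen (m : ℕ) (k : ℤ) :
    Yhat (wGen R (m, k)) = ((m : ℚ) + 1)⁻¹ • currentCoeff m (-(k + m)) := by
  have h : wGen R (m, k) = wBasis R (m, k) := by simp [wBasis]
  rw [h, Yhat, Module.Basis.constr_basis]

/-- `R̂_n = ∑_{k = 0}^n (-β) ^ k ∑_{1 ≤ i_1 < ⋯ < i_k ≤ n} Ŷ_{x ^ (-n) (D - i_1) ⋯ (D - i_k)}`. -/
def Rhat (β : R) (n : ℕ) : MvPowerSeries ℕ+ R → MvPowerSeries ℕ+ R :=
  ∑ k ∈ Finset.range (n + 1), (-β) ^ k •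
    ∑ S ∈ (Finset.Icc 1 n).powersetCard k,
      Yhat (wx R (-(n : ℤ)) *
        Polynomial.aeval (wD R) (∏ i ∈ S, (Polynomial.X - Polynomial.C (i : R))))

/-- The operator `b_mm = x⁻¹ (1 - β (D - 1))`. -/
def bmm (β : R) : W R := wx R (-1) * (1 - β • (wD R - 1))

end Bosonic

/-! ## Schur functions in the times and the tau-function -/

section Tau

/-- `h_k(u)`, where `∑_k h_k(u) z ^ k = exp (∑_{j ≥ 1} u_j z ^ j)` and `h_k = 0` for `k < 0`. -/
def hTimes {A : Type*} [CommRing A] [Algebra ℚ A] (u : ℕ+ → A) : ℤ → A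
  | Int.ofNat k => PowerSeries.coeff k
      ((PowerSeries.exp A).subst
        (PowerSeries.mk fun j => if hj : 0 < j then u ⟨j, hj⟩ else 0 : PowerSeries A))
  | Int.negSucc _ => 0

/-- The `i`-th part (`i = 0, 1, …`) of a partition, in weakly decreasing order; `0` beyond the
number of parts. -/
def part {n : ℕ} (lam : n.Partition) (i : ℕ) : ℕ :=
  (lam.parts.sort (· ≥ ·)).getD i 0

/-- The Schur function `s_λ(u) = det (h_{λ_i - i + j}(u))_{1 ≤ i, j ≤ ℓ(λ)}` in the variables
`u_k = p_k / k`. -/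
def schur {A : Type*} [CommRing A] [Algebra ℚ A] (u : ℕ+ → A) {n : ℕ} (lam : n.Partition) : A :=
  Matrix.det (Matrix.of fun i j : Fin (Multiset.card lam.parts) =>
    hTimes u ((part lam i : ℤ) - (i : ℤ) + (j : ℤ)))

variable {R : Type*} [CommRing R]

/-- `∏_{i = 1}^{ℓ(λ)} ∏_{k = 0}^{λ_i - 1} 1 / (1 + β (k + i - λ_i))`. -/
def contentWeight (β : R) {n : ℕ} (lam : n.Partition) : R :=
  ∏ i ∈ Finset.Icc 1 (Multiset.card lam.parts), ∏ k ∈ Finset.range (part lam (i - 1)),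
    Ring.inverse (1 + β * ((k : R) + (i : R) - (part lam (i - 1) : R)))

/-- The tau-function
`τ_mm(t, t̃) = ∑_λ s_λ(t) s_λ(t̃) ∏_{i = 1}^{ℓ(λ)} ∏_{k = 0}^{λ_i - 1} 1 / (1 + β (k + i - λ_i))`
as a power series in `t`; the coefficient of each monomial is a finite sum, since `s_λ(t)` is
homogeneous of weighted degree `|λ|`. -/
def tauMM [Algebra ℚ R] (β : R) (t' : ℕ+ → R) : MvPowerSeries ℕ+ R := fun d =>
  ∑ᶠ n : ℕ, ∑ lam : n.Partition,
    MvPowerSeries.coeff d (schur (fun k => (MvPowerSeries.X k : MvPowerSeries ℕ+ R)) lam) *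
      (schur t' lam * contentWeight β lam)

end Tau

end MonotoneHurwitz

end

noncomputable section

namespace MonotoneHurwitz

/-! ### Powers of `bmm` in the algebra of differential operators -/

section Circle

variable {R : Type*} [CommRing R]

/-! Encode a partition by its bead positions `λ_i - i`. The determinant defining `s_λ` makes sense
for every `l : Fin N → ℤ` and is antisymmetric in the beads. In this language the eigenvalue
equation rests on three facts. (1) For `n > 0` the operator `Ŷ_{p(D) x^(-n)}` sends `s_l(t)` to the
sum over `i` of `p(l_i - n + 1)` times the function with bead `i` lowered by `n`: a bead at `c`
behaves like the monomial `x^(c+1)` (`currentCoeff_tSchur`, `Yhat_tSchur`). (2) For `R̂_n` this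
coefficient is `∏_{k<n} (1 - β (l_i - k))`, exactly the factor by which the weight of the
configuration changes under the move (`totalWeight_sub_single`). (3) Multiplication by `n u_n`
raises one bead of `s_l(u)` by `n` in all possible ways (`mul_beadSchur`). So `R̂_n τ` is a sum over
pairs of configurations that differ by one move, weighted by the lower one. Summing over the upper
member first produces the factor `n t̃_n` (`sum_moveDown_eq_sum_moveUp`, `Rhat_schurSeries`).

The core is (1). Both sides are compared through their constant terms and all `∂/∂t_r`, by induction
on the weighted degree. For the derivatives, the commutator of `∂/∂t_r` with a current matches the
Vandermonde convolution of falling factorials. For the constant terms, the recursion in `m` produces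
moves of two beads into the vacuum; antisymmetry cancels all of these except those that amount to a
move of one bead, and a telescoping sum of falling factorials finishes.

For uniqueness, make the second times formal. The coefficients `tauCoeff β e` of the universal
series satisfy `R̂_n tauCoeff_e = n tauCoeff_{e - δ_n}`. In each degree their matrix is `S
diag(weights) Sᵀ`, where `S` holds the coefficients of the Schur functions. At `β = 0` one has `R̂_n
= ∂/∂t_n` and this matrix is diagonal with unit entries, so `S` is invertible, and hence so is the
matrix for every admissible `β`. A solution without constant term, expanded in this basis, vanishes
degree by degree (`eq_zero_of_Rhat_eq_smul`); this is applied to `f - f(0) τ`.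

The identity `R̂_n = Ŷ_{b^n}` is the expansion of `b^n = x^(-n) ∏_{i=1}^n (1 - β (D - i))`. -/

lemma fallPoly_span (p : Polynomial R) : p ∈ Submodule.span R (Set.range (fallPoly R)) := by
  have hX : ∀ p ∈ Submodule.span R (Set.range (fallPoly R)),
      Polynomial.X * p ∈ Submodule.span R (Set.range (fallPoly R)) := by
    intro p hp
    induction hp using Submodule.span_induction with
    | mem x hx =>
      obtain ⟨m, rfl⟩ := hx
      have : Polynomial.X * fallPoly R m
          = fallPoly R (m + 1) + ((m : R) + 1) • fallPoly R m := by
        rw [fallPoly, fallPoly, Finset.prod_range_succ, Polynomial.smul_eq_C_mul]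
        ring
      rw [this]
      exact add_mem (Submodule.subset_span ⟨_, rfl⟩)
        (Submodule.smul_mem _ _ (Submodule.subset_span ⟨_, rfl⟩))
    | zero => simp
    | add x y _ _ hx hy => rw [mul_add]; exact add_mem hx hy
    | smul a x _ hx => rw [mul_smul_comm]; exact Submodule.smul_mem _ _ hx
  have hpow : ∀ n : ℕ, (Polynomial.X : Polynomial R) ^ n
      ∈ Submodule.span R (Set.range (fallPoly R)) := by
    intro n
    induction n with
    | zero => exact Submodule.subset_span ⟨0, by simp [fallPoly]⟩
    | succ n ih => rw [pow_succ']; exact hX _ ih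
  induction p using Polynomial.induction_on' with
  | add p q hp hq => exact add_mem hp hq
  | monomial n a =>
    rw [← Polynomial.smul_X_eq_monomial]
    exact Submodule.smul_mem _ _ (hpow n)

/-- `∏_{i = 1}^n (1 - β (X - i))`. -/
def ladderPoly (β : R) (n : ℕ) : Polynomial R :=
  ∏ i ∈ Finset.Icc 1 n, (1 - Polynomial.C β * (Polynomial.X - Polynomial.C (i : R)))

/-- A new factor `bmm β` on the left has to pass `x^(-n)`; this shifts `D` by `n` and produces the
factor `1 - β (D - (n + 1))`. -/
lemma bmm_pow (β : R) (n : ℕ) :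
    bmm β ^ n = wx R (-(n : ℤ)) * Polynomial.aeval (wD R) (ladderPoly β n) := by
  induction n with
  | zero => simp [ladderPoly, wx_zero]
  | succ n ih =>
    have hb : bmm β = wx R (-1) *
        Polynomial.aeval (wD R) (1 - Polynomial.C β * (Polynomial.X - Polynomial.C (1 : R))) := by
      simp [bmm, Algebra.smul_def]
    have key : Polynomial.aeval (wD R)
          (1 - Polynomial.C β * (Polynomial.X - Polynomial.C (1 : R))) * wx R (-(n : ℤ))
        = wx R (-(n : ℤ)) * Polynomial.aeval (wD R)
          (1 - Polynomial.C β * (Polynomial.X - Polynomial.C ((n : R) + 1))) := by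
      have h2 := wx_mul_aeval (-(n : ℤ))
        (1 - Polynomial.C β * (Polynomial.X - Polynomial.C ((n : R) + 1)))
      rw [h2]
      congr 2
      simp only [Polynomial.sub_comp, Polynomial.mul_comp, Polynomial.X_comp, Polynomial.C_comp,
        Polynomial.one_comp, Int.cast_neg, Int.cast_natCast, map_neg]
      rw [map_add, map_one]
      ring
    have hl : ladderPoly β (n + 1) = (1 - Polynomial.C β * (Polynomial.X
        - Polynomial.C ((n : R) + 1))) * ladderPoly β n := by
      rw [ladderPoly, Finset.prod_Icc_succ_top (by omega), mul_comm, ladderPoly]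
      push_cast
      rfl
    rw [pow_succ', ih, hl, map_mul, hb, mul_assoc, ← mul_assoc _ (wx R (-(n : ℤ))), key,
      ← mul_assoc, ← mul_assoc, ← mul_assoc, wx_mul, mul_assoc, mul_assoc]
    congr 2
    push_cast
    ring

lemma ladderPoly_eq_sum (β : R) (n : ℕ) :
    ladderPoly β n = ∑ k ∈ Finset.range (n + 1), (-β) ^ k •
      ∑ S ∈ (Finset.Icc 1 n).powersetCard k,
        ∏ i ∈ S, (Polynomial.X - Polynomial.C (i : R)) := by
  have h : ladderPoly β n = ∏ i ∈ Finset.Icc 1 n,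
      (1 + (-Polynomial.C β) * (Polynomial.X - Polynomial.C (i : R))) := by
    unfold ladderPoly
    refine Finset.prod_congr rfl fun i _ => by ring
  rw [h, Finset.prod_one_add, Finset.sum_powerset]
  simp only [Nat.card_Icc, Nat.add_sub_cancel]
  refine Finset.sum_congr rfl fun k _ => ?_
  rw [Finset.smul_sum]
  refine Finset.sum_congr rfl fun S hS => ?_
  rw [Finset.prod_mul_distrib, Finset.prod_const, (Finset.mem_powersetCard.1 hS).2,
    Polynomial.smul_eq_C_mul]
  simp

lemma eval_ladderPoly (β x : R) (n : ℕ) :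
    (ladderPoly β n).eval x = ∏ i ∈ Finset.Icc 1 n, (1 - β * (x - i)) := by
  simp [ladderPoly, Polynomial.eval_prod]

lemma Rhat_eq_Yhat [Algebra ℚ R] (β : R) (n : ℕ) : Rhat β n = Yhat (bmm β ^ n) := by
  rw [bmm_pow, ladderPoly_eq_sum, Rhat]
  simp only [map_sum, map_smul, Finset.mul_sum, mul_smul_comm, Finset.smul_sum]

end Circle

/-! ### Determinants indexed by bead positions -/

section Determinants

variable {A : Type*} [CommRing A]

/-- The determinant `det (h_{l_i + j})` for a sequence `l` of (not necessarily ordered) bead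
positions. -/
def beadDet (h : ℤ → A) {N : ℕ} (l : Fin N → ℤ) : A :=
  Matrix.det (Matrix.of fun i j : Fin N => h (l i + j + 1))

lemma beadDet_comp_perm (h : ℤ → A) {N : ℕ} (l : Fin N → ℤ) (σ : Equiv.Perm (Fin N)) :
    beadDet h (l ∘ σ) = (Equiv.Perm.sign σ : ℤ) * beadDet h l := by
  rw [beadDet, beadDet, ← Matrix.det_permute]
  rfl

lemma beadDet_eq_zero_of_not_injective (h : ℤ → A) {N : ℕ} {l : Fin N → ℤ}
    (hl : ¬ Function.Injective l) : beadDet h l = 0 := by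
  simp only [Function.Injective, not_forall] at hl
  obtain ⟨i, j, hij, hne⟩ := hl
  exact Matrix.det_zero_of_row_eq hne (by ext k; simp [hij])

lemma beadDet_eq_zero_of_row (h : ℤ → A) {N : ℕ} {l : Fin N → ℤ} (i : Fin N)
    (hi : ∀ j : Fin N, h (l i + j + 1) = 0) : beadDet h l = 0 :=
  Matrix.det_eq_zero_of_row_eq_zero i hi

lemma beadDet_eq_zero_of_lt {h : ℤ → A} (hneg : ∀ k < 0, h k = 0) {N : ℕ} {l : Fin N → ℤ}
    (i : Fin N) (hi : l i < -N) : beadDet h l = 0 :=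
  beadDet_eq_zero_of_row h i fun j => hneg _ (by have := j.2; omega)

lemma map_beadDet {B : Type*} [CommRing B] (φ : A →+* B) (h : ℤ → A) {N : ℕ} (l : Fin N → ℤ) :
    φ (beadDet h l) = beadDet (fun k => φ (h k)) l := by
  rw [beadDet, RingHom.map_det]
  rfl

/-- Adding one vacuum bead at the bottom does not change the determinant. -/
lemma beadDet_snoc {h : ℤ → A} (hneg : ∀ k < 0, h k = 0) (h0 : h 0 = 1) {N : ℕ}
    (l : Fin (N + 1) → ℤ) (hl : l (Fin.last N) = -(N + 1)) :
    beadDet h l = beadDet h (fun i : Fin N => l i.castSucc) := by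
  -- The entries of the bottom row are `h_{j - N}`, so this row is `(0, …, 0, 1)`.
  rw [beadDet, Matrix.det_succ_row _ (Fin.last N), Finset.sum_eq_single (Fin.last N)]
  · simp only [Matrix.of_apply, hl, Fin.val_last, Fin.succAbove_last]
    rw [show (-((N : ℤ) + 1) + N + 1) = 0 by ring, h0]
    simp only [← two_mul, pow_mul, beadDet]
    norm_num
    rfl
  · intro j _ hj
    have : (j : ℕ) < N := by
      have := j.2
      have h2 : (j : ℕ) ≠ N := fun h => hj (Fin.ext h)
      omega
    simp only [Matrix.of_apply, hl]
    rw [hneg _ (by omega)]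
    ring
  · simp

lemma beadDet_extend {h : ℤ → A} (hneg : ∀ k < 0, h k = 0) (h0 : h 0 = 1) (l : ℕ → ℤ) {M N : ℕ}
    (hMN : M ≤ N) (hl : ∀ i, M ≤ i → l i = -((i : ℤ) + 1)) :
    beadDet h (fun i : Fin N => l i) = beadDet h (fun i : Fin M => l i) := by
  induction N, hMN using Nat.le_induction with
  | base => rfl
  | succ N hN ih =>
    rw [beadDet_snoc hneg h0 _ (by simpa using hl N hN), ← ih]
    rfl

/-- A derivation with `∂ h_k = h_{k - r}` acts on bead determinants by moving one bead down. -/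
lemma derivation_beadDet {B : Type*} [CommRing B] [Algebra B A] (D : Derivation B A A) (r : ℤ)
    (h : ℤ → A) (hD : ∀ k, D (h k) = h (k - r)) {N : ℕ} (l : Fin N → ℤ) :
    D (beadDet h l) = ∑ i, beadDet h (l - Pi.single i r) := by
  classical
  have hprod : ∀ (s : Finset (Fin N)) (f : Fin N → A),
      D (∏ i ∈ s, f i) = ∑ i ∈ s, ∏ k ∈ s, if k = i then D (f k) else f k := by
    intro s f
    induction s using Finset.induction_on with
    | empty => simp
    | insert a s ha ih =>
      rw [Finset.prod_insert ha, Derivation.leibniz, ih, Finset.sum_insert ha,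
        Finset.prod_insert ha, if_pos rfl, smul_eq_mul, smul_eq_mul, add_comm, mul_comm]
      congr 1
      · congr 1
        refine Finset.prod_congr rfl fun k hk => ?_
        rw [if_neg (by rintro rfl; exact ha hk)]
      · rw [Finset.mul_sum]
        refine Finset.sum_congr rfl fun i hi => ?_
        rw [Finset.prod_insert ha, if_neg (by rintro rfl; exact ha hi)]
  simp only [beadDet, Matrix.det_apply, map_sum, Matrix.of_apply]
  rw [Finset.sum_comm]
  refine Finset.sum_congr rfl fun σ _ => ?_
  rw [Units.smul_def, map_zsmul, hprod, Finset.smul_sum]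
  -- In the term of `σ` the factor with column `i` sits in row `σ i`, so differentiating it moves
  -- bead `σ i`.
  refine Fintype.sum_equiv σ _ _ fun i => ?_
  rw [Units.smul_def]
  congr 1
  refine Finset.prod_congr rfl fun k _ => ?_
  by_cases hk : k = i
  · subst hk
    rw [if_pos rfl, hD]
    congr 1
    simp
    ring
  · rw [if_neg hk]
    congr 1
    have : σ k ≠ σ i := fun h => hk (σ.injective h)
    simp [this]

end Determinants

/-! ### Multiplication by power sums as raising of beads -/

section Newton

variable {A : Type*} [CommRing A]

/-- The sum over all beads of the determinant with that bead moved up by `n`, as a trace. -/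
lemma sum_beadDet_add (h : ℤ → A) {N : ℕ} (l : Fin N → ℤ) (n : ℤ) :
    ∑ i, beadDet h (l + Pi.single i n)
      = ∑ j, ∑ i, (Matrix.of fun i j : Fin N => h (l i + j + 1)).adjugate j i
          * h (l i + n + j + 1) := by
  rw [Finset.sum_comm]
  refine Finset.sum_congr rfl fun i _ => ?_
  rw [beadDet, Matrix.det_eq_sum_mul_adjugate_row _ i]
  refine Finset.sum_congr rfl fun j _ => ?_
  rw [mul_comm]
  congr 1
  · rw [Matrix.adjugate_apply, Matrix.adjugate_apply]
    congr 1
    ext a b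
    by_cases ha : a = i
    · subst ha; simp
    · simp [Matrix.updateRow_apply, ha, Pi.single_apply]
  · simp

lemma sum_range_sum_range_succ (g : ℕ → A) (n : ℕ) :
    ∑ j ∈ Finset.range n, ∑ d ∈ Finset.range (j + 1), g d
      = ∑ d ∈ Finset.range n, ((n - d : ℕ) : A) * g d := by
  induction n with
  | zero => simp
  | succ n ih =>
    rw [Finset.sum_range_succ, ih, Finset.sum_range_succ, Finset.sum_range_succ, ← add_assoc,
      ← Finset.sum_add_distrib]
    congr 1
    · refine Finset.sum_congr rfl fun d hd => ?_
      rw [Nat.succ_sub (Finset.mem_range.1 hd).le]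
      push_cast
      ring
    · simp

lemma sum_fin_ite_le (N a : ℕ) (ha : a ≤ N) (g : ℕ → A) :
    ∑ c : Fin N, (if a ≤ (c : ℕ) then g (c - a) else 0) = ∑ d ∈ Finset.range (N - a), g d := by
  rw [Fin.sum_univ_eq_sum_range (fun c => if a ≤ c then g (c - a) else 0) N,
    ← Finset.sum_range_add_sum_Ico _ ha, Finset.sum_eq_zero, zero_add,
    Finset.sum_Ico_eq_sum_range]
  · refine Finset.sum_congr rfl fun d _ => ?_
    rw [if_pos (by omega), Nat.add_sub_cancel_left]
  · intro c hc
    rw [if_neg (by have := Finset.mem_range.1 hc; omega)]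

/-- Newton's identities: if `k h_k = ∑_j p_j h_{k - j}`, then multiplication by `p_n` moves beads
up by `n`. -/
lemma mul_beadDet {h : ℤ → A} (hneg : ∀ k < 0, h k = 0) (h0 : h 0 = 1) (p : ℕ → A)
    (hp : ∀ k : ℕ, (k : A) * h k
      = ∑ x ∈ Finset.HasAntidiagonal.antidiagonal k, p x.1 * h x.2)
    {N : ℕ} (l : Fin N → ℤ) (n : ℕ) (hn : 0 < n) (hnN : n ≤ N)
    (hl : ∀ a : Fin N, N ≤ a + n → ∃ i, l i = -((a : ℤ) + 1)) :
    p n * beadDet h l = ∑ i, beadDet h (l + Pi.single i (n : ℤ)) := by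
  classical
  -- The inverse series.
  obtain ⟨e, he⟩ : ∃ e : ℕ → A, ∀ k : ℕ,
      ∑ x ∈ Finset.HasAntidiagonal.antidiagonal k, e x.1 * h x.2 = if k = 0 then 1 else 0 := by
    have hu : PowerSeries.constantCoeff (PowerSeries.mk fun k : ℕ => h k) = ((1 : Aˣ) : A) := by
      simp [h0]
    refine ⟨fun k => PowerSeries.coeff k (PowerSeries.invOfUnit
      (PowerSeries.mk fun k : ℕ => h k) 1), fun k => ?_⟩
    have := congrArg (PowerSeries.coeff k) (PowerSeries.mul_invOfUnit _ _ hu)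
    rw [mul_comm, PowerSeries.coeff_mul, PowerSeries.coeff_one] at this
    simpa using this
  set M : Matrix (Fin N) (Fin N) A := Matrix.of fun i j : Fin N => h (l i + j + 1) with hM
  have hι : ∀ a : Fin N, ∃ i, N ≤ a + n → l i = -((a : ℤ) + 1) := by
    intro a
    by_cases ha : N ≤ a + n
    · obtain ⟨i, hi⟩ := hl a ha
      exact ⟨i, fun _ => hi⟩
    · exact ⟨a, fun h => absurd h ha⟩
  choose ι hι using hι
  -- Row `a` of the adjugate for the lowest columns.
  have hadj : ∀ a : Fin N, N ≤ a + n → ∀ i, M.adjugate a i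
      = M.det * ∑ c : Fin N, if (a : ℕ) ≤ c then (if ι c = i then e (c - a) else 0) else 0 := by
    intro a ha
    -- The vacuum beads `-(c + 1)` with `c ≥ a` give rows `h_{b - c}`. Combining these rows with the
    -- coefficients of the inverse series gives the `a`-th unit vector, so row `a` of the adjugate
    -- is `det M • v`; the determinant need not be invertible.
    set v : Fin N → A := fun i =>
      ∑ c : Fin N, if (a : ℕ) ≤ c then (if ι c = i then e (c - a) else 0) else 0 with hv
    have hvM : Matrix.vecMul v M = Pi.single a 1 := by
      ext b
      have h1 : Matrix.vecMul v M b
          = ∑ c : Fin N, if (a : ℕ) ≤ c then e (c - a) * h ((b : ℤ) - c) else 0 := by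
        simp only [Matrix.vecMul, dotProduct, hv, Finset.sum_mul]
        rw [Finset.sum_comm]
        refine Finset.sum_congr rfl fun c _ => ?_
        split_ifs with hc
        · rw [Finset.sum_eq_single (ι c)]
          · rw [if_pos rfl, hM, Matrix.of_apply, hι c (by omega)]
            congr 2
            ring
          · intro i _ hi
            rw [if_neg (Ne.symm hi), zero_mul]
          · simp
        · simp
      have h2 : ∀ c : Fin N, (if (a : ℕ) ≤ c then e (c - a) * h ((b : ℤ) - c) else 0)
          = if (a : ℕ) ≤ c then (fun d : ℕ => e d * h ((b : ℤ) - a - d)) (c - a) else 0 := by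
        intro c
        split_ifs with hc
        · simp only
          congr 2
          rw [Nat.cast_sub hc]
          ring
        · rfl
      rw [h1, Finset.sum_congr rfl fun c _ => h2 c, 
        sum_fin_ite_le N a a.2.le (fun d : ℕ => e d * h ((b : ℤ) - a - d))]
      by_cases hab : (a : ℕ) ≤ b
      · have h3 := he (b - a)
        rw [Finset.Nat.sum_antidiagonal_eq_sum_range_succ_mk] at h3
        have hsub : Finset.range (b - a : ℕ).succ ⊆ Finset.range (N - a) := by
          intro x hx
          have := b.2
          simp only [Finset.mem_range] at hx ⊢
          omega
        rw [← Finset.sum_subset hsub, Finset.sum_congr rfl, h3]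
        · by_cases h : b = a
          · subst h; simp
          · have : (b : ℕ) - a ≠ 0 := by
              intro h'; exact h (Fin.ext (by omega))
            simp [this, h]
        · intro d hd
          have := Finset.mem_range.1 hd
          congr 2
          push_cast [Nat.cast_sub hab, Nat.cast_sub (show d ≤ b - a by omega)]
          ring
        · intro d _ hd
          rw [hneg, mul_zero]
          rw [Finset.mem_range] at hd
          omega
      · rw [Finset.sum_eq_zero, Pi.single_apply, if_neg]
        · rintro rfl; exact hab le_rfl
        · intro d _
          rw [hneg _ (by omega), mul_zero]
    have h3 : Matrix.vecMul (Pi.single a 1) M.adjugate = M.det • v := by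
      rw [← hvM, Matrix.vecMul_vecMul, Matrix.mul_adjugate, Matrix.vecMul_smul, Matrix.vecMul_one]
    intro i
    have h4 := congrFun h3 i
    have h5 : M.adjugate a i = M.det * v i := by simpa using h4
    exact h5
  -- If `j + n < N`, the shifted column is column `j + n` of `M` itself, and the sum is an
  -- off-diagonal entry of `adj M * M`. Only the last `n` columns contribute.
  have hcol : ∀ j : Fin N, ∑ i, M.adjugate j i * h (l i + n + j + 1)
      = if N ≤ (j : ℕ) + n then
          M.det * ∑ d ∈ Finset.range (N - j), e d * h ((n : ℤ) - d) else 0 := by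
    intro j
    split_ifs with hj
    · simp only [hadj j hj, mul_assoc, ← Finset.mul_sum]
      congr 1
      simp only [Finset.sum_mul]
      rw [Finset.sum_comm, ← sum_fin_ite_le N j j.2.le]
      refine Finset.sum_congr rfl fun c _ => ?_
      split_ifs with hc
      · rw [Finset.sum_eq_single (ι c)]
        · rw [if_pos rfl, hι c (by omega)]
          congr 2
          rw [Nat.cast_sub hc]
          ring
        · intro i _ hi
          rw [if_neg (Ne.symm hi), zero_mul]
        · simp
      · simp
    · have h1 := congrFun (congrFun M.adjugate_mul j) ⟨j + n, by omega⟩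
      rw [Matrix.mul_apply] at h1
      rw [Matrix.smul_apply, Matrix.one_apply_ne, smul_zero] at h1
      · rw [← h1]
        refine Finset.sum_congr rfl fun i _ => ?_
        rw [hM, Matrix.of_apply]
        congr 2
        push_cast
        ring
      · intro h
        have := congrArg Fin.val h
        simp only at this
        omega
  -- Newton's identities say `P H = z H'`, hence `P = E z H'` for `E = 1 / H`.
  have hpn : p n = ∑ x ∈ Finset.HasAntidiagonal.antidiagonal n, e x.1 * (x.2 * h x.2) := by
    set H : PowerSeries A := PowerSeries.mk fun k : ℕ => h k
    set E : PowerSeries A := PowerSeries.mk e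
    set P : PowerSeries A := PowerSeries.mk p
    have hEH : E * H = 1 := by
      ext k
      simpa [H, E, PowerSeries.coeff_mul, PowerSeries.coeff_one] using he k
    have hPH : P * H = PowerSeries.mk fun k : ℕ => (k : A) * h k := by
      ext k
      simpa [P, H, PowerSeries.coeff_mul] using (hp k).symm
    have : P = E * (PowerSeries.mk fun k : ℕ => (k : A) * h k) := by
      rw [← hPH, mul_left_comm, hEH, mul_one]
    have h2 := congrArg (PowerSeries.coeff n) this
    simpa [P, E, PowerSeries.coeff_mul] using h2
  rw [sum_beadDet_add, Finset.sum_congr rfl fun j _ => hcol j]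
  rw [Fin.sum_univ_eq_sum_range (fun j => if N ≤ j + n then
    M.det * ∑ d ∈ Finset.range (N - j), e d * h ((n : ℤ) - d) else 0) N,
    ← Finset.sum_range_reflect]
  have h5 : ∀ j ∈ Finset.range N, (if N ≤ N - 1 - j + n then
      M.det * ∑ d ∈ Finset.range (N - (N - 1 - j)), e d * h ((n : ℤ) - d) else 0)
      = if j < n then M.det * ∑ d ∈ Finset.range (j + 1), e d * h ((n : ℤ) - d) else 0 := by
    intro j hj
    have hj := Finset.mem_range.1 hj
    rw [show N - (N - 1 - j) = j + 1 by omega]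
    congr 1
    apply propext
    omega
  rw [Finset.sum_congr rfl h5, ← Finset.sum_filter,
    show (Finset.range N).filter (· < n) = Finset.range n by
      ext j; simp only [Finset.mem_filter, Finset.mem_range]; omega,
    ← Finset.mul_sum, sum_range_sum_range_succ, mul_comm, hpn,
    Finset.Nat.sum_antidiagonal_eq_sum_range_succ_mk, Finset.sum_range_succ]
  simp only [Nat.sub_self, Nat.cast_zero, zero_mul, mul_zero, add_zero]
  change M.det * _ = _
  congr 1
  refine Finset.sum_congr rfl fun d hd => ?_
  have := (Finset.mem_range.1 hd).le
  rw [Nat.cast_sub this, Nat.cast_sub this]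
  ring

end Newton

/-! ### Schur functions in the times as bead determinants -/

section Times

variable {A : Type*} [CommRing A] [Algebra ℚ A]

lemma hTimes_of_neg (u : ℕ+ → A) (k : ℤ) (hk : k < 0) : hTimes u k = 0 := by
  rcases k with k | k
  · simp only [Int.ofNat_eq_natCast] at hk; omega
  · rfl

/-- The power series `∑_{j ≥ 1} u_j z ^ j`. -/
def timesSeries (u : ℕ+ → A) : PowerSeries A :=
  PowerSeries.mk fun j => if hj : 0 < j then u ⟨j, hj⟩ else 0

lemma hTimes_natCast (u : ℕ+ → A) (k : ℕ) :
    hTimes u k = PowerSeries.coeff k ((PowerSeries.exp A).subst (timesSeries u)) := rfl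

omit [Algebra ℚ A] in
lemma hasSubst_timesSeries (u : ℕ+ → A) : PowerSeries.HasSubst (timesSeries u) :=
  PowerSeries.HasSubst.of_constantCoeff_zero' (by simp [timesSeries])

lemma hTimes_zero (u : ℕ+ → A) : hTimes u 0 = 1 := by
  have h := hTimes_natCast u 0
  rw [Nat.cast_zero] at h
  have h0 : PowerSeries.constantCoeff (timesSeries u) = 0 := by simp [timesSeries]
  have h1 : PowerSeries.constantCoeff
      ((PowerSeries.exp A - 1).subst (timesSeries u) : PowerSeries A) = 0 :=
    PowerSeries.constantCoeff_subst_eq_zero h0 _ (by simp)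
  rw [← PowerSeries.coe_substAlgHom (hasSubst_timesSeries u), map_sub, map_sub, map_one, map_one,
    PowerSeries.coe_substAlgHom, sub_eq_zero] at h1
  rw [h, PowerSeries.coeff_zero_eq_constantCoeff_apply, h1]

/-- The sequence `0, u_1, 2 u_2, 3 u_3, …`. -/
def powerSums (u : ℕ+ → A) (j : ℕ) : A :=
  if hj : 0 < j then (j : A) * u ⟨j, hj⟩ else 0

omit [Algebra ℚ A] in
lemma powerSums_coe (u : ℕ+ → A) (n : ℕ+) : powerSums u n = (n : A) * u n := by
  simp only [powerSums, n.pos, dif_pos]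
  rfl

/-- Coefficient form of `z H' = (z U') H` for `H = exp U`. -/
lemma natCast_mul_hTimes (u : ℕ+ → A) (k : ℕ) :
    (k : A) * hTimes u k
      = ∑ x ∈ Finset.HasAntidiagonal.antidiagonal k, powerSums u x.1 * hTimes u x.2 := by
  simp only [hTimes_natCast]
  set H := (PowerSeries.exp A).subst (timesSeries u) with hH
  have hd : PowerSeries.derivative A H = H * PowerSeries.derivative A (timesSeries u) := by
    rw [hH, PowerSeries.derivative_subst (hasSubst_timesSeries u), PowerSeries.derivative_exp]
  have h1 : PowerSeries.X * PowerSeries.derivative A H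
      = (PowerSeries.X * PowerSeries.derivative A (timesSeries u)) * H := by
    rw [hd]; ring
  have hX : ∀ (f : PowerSeries A) (k : ℕ),
      PowerSeries.coeff k (PowerSeries.X * PowerSeries.derivative A f)
        = (k : A) * PowerSeries.coeff k f := by
    intro f k
    rcases k with _ | k
    · simp
    · rw [PowerSeries.coeff_succ_X_mul, PowerSeries.coeff_derivative, mul_comm]
      push_cast; rfl
  have h2 := congrArg (PowerSeries.coeff k) h1
  rw [hX, PowerSeries.coeff_mul] at h2
  rw [h2]
  refine Finset.sum_congr rfl fun x _ => ?_
  rw [hX]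
  congr 1
  simp only [timesSeries, PowerSeries.coeff_mk, powerSums]
  split_ifs <;> simp

/-- Bead determinants of the `h_k(u)`; for strictly decreasing bead positions these are Schur
functions. -/
def beadSchur (u : ℕ+ → A) {N : ℕ} (l : Fin N → ℤ) : A :=
  beadDet (hTimes u) l

/-- The bead positions `λ_i - i` of a partition. -/
def beads {n : ℕ} (lam : n.Partition) (N : ℕ) (i : Fin N) : ℤ :=
  (part lam i : ℤ) - (i + 1)

lemma part_eq_zero {n : ℕ} (lam : n.Partition) {i : ℕ} (hi : Multiset.card lam.parts ≤ i) :
    part lam i = 0 :=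
  List.getD_eq_default _ _ (by simpa using hi)

lemma schur_eq_beadSchur (u : ℕ+ → A) {n : ℕ} (lam : n.Partition) {N : ℕ}
    (hN : Multiset.card lam.parts ≤ N) : schur u lam = beadSchur u (beads lam N) := by
  have h := beadDet_extend (hTimes_of_neg u) (hTimes_zero u)
    (fun i => (part lam i : ℤ) - (i + 1)) hN (fun i hi => by simp [part_eq_zero lam hi])
  rw [beadSchur]
  refine Eq.trans ?_ h.symm
  rw [schur, beadDet]
  congr 1
  ext i j
  simp only [Matrix.of_apply]
  congr 1
  ring

lemma beadSchur_comp_perm (u : ℕ+ → A) {N : ℕ} (l : Fin N → ℤ) (σ : Equiv.Perm (Fin N)) :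
    beadSchur u (l ∘ σ) = (Equiv.Perm.sign σ : ℤ) * beadSchur u l :=
  beadDet_comp_perm _ _ _

lemma beadSchur_eq_zero_of_not_injective (u : ℕ+ → A) {N : ℕ} {l : Fin N → ℤ}
    (hl : ¬ Function.Injective l) : beadSchur u l = 0 :=
  beadDet_eq_zero_of_not_injective _ hl

lemma beadSchur_eq_zero_of_lt (u : ℕ+ → A) {N : ℕ} {l : Fin N → ℤ} (i : Fin N)
    (hi : l i < -N) : beadSchur u l = 0 :=
  beadDet_eq_zero_of_lt (hTimes_of_neg u) i hi

lemma mul_beadSchur (u : ℕ+ → A) {N : ℕ} (l : Fin N → ℤ) (n : ℕ+) (hnN : (n : ℕ) ≤ N)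
    (hl : ∀ a : Fin N, N ≤ a + (n : ℕ) → ∃ i, l i = -((a : ℤ) + 1)) :
    (n : A) * u n * beadSchur u l = ∑ i, beadSchur u (l + Pi.single i (n : ℤ)) := by
  rw [← powerSums_coe]
  exact mul_beadDet (hTimes_of_neg u) (hTimes_zero u) _ (natCast_mul_hTimes u) l n n.pos hnN hl

end Times

/-! ### Derivatives and constant terms of Schur functions -/

section PowerSeriesTimes

variable {R : Type*} [CommRing R] [Algebra ℚ R]

lemma isUnit_natCast_of_ne_zero {n : ℕ} (hn : n ≠ 0) : IsUnit (n : R) := by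
  have : IsUnit (algebraMap ℚ R (n : ℚ)) := (IsUnit.mk0 _ (by exact_mod_cast hn)).map _
  simpa using this

lemma sum_powerSums_mul_hTimes_sub {A : Type*} [CommRing A] [Algebra ℚ A] (u : ℕ+ → A)
    (k r : ℕ) :
    ∑ j ∈ Finset.range (k + 1), powerSums u j * hTimes u ((k : ℤ) - j - r)
      = ((k : A) - r) * hTimes u ((k : ℤ) - r) := by
  rcases lt_or_ge k r with hk | hk
  · rw [hTimes_of_neg u _ (by omega), mul_zero]
    exact Finset.sum_eq_zero fun j _ => by rw [hTimes_of_neg u _ (by omega), mul_zero]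
  · have h := natCast_mul_hTimes u (k - r)
    rw [Finset.Nat.sum_antidiagonal_eq_sum_range_succ_mk, Nat.cast_sub hk, Nat.cast_sub hk] at h
    rw [h, ← Finset.sum_subset (Finset.range_subset_range.2 (show (k - r).succ ≤ k + 1 by omega))]
    · refine Finset.sum_congr rfl fun j hj => ?_
      have := Finset.mem_range.1 hj
      congr 2
      omega
    · intro j _ hj
      rw [Finset.mem_range] at hj
      rw [hTimes_of_neg u _ (by omega), mul_zero]

omit [Algebra ℚ R] in
lemma pderiv_powerSums (r : ℕ+) (j : ℕ) :
    MvPowerSeries.pderiv R r (powerSums (fun j => (MvPowerSeries.X j : MvPowerSeries ℕ+ R)) j)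
      = if j = r then ((r : ℕ) : MvPowerSeries ℕ+ R) else 0 := by
  rcases Nat.eq_zero_or_pos j with rfl | hj
  · simp [powerSums, r.pos.ne]
  obtain ⟨m, rfl⟩ : ∃ m : ℕ+, (m : ℕ) = j := ⟨⟨j, hj⟩, rfl⟩
  rw [powerSums_coe, Derivation.leibniz, Derivation.map_natCast, smul_zero, add_zero, smul_eq_mul]
  by_cases h : m = r
  · subst h
    simp
  · rw [MvPowerSeries.pderiv_X_of_ne h, mul_zero, if_neg (fun h' => h (PNat.coe_injective h'))]

/-- Differentiating Newton's identity for `k h_k` and using induction gives `(k - r) h_{k-r} + r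
h_{k-r}`; the factor `k` is a unit and cancels. -/
lemma pderiv_hTimes (r : ℕ+) (k : ℤ) :
    MvPowerSeries.pderiv R r (hTimes (fun j => (MvPowerSeries.X j : MvPowerSeries ℕ+ R)) k)
      = hTimes (fun j => (MvPowerSeries.X j : MvPowerSeries ℕ+ R)) (k - (r : ℕ)) := by
  set u : ℕ+ → MvPowerSeries ℕ+ R := fun j => MvPowerSeries.X j with hu
  rcases lt_or_ge k 0 with hk | hk
  · rw [hTimes_of_neg u _ hk, hTimes_of_neg u _ (by have := r.pos; omega), map_zero]
  lift k to ℕ using hk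
  induction k using Nat.strong_induction_on with
  | _ k ih =>
    rcases Nat.eq_zero_or_pos k with rfl | hk
    · rw [Nat.cast_zero, hTimes_zero, hTimes_of_neg u _ (by have := r.pos; omega),
        MvPowerSeries.pderiv_one]
    have h1 := congrArg (MvPowerSeries.pderiv R r) (natCast_mul_hTimes u k)
    rw [Finset.Nat.sum_antidiagonal_eq_sum_range_succ_mk, Derivation.leibniz,
      Derivation.map_natCast, smul_zero, add_zero, map_sum] at h1
    have h2 : ∀ j ∈ Finset.range k.succ,
        MvPowerSeries.pderiv R r (powerSums u j * hTimes u ((k - j : ℕ) : ℤ))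
        = powerSums u j * hTimes u ((k : ℤ) - j - (r : ℕ))
          + if j = r then hTimes u ((k : ℤ) - (r : ℕ)) * (r : ℕ) else 0 := by
      intro j hj
      have hj := Finset.mem_range.1 hj
      rw [Derivation.leibniz, hu, pderiv_powerSums, ← hu, smul_eq_mul, smul_eq_mul]
      congr 1
      · rcases Nat.eq_zero_or_pos j with rfl | hj0
        · simp [powerSums]
        · rw [ih _ (by omega), Nat.cast_sub (by omega)]
      · split_ifs with h
        · subst h
          rw [Nat.cast_sub (by omega)]
        · simp
    rw [Finset.sum_congr rfl h2, Finset.sum_add_distrib, Nat.succ_eq_add_one,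
      sum_powerSums_mul_hTimes_sub, Finset.sum_ite_eq'] at h1
    have h3 : (if (r : ℕ) ∈ Finset.range (k + 1) then hTimes u ((k : ℤ) - (r : ℕ)) * ((r : ℕ) :
        MvPowerSeries ℕ+ R) else 0) = ((r : ℕ) : MvPowerSeries ℕ+ R) * hTimes u ((k : ℤ) - (r : ℕ)) := by
      split_ifs with h
      · rw [mul_comm]
      · rw [Finset.mem_range] at h
        rw [hTimes_of_neg u _ (by omega), mul_zero]
    rw [h3, ← add_mul, sub_add_cancel, smul_eq_mul] at h1
    exact (isUnit_natCast_of_ne_zero hk.ne').mul_left_cancel h1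

lemma constantCoeff_hTimes {k : ℤ} (hk : k ≠ 0) :
    MvPowerSeries.constantCoeff (hTimes (fun j => (MvPowerSeries.X j : MvPowerSeries ℕ+ R)) k)
      = 0 := by
  set u : ℕ+ → MvPowerSeries ℕ+ R := fun j => MvPowerSeries.X j with hu
  rcases lt_or_ge k 0 with h | h
  · rw [hTimes_of_neg u _ h, map_zero]
  lift k to ℕ using h
  have h1 := congrArg MvPowerSeries.constantCoeff (natCast_mul_hTimes u k)
  rw [map_mul, map_natCast, map_sum, Finset.sum_eq_zero] at h1
  · have hk0 : k ≠ 0 := by exact_mod_cast hk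
    exact (isUnit_natCast_of_ne_zero hk0).mul_right_eq_zero.1 h1
  · rintro ⟨j, i⟩ _
    rcases Nat.eq_zero_or_pos j with rfl | hj
    · simp [powerSums]
    obtain ⟨m, rfl⟩ : ∃ m : ℕ+, (m : ℕ) = j := ⟨⟨j, hj⟩, rfl⟩
    rw [powerSums_coe, map_mul, map_mul, MvPowerSeries.constantCoeff_X, mul_zero, zero_mul]

/-- The Schur functions in the times `t_1, t_2, …`. -/
def tSchur (R : Type*) [CommRing R] [Algebra ℚ R] {N : ℕ} (l : Fin N → ℤ) :
    MvPowerSeries ℕ+ R :=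
  beadSchur (fun j => (MvPowerSeries.X j : MvPowerSeries ℕ+ R)) l

lemma pderiv_tSchur (r : ℕ+) {N : ℕ} (l : Fin N → ℤ) :
    MvPowerSeries.pderiv R r (tSchur R l) = ∑ i, tSchur R (l - Pi.single i ((r : ℕ) : ℤ)) :=
  derivation_beadDet (MvPowerSeries.pderiv R r) _ _ (pderiv_hTimes r) l

/-- The constant term of a Schur function. -/
def vacuumSign (R : Type*) [CommRing R] [Algebra ℚ R] {N : ℕ} (l : Fin N → ℤ) : R :=
  MvPowerSeries.constantCoeff (tSchur R l)

lemma vacuumSign_comp_perm {N : ℕ} (l : Fin N → ℤ) (σ : Equiv.Perm (Fin N)) :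
    vacuumSign R (l ∘ σ) = (Equiv.Perm.sign σ : ℤ) * vacuumSign R l := by
  rw [vacuumSign, tSchur, beadSchur_comp_perm, map_mul, map_intCast]
  rfl

lemma vacuumSign_eq_zero_of_not_injective {N : ℕ} {l : Fin N → ℤ}
    (hl : ¬ Function.Injective l) : vacuumSign R l = 0 := by
  rw [vacuumSign, tSchur, beadSchur_eq_zero_of_not_injective _ hl, map_zero]

lemma vacuumSign_eq_zero_of_lt {N : ℕ} {l : Fin N → ℤ} (i : Fin N)
    (hi : l i < -N) : vacuumSign R l = 0 := by
  rw [vacuumSign, tSchur, beadSchur_eq_zero_of_lt _ i hi, map_zero]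

/-- The row of such a bead consists of `h_k` with `k > 0`, which have no constant term. -/
lemma vacuumSign_eq_zero_of_nonneg {N : ℕ} {l : Fin N → ℤ} (i : Fin N)
    (hi : 0 ≤ l i) : vacuumSign R l = 0 := by
  rw [vacuumSign, tSchur, beadSchur, map_beadDet]
  exact beadDet_eq_zero_of_row _ i fun j => constantCoeff_hTimes (by omega)

lemma mem_Icc_of_vacuumSign_ne_zero {N : ℕ} {l : Fin N → ℤ} (h : vacuumSign R l ≠ 0) (i : Fin N) :
    l i ∈ Finset.Icc (-(N : ℤ)) (-1) := by
  rw [Finset.mem_Icc]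
  by_contra hn
  rw [not_and_or, not_le, not_le] at hn
  rcases hn with hn | hn
  · exact h (vacuumSign_eq_zero_of_lt i hn)
  · exact h (vacuumSign_eq_zero_of_nonneg i (by omega))

/-- If the constant term of `s_l` is nonzero, the bead positions are exactly `-N, …, -1`. -/
lemma image_of_vacuumSign_ne_zero {N : ℕ} {l : Fin N → ℤ} (h : vacuumSign R l ≠ 0) :
    Finset.univ.image l = Finset.Icc (-(N : ℤ)) (-1) := by
  have hinj : Function.Injective l := by
    by_contra hn
    exact h (vacuumSign_eq_zero_of_not_injective hn)
  apply Finset.eq_of_subset_of_card_le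
  · intro x hx
    obtain ⟨i, _, rfl⟩ := Finset.mem_image.1 hx
    exact mem_Icc_of_vacuumSign_ne_zero h i
  · rw [Finset.card_image_of_injective _ hinj]
    simp

end PowerSeriesTimes

/-! ### Powers of the current and their commutators with derivatives -/

section Currents

variable {R : Type*} [CommRing R]

lemma J_add (b : ℤ) (f g : MvPowerSeries ℕ+ R) : J b (f + g) = J b f + J b g := by
  rcases b with (_ | b) | b
  · simp [J]
  · exact map_add _ _ _
  · simp only [J, mul_add, smul_add]

lemma J_smul (b : ℤ) (r : R) (f : MvPowerSeries ℕ+ R) : J b (r • f) = r • J b f := by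
  rcases b with (_ | b) | b
  · simp [J]
  · exact Derivation.map_smul _ _ _
  · simp only [J, mul_smul_comm]
    exact smul_comm _ _ _

lemma J_natCast (r : ℕ+) (f : MvPowerSeries ℕ+ R) :
    J ((r : ℕ) : ℤ) f = MvPowerSeries.pderiv R r f := by
  have h : ((r : ℕ) : ℤ) = Int.ofNat (r.natPred + 1) := by
    rw [PNat.natPred_add_one]; rfl
  rw [h, J, PNat.succPNat_natPred]

lemma J_zero_index (f : MvPowerSeries ℕ+ R) : J 0 f = 0 := rfl

/-- `currentPow m s` is the coefficient of `x ^ (-s - m)` in `:(Ĵ(x) + ∂_x) ^ m 1:`. -/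
def currentPow : ℕ → ℤ → MvPowerSeries ℕ+ R → MvPowerSeries ℕ+ R
  | 0, s, f => if s = 0 then f else 0
  | m + 1, s, f => currentCoeff m s f

lemma currentPow_finite (m : ℕ) (s : ℤ) (f : MvPowerSeries ℕ+ R) (d : ℕ+ →₀ ℕ) :
    (Function.support fun b : ℤ =>
      MvPowerSeries.coeff d (normalMul b (currentPow m (s - b)) f)).Finite := by
  cases m with
  | succ m => exact currentCoeff_finite m s f d
  | zero =>
    refine (Set.finite_singleton s).subset fun b hb => ?_
    by_contra hn
    apply hb
    have hsb : s - b ≠ 0 := fun h => hn (by simp; omega)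
    have h0 : J b (0 : MvPowerSeries ℕ+ R) = 0 := by simpa using J_smul b (0 : R) 0
    simp only [normalMul, currentPow, hsb, if_false, h0]
    split_ifs <;> simp

/-- Starting from the empty product gives one recursion for all `m` and lets the commutator formula
run down to power `0`. At `m = 0` the derivative term drops out, because `currentPow 0 s` vanishes
unless `s = 0`. -/
lemma coeff_currentPow_succ (m : ℕ) (s : ℤ) (f : MvPowerSeries ℕ+ R) (d : ℕ+ →₀ ℕ) :
    MvPowerSeries.coeff d (currentPow (m + 1) s f)
      = (∑ᶠ b : ℤ, MvPowerSeries.coeff d (normalMul b (currentPow m (s - b)) f))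
        - ((s : R) + m) * MvPowerSeries.coeff d (currentPow m s f) := by
  cases m with
  | succ m =>
    rw [currentPow]
    rw [Nat.cast_add, Nat.cast_one, ← add_assoc]
    rfl
  | zero =>
    have h0 : ∀ b : ℤ, J b (0 : MvPowerSeries ℕ+ R) = 0 := fun b => by
      simpa using J_smul b (0 : R) 0
    rw [finsum_eq_single _ s]
    · have : MvPowerSeries.coeff d (currentPow 0 s f) * (s : R) = 0 := by
        by_cases hs : s = 0
        · simp [hs]
        · simp [currentPow, hs]
      rw [Nat.cast_zero, add_zero, mul_comm, this, sub_zero]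
      simp [normalMul, currentPow, currentCoeff]
    · intro b hb
      have hsb : s - b ≠ 0 := fun h => hb (by omega)
      simp only [normalMul, currentPow, hsb, if_false, h0]
      split_ifs <;> simp

lemma normalMul_add {Z : MvPowerSeries ℕ+ R → MvPowerSeries ℕ+ R}
    (hZ : ∀ f g, Z (f + g) = Z f + Z g) (b : ℤ) (f g : MvPowerSeries ℕ+ R) :
    normalMul b Z (f + g) = normalMul b Z f + normalMul b Z g := by
  unfold normalMul
  split_ifs
  · rw [hZ, J_add]
  · rw [J_add, hZ]

lemma normalMul_smul {Z : MvPowerSeries ℕ+ R → MvPowerSeries ℕ+ R} (r : R)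
    (hZ : ∀ f, Z (r • f) = r • Z f) (b : ℤ) (f : MvPowerSeries ℕ+ R) :
    normalMul b Z (r • f) = r • normalMul b Z f := by
  unfold normalMul
  split_ifs
  · rw [hZ, J_smul]
  · rw [J_smul, hZ]

lemma currentPow_add (m : ℕ) (s : ℤ) (f g : MvPowerSeries ℕ+ R) :
    currentPow m s (f + g) = currentPow m s f + currentPow m s g := by
  induction m generalizing s f g with
  | zero => simp only [currentPow]; split_ifs <;> simp
  | succ m ih =>
    ext d
    rw [map_add, coeff_currentPow_succ, coeff_currentPow_succ, coeff_currentPow_succ, ih]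
    simp only [normalMul_add (ih _), map_add]
    rw [finsum_add_distrib (currentPow_finite m s f d) (currentPow_finite m s g d)]
    ring

lemma currentPow_smul (m : ℕ) (s : ℤ) (r : R) (f : MvPowerSeries ℕ+ R) :
    currentPow m s (r • f) = r • currentPow m s f := by
  induction m generalizing s f with
  | zero => simp only [currentPow]; split_ifs <;> simp
  | succ m ih =>
    ext d
    rw [MvPowerSeries.coeff_smul, coeff_currentPow_succ, coeff_currentPow_succ, ih]
    simp only [normalMul_smul r (ih _), MvPowerSeries.coeff_smul]
    rw [← mul_finsum' _ _ (currentPow_finite m s f d)]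
    ring

/-- The operator `currentCoeff m s` as a linear map. -/
def currentLin (m : ℕ) (s : ℤ) : MvPowerSeries ℕ+ R →ₗ[R] MvPowerSeries ℕ+ R where
  toFun := currentPow m s
  map_add' := currentPow_add m s
  map_smul' := currentPow_smul m s

lemma wt_add_single (d : ℕ+ →₀ ℕ) (i : ℕ+) : wt (d + Finsupp.single i 1) = wt d + i := by
  simp [wt, Finsupp.weight_apply, Finsupp.sum_add_index', add_mul]

lemma coeff_J_congr {f g : MvPowerSeries ℕ+ R} (b : ℤ) (d : ℕ+ →₀ ℕ)
    (h : ∀ e : ℕ+ →₀ ℕ, (wt e : ℤ) = wt d + b → MvPowerSeries.coeff e f = MvPowerSeries.coeff e g) :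
    MvPowerSeries.coeff d (J b f) = MvPowerSeries.coeff d (J b g) := by
  rcases b with (_ | b) | b
  · simp [J]
  · simp only [J, MvPowerSeries.coeff_pderiv]
    rw [h]
    rw [wt_add_single]
    simp
  · rw [coeff_J_neg, coeff_J_neg]
    split_ifs with h0
    · rfl
    · rw [h]
      have := wt_sub_single h0
      simp only [Nat.succPNat_coe, Int.negSucc_eq] at this ⊢
      omega

/-- `currentPow m s` lowers the weighted degree by `s`. -/
lemma coeff_currentPow_congr {f g : MvPowerSeries ℕ+ R} (m : ℕ) (s : ℤ) (d : ℕ+ →₀ ℕ)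
    (h : ∀ e : ℕ+ →₀ ℕ, (wt e : ℤ) = wt d + s → MvPowerSeries.coeff e f = MvPowerSeries.coeff e g) :
    MvPowerSeries.coeff d (currentPow m s f) = MvPowerSeries.coeff d (currentPow m s g) := by
  induction m generalizing s d f g with
  | zero =>
    simp only [currentPow]
    split_ifs with hs
    · exact h d (by omega)
    · rfl
  | succ m ih =>
    rw [coeff_currentPow_succ, coeff_currentPow_succ, ih s d h]
    congr 1
    refine finsum_congr fun b => ?_
    unfold normalMul
    split_ifs with hb
    · exact coeff_J_congr b d fun e he => ih _ e fun e' he' => h e' (by omega)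
    · exact ih _ d fun e he => coeff_J_congr b e fun e' he' => h e' (by omega)

lemma pderiv_J (r : ℕ+) (b : ℤ) (f : MvPowerSeries ℕ+ R) :
    MvPowerSeries.pderiv R r (J b f) = J b (MvPowerSeries.pderiv R r f)
      + if b = -((r : ℕ) : ℤ) then (r : R) • f else 0 := by
  rcases b with (_ | b) | b
  · have := r.pos
    rw [if_neg (by simp only [Int.ofNat_eq_natCast]; omega)]
    simp [J]
  · have := r.pos
    rw [if_neg (by simp only [Int.ofNat_eq_natCast]; omega), add_zero]
    ext d
    simp only [J, MvPowerSeries.coeff_pderiv]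
    rw [add_right_comm, Finsupp.add_apply, Finsupp.add_apply]
    by_cases h : r = b.succPNat
    · subst h; ring
    · rw [Finsupp.single_eq_of_ne h, Finsupp.single_eq_of_ne (Ne.symm h)]
      simp only [add_zero]
      ring
  · simp only [J, Derivation.map_smul, Derivation.leibniz, smul_add, smul_eq_mul]
    by_cases h : b.succPNat = r
    · subst h
      rw [if_pos (by simp [Int.negSucc_eq])]
      simp
    · rw [MvPowerSeries.pderiv_X_of_ne h, if_neg]
      · simp
      · intro h'
        apply h
        apply PNat.coe_injective
        simp only [Int.negSucc_eq, Nat.succPNat_coe] at h' ⊢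
        omega

lemma pderiv_normalMul {Z : MvPowerSeries ℕ+ R → MvPowerSeries ℕ+ R}
    (Y : MvPowerSeries ℕ+ R → MvPowerSeries ℕ+ R)
    (r : ℕ+)
    (hZ : ∀ f, MvPowerSeries.pderiv R r (Z f) = Z (MvPowerSeries.pderiv R r f) + Y f)
    (b : ℤ) (f : MvPowerSeries ℕ+ R) :
    MvPowerSeries.pderiv R r (normalMul b Z f)
      = normalMul b Z (MvPowerSeries.pderiv R r f) + normalMul b Y f
        + if b = -((r : ℕ) : ℤ) then (r : R) • Z f else 0 := by
  have := r.pos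
  unfold normalMul
  split_ifs with h1 h2 h2
  · rw [pderiv_J, hZ, if_pos h2, J_add]
  · rw [pderiv_J, hZ, if_neg h2, J_add]
  · omega
  · rw [hZ, pderiv_J, if_neg h2, add_zero, add_zero]

lemma normalMul_sum_smul {ι : Type*} (t : Finset ι) (c : ι → R)
    (Z : ι → MvPowerSeries ℕ+ R → MvPowerSeries ℕ+ R) (b : ℤ) (f : MvPowerSeries ℕ+ R) :
    normalMul b (fun g => ∑ i ∈ t, c i • Z i g) f = ∑ i ∈ t, c i • normalMul b (Z i) f := by
  classical
  simp only [normalMul]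
  split_ifs
  · induction t using Finset.induction_on with
    | empty => simpa using J_smul b (0 : R) 0
    | insert a t ha ih => simp only [Finset.sum_insert ha, J_add, J_smul, ih]
  · rfl

/-- Coefficients of the commutator of `∂ / ∂ t_r` with a normally ordered power of the current. -/
def commCoeff (r m j : ℕ) : ℕ := m.choose j * r.descFactorial j

lemma commCoeff_zero (r m : ℕ) : commCoeff r m 0 = 1 := by simp [commCoeff]

lemma commCoeff_of_lt (r : ℕ) {m j : ℕ} (h : m < j) : commCoeff r m j = 0 := by
  simp [commCoeff, Nat.choose_eq_zero_of_lt h]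

lemma commCoeff_succ (r m j : ℕ) : (commCoeff r (m + 1) (j + 1) : R)
    = commCoeff r m (j + 1) + commCoeff r m j * ((r : R) - j) := by
  have h : ((r.descFactorial (j + 1) : ℕ) : R) = r.descFactorial j * ((r : R) - j) := by
    rw [Nat.descFactorial_succ]
    rcases le_or_gt j r with hj | hj
    · rw [Nat.cast_mul, Nat.cast_sub hj]; ring
    · rw [Nat.descFactorial_eq_zero_iff_lt.2 hj]; simp
  simp only [commCoeff, Nat.choose_succ_succ, Nat.cast_mul, Nat.cast_add, h]
  ring

/-- Formally, bracketing `:(Ĵ + ∂_x)^m:` with `∂/∂t_r` inserts `r x^(r-1) = [∂_x, x^r]`, so the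
result is the commutator of `(Ĵ + ∂_x)^m` with `x^r`. By Leibniz this is the sum over `j ≥ 1` of
`C(m,j) ∂_x^j(x^r) (Ĵ + ∂_x)^(m-j)`. -/
lemma pderiv_currentPow (r : ℕ+) (m : ℕ) (s : ℤ) (f : MvPowerSeries ℕ+ R) :
    MvPowerSeries.pderiv R r (currentPow m s f)
      = currentPow m s (MvPowerSeries.pderiv R r f)
        + ∑ j ∈ Finset.range m, (commCoeff r m (j + 1) : R) •
            currentPow (m - (j + 1)) (s + (r : ℕ)) f := by
  induction m generalizing s f with
  | zero => simp only [currentPow]; split_ifs <;> simp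
  | succ m ih =>
    ext d
    have hN : ∀ b : ℤ, ((d r : R) + 1) * MvPowerSeries.coeff (d + Finsupp.single r 1)
        (normalMul b (currentPow m (s - b)) f)
        = (MvPowerSeries.coeff d (normalMul b (currentPow m (s - b)) (MvPowerSeries.pderiv R r f))
          + ∑ j ∈ Finset.range m, (commCoeff r m (j + 1) : R) *
            MvPowerSeries.coeff d
              (normalMul b (currentPow (m - (j + 1)) (s + (r : ℕ) - b)) f))
          + if b = -((r : ℕ) : ℤ) then
              (r : R) * MvPowerSeries.coeff d (currentPow m (s + (r : ℕ)) f) else 0 := by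
      intro b
      rw [mul_comm, ← MvPowerSeries.coeff_pderiv, pderiv_normalMul _ r
        (ih (s - b)), normalMul_sum_smul, map_add, map_add, map_sum]
      simp only [MvPowerSeries.coeff_smul]
      congr 1
      · congr 1
        refine Finset.sum_congr rfl fun j _ => ?_
        rw [show s - b + ((r : ℕ) : ℤ) = s + (r : ℕ) - b by ring]
      · split_ifs with h
        · rw [MvPowerSeries.coeff_smul, h, sub_neg_eq_add]
        · simp
    have hfin1 := currentPow_finite m s (MvPowerSeries.pderiv R r f) d
    have hfin2 : ∀ j ∈ Finset.range m, (Function.support fun b : ℤ =>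
        (commCoeff r m (j + 1) : R) * MvPowerSeries.coeff d
          (normalMul b (currentPow (m - (j + 1)) (s + (r : ℕ) - b)) f)).Finite := fun j _ =>
      (currentPow_finite (m - (j + 1)) (s + (r : ℕ)) f d).subset
        (Function.support_mul_subset_right _ _)
    have hfin3 : (Function.support fun b : ℤ => ∑ j ∈ Finset.range m, (commCoeff r m (j + 1) : R) *
        MvPowerSeries.coeff d
          (normalMul b (currentPow (m - (j + 1)) (s + (r : ℕ) - b)) f)).Finite := by
      refine ((Finset.range m).finite_toSet.biUnion hfin2).subset fun b hb => ?_
      obtain ⟨j, hj, hne⟩ := Finset.exists_ne_zero_of_sum_ne_zero hb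
      exact Set.mem_biUnion hj hne
    have hfin4 : (Function.support fun b : ℤ => if b = -((r : ℕ) : ℤ) then
        (r : R) * MvPowerSeries.coeff d (currentPow m (s + (r : ℕ)) f) else 0).Finite :=
      (Set.finite_singleton (-((r : ℕ) : ℤ))).subset fun b hb => by
        by_contra hn
        exact hb (if_neg hn)
    have hfin12 : (Function.support fun b : ℤ => MvPowerSeries.coeff d
        (normalMul b (currentPow m (s - b)) (MvPowerSeries.pderiv R r f))
          + ∑ j ∈ Finset.range m, (commCoeff r m (j + 1) : R) * MvPowerSeries.coeff d
            (normalMul b (currentPow (m - (j + 1)) (s + (r : ℕ) - b)) f)).Finite :=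
      (hfin1.union hfin3).subset (Function.support_add _ _)
    have hrec : ∀ j ∈ Finset.range m,
        ∑ᶠ b : ℤ, (commCoeff r m (j + 1) : R) * MvPowerSeries.coeff d
          (normalMul b (currentPow (m - (j + 1)) (s + (r : ℕ) - b)) f)
        = (commCoeff r m (j + 1) : R) * (MvPowerSeries.coeff d (currentPow (m - j) (s + (r : ℕ)) f)
          + ((s : R) + r + m - j - 1) *
            MvPowerSeries.coeff d (currentPow (m - (j + 1)) (s + (r : ℕ)) f)) := by
      intro j hj
      have hj := Finset.mem_range.1 hj
      have h := coeff_currentPow_succ (m - (j + 1)) (s + (r : ℕ)) f d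
      rw [show m - (j + 1) + 1 = m - j by omega, Nat.cast_sub (by omega)] at h
      rw [← mul_finsum' _ _ (currentPow_finite (m - (j + 1)) (s + (r : ℕ)) f d), h]
      push_cast
      ring
    rw [MvPowerSeries.coeff_pderiv, coeff_currentPow_succ, sub_mul, mul_comm (finsum _),
      mul_finsum' _ _ (currentPow_finite m s f _),
      finsum_congr hN, finsum_add_distrib hfin12 hfin4, finsum_add_distrib hfin1 hfin3,
      finsum_sum_comm _ _ hfin2, Finset.sum_congr rfl hrec, finsum_eq_single _ (-((r : ℕ) : ℤ))
        (fun b hb => if_neg hb), if_pos rfl, map_add, coeff_currentPow_succ, mul_assoc,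
      ← MvPowerSeries.coeff_pderiv, ih, map_add, map_sum, map_sum]
    simp only [MvPowerSeries.coeff_smul, commCoeff_succ, add_mul, Finset.sum_add_distrib]
    rw [Finset.sum_range_succ, commCoeff_of_lt _ (Nat.lt_succ_self m), Finset.sum_range_succ' _ m]
    simp only [Nat.add_sub_add_right, commCoeff_zero, mul_add, Finset.sum_add_distrib,
      Finset.mul_sum]
    simp only [Nat.cast_zero, Nat.cast_one, Nat.cast_add, Nat.sub_zero]
    rw [← sub_eq_zero]
    -- The derivative terms of the recursions match because `s + r + m - j - 1 = s + m + (r - (j +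
    -- 1))`.
    have hcancel : ∑ j ∈ Finset.range m, ((commCoeff r m (j + 1) : R) * (((s : R) + r + m - j - 1) *
            MvPowerSeries.coeff d (currentPow (m - (j + 1)) (s + (r : ℕ)) f)))
        - ∑ j ∈ Finset.range m, (s : R) * ((commCoeff r m (j + 1) : R) *
            MvPowerSeries.coeff d (currentPow (m - (j + 1)) (s + (r : ℕ)) f))
        - ∑ j ∈ Finset.range m, (m : R) * ((commCoeff r m (j + 1) : R) *
            MvPowerSeries.coeff d (currentPow (m - (j + 1)) (s + (r : ℕ)) f))
        - ∑ j ∈ Finset.range m, (commCoeff r m (j + 1) : R) * ((r : R) - (j + 1)) *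
            MvPowerSeries.coeff d (currentPow (m - (j + 1)) (s + (r : ℕ)) f) = 0 := by
      rw [← Finset.sum_sub_distrib, ← Finset.sum_sub_distrib, ← Finset.sum_sub_distrib]
      exact Finset.sum_eq_zero fun j _ => by ring
    linear_combination hcancel

end Currents

/-! ### Cancellation among moves of two beads into the vacuum -/

section PairSum

variable {R : Type*} [CommRing R] [Algebra ℚ R]

lemma vacuumSign_swap {N : ℕ} (l : Fin N → ℤ) {i j : Fin N} (hij : i ≠ j) :
    vacuumSign R (l ∘ Equiv.swap i j) = -vacuumSign R l := by
  rw [vacuumSign_comp_perm, Equiv.Perm.sign_swap hij]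
  simp

/-- Bead `i` is put at position `u` and bead `j` at position `v`. -/
def placeTwo {N : ℕ} (l : Fin N → ℤ) (i j : Fin N) (u v : ℤ) : Fin N → ℤ :=
  Function.update (Function.update l i u) j v

lemma placeTwo_swap {N : ℕ} (l : Fin N → ℤ) {i j : Fin N} (hij : i ≠ j) (u v : ℤ) :
    placeTwo l j i u v = placeTwo l i j u v ∘ Equiv.swap i j := by
  ext k
  by_cases hki : k = i
  · subst hki
    simp [placeTwo]
  by_cases hkj : k = j
  · subst hkj
    simp [placeTwo, hij, hki]
  · simp [placeTwo, Equiv.swap_apply_of_ne_of_ne hki hkj, hki, hkj]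

lemma vacuumSign_placeTwo_swap {N : ℕ} (l : Fin N → ℤ) {i j : Fin N} (hij : i ≠ j) (u v : ℤ) :
    vacuumSign R (placeTwo l j i u v) = -vacuumSign R (placeTwo l i j u v) := by
  rw [placeTwo_swap l hij, vacuumSign_swap _ hij]

lemma placeTwo_comm {N : ℕ} (l : Fin N → ℤ) {i j : Fin N} (hij : i ≠ j) (u v : ℤ) :
    placeTwo l i j u v = placeTwo l j i v u :=
  Function.update_comm hij _ _ _

lemma exists_of_vacuumSign_ne_zero {N : ℕ} {l : Fin N → ℤ} (h : vacuumSign R l ≠ 0) {c : ℤ}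
    (hc : -(N : ℤ) ≤ c) (hc' : c < 0) : ∃ k, l k = c := by
  have : c ∈ Finset.univ.image l := by
    rw [image_of_vacuumSign_ne_zero h, Finset.mem_Icc]
    omega
  obtain ⟨k, _, hk⟩ := Finset.mem_image.1 this
  exact ⟨k, hk⟩

/-- The move leaves a hole at `l j`. It lies between `v` and `u`, hence inside the window `-N, …,
-1` that the vacuum fills, and injectivity keeps every other bead away from it. -/
lemma vacuumSign_placeTwo_eq_zero {N : ℕ} {l : Fin N → ℤ} (hl : Function.Injective l)
    {i j : Fin N} (hij : i ≠ j) {u v : ℤ} (hv : v < l j) (hu : l j < u) :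
    vacuumSign R (placeTwo l i j u v) = 0 := by
  by_contra h
  have hi := Finset.mem_Icc.1 (mem_Icc_of_vacuumSign_ne_zero h i)
  have hj := Finset.mem_Icc.1 (mem_Icc_of_vacuumSign_ne_zero h j)
  simp only [placeTwo, Function.update_self, Function.update_of_ne hij] at hi hj
  obtain ⟨k, hk⟩ := exists_of_vacuumSign_ne_zero h (c := l j) (by omega) (by omega)
  by_cases hkj : k = j
  · subst hkj
    simp [placeTwo] at hk
    omega
  by_cases hki : k = i
  · subst hki
    simp [placeTwo, hkj] at hk
    omega
  · simp only [placeTwo, Function.update_of_ne hkj, Function.update_of_ne hki] at hk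
    exact hkj (hl hk)

lemma update_eq_sub_single {N : ℕ} (l : Fin N → ℤ) (i : Fin N) (s : ℤ) :
    Function.update l i (l i - s) = l - Pi.single i s := by
  ext k
  by_cases hk : k = i
  · subst hk; simp
  · simp [hk]

/-- With the labels `i` and `j` exchanged this is the move of bead `i` alone, whence the sign. -/
lemma vacuumSign_place_row {N : ℕ} (l : Fin N → ℤ) {i j : Fin N} (hij : i ≠ j) (s : ℤ) :
    vacuumSign R (placeTwo l i j (l j) (l i - s)) = -vacuumSign R (l - Pi.single i s) := by
  rw [placeTwo_comm l hij, vacuumSign_placeTwo_swap l hij]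
  congr 2
  rw [← update_eq_sub_single]
  ext k
  by_cases hkj : k = j
  · subst hkj; simp [placeTwo, hij.symm]
  · simp [placeTwo, hkj]

/-- Contribution of moving two different beads `i`, `j` down by `s` in total. -/
lemma sum_placeTwo {N : ℕ} {l : Fin N → ℤ} (hl : Function.Injective l) {i j : Fin N} (hij : i ≠ j)
    (q : ℤ → R) {s : ℤ} (hs : 0 < s) :
    ∑ u ∈ Finset.Ioo (l i - s) (l i), q u * vacuumSign R (placeTwo l i j u (l i + l j - s - u))
      = ∑ u ∈ Finset.Ioo (l i - s) (l i) ∩ Finset.Ioo (l j - s) (l j),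
          q u * vacuumSign R (placeTwo l i j u (l i + l j - s - u))
        - (if l i - s < l j ∧ l j < l i then q (l j) * vacuumSign R (l - Pi.single i s) else 0)
        - (if l j - s < l i ∧ l i < l j then q (l j - s) * vacuumSign R (l - Pi.single j s)
            else 0) := by
  have hne : l i ≠ l j := fun h => hij (hl h)
  set F : ℤ → R := fun u => q u * vacuumSign R (placeTwo l i j u (l i + l j - s - u)) with hF
  have h1 : F (l j) = -(q (l j) * vacuumSign R (l - Pi.single i s)) := by
    simp only [hF]
    rw [show l i + l j - s - l j = l i - s by ring, vacuumSign_place_row l hij]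
    ring
  have h2 : F (l j - s) = -(q (l j - s) * vacuumSign R (l - Pi.single j s)) := by
    simp only [hF]
    rw [show l i + l j - s - (l j - s) = l i by ring, placeTwo_comm l hij,
      vacuumSign_place_row l hij.symm]
    ring
  -- If `u > l j`, the final configuration has a hole at `l j`; if `u < l j - s`, it has one at `l
  -- i`. Outside the common interval only `u = l j` and `u = l j - s` survive, and both are moves of
  -- one bead with exchanged labels.
  have h3 : ∀ u ∈ Finset.Ioo (l i - s) (l i), F u
      = (if u ∈ Finset.Ioo (l j - s) (l j) then F u else 0) + (if u = l j then F u else 0)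
        + (if u = l j - s then F u else 0) := by
    intro u hu
    rw [Finset.mem_Ioo] at hu
    rcases lt_trichotomy u (l j) with h | h | h
    · rcases lt_trichotomy u (l j - s) with h' | h' | h'
      · have : F u = 0 := by
          simp only [hF]
          rw [placeTwo_comm l hij, vacuumSign_placeTwo_eq_zero hl hij.symm (by omega) (by omega),
            mul_zero]
        simp [this]
      · have e1 : ¬ (u ∈ Finset.Ioo (l j - s) (l j)) := by rw [Finset.mem_Ioo]; omega
        rw [if_neg e1, if_neg h.ne, if_pos h']
        ring
      · rw [if_pos (Finset.mem_Ioo.2 ⟨h', h⟩), if_neg h.ne, if_neg h'.ne']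
        ring
    · have e1 : ¬ (u ∈ Finset.Ioo (l j - s) (l j)) := by rw [Finset.mem_Ioo]; omega
      rw [if_neg e1, if_pos h, if_neg (by omega)]
      ring
    · have : F u = 0 := by
        simp only [hF]
        rw [vacuumSign_placeTwo_eq_zero hl hij (by omega) h, mul_zero]
      simp [this]
  have h4 : ∑ u ∈ Finset.Ioo (l i - s) (l i), (if u = l j then F u else 0)
      = -(if l i - s < l j ∧ l j < l i then q (l j) * vacuumSign R (l - Pi.single i s)
          else 0) := by
    rw [Finset.sum_ite_eq', h1]
    simp only [Finset.mem_Ioo]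
    split_ifs <;> simp
  have h5 : ∑ u ∈ Finset.Ioo (l i - s) (l i), (if u = l j - s then F u else 0)
      = -(if l j - s < l i ∧ l i < l j then q (l j - s) * vacuumSign R (l - Pi.single j s)
          else 0) := by
    rw [Finset.sum_ite_eq', h2]
    by_cases h : l j - s < l i ∧ l i < l j
    · rw [if_pos h, if_pos (by rw [Finset.mem_Ioo]; omega)]
    · rw [if_neg h, neg_zero, if_neg (by rw [Finset.mem_Ioo]; omega)]
  rw [Finset.sum_congr rfl h3, Finset.sum_add_distrib, Finset.sum_add_distrib, h4, h5,
    ← Finset.sum_filter, Finset.filter_mem_eq_inter]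
  ring

/-- Exchanging `i` and `j` keeps the range of `u` and the factor `q u` but reverses the sign, and
`2` is invertible. -/
lemma sum_placeTwo_inter_antisymm {N : ℕ} (l : Fin N → ℤ) (q : ℤ → R) (s : ℤ) :
    ∑ i, ∑ j ∈ Finset.univ.filter (· ≠ i),
      ∑ u ∈ Finset.Ioo (l i - s) (l i) ∩ Finset.Ioo (l j - s) (l j),
          q u * vacuumSign R (placeTwo l i j u (l i + l j - s - u)) = 0 := by
  set G : Fin N → Fin N → R := fun i j =>
    ∑ u ∈ Finset.Ioo (l i - s) (l i) ∩ Finset.Ioo (l j - s) (l j),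
          q u * vacuumSign R (placeTwo l i j u (l i + l j - s - u)) with hG
  have hanti : ∀ i j, j ≠ i → G i j = -G j i := by
    intro i j hij
    simp only [hG]
    rw [Finset.inter_comm, ← Finset.sum_neg_distrib]
    refine Finset.sum_congr rfl fun u _ => ?_
    rw [vacuumSign_placeTwo_swap l hij, add_comm (l i)]
    ring
  have h2 : ∑ i, ∑ j ∈ Finset.univ.filter (· ≠ i), G i j
      = -∑ i, ∑ j ∈ Finset.univ.filter (· ≠ i), G i j := by
    simp only [Finset.sum_filter]
    conv_lhs => rw [Finset.sum_comm]
    simp only [← Finset.sum_neg_distrib]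
    refine Finset.sum_congr rfl fun i _ => Finset.sum_congr rfl fun j _ => ?_
    by_cases h : j = i
    · simp [h]
    · rw [if_pos (Ne.symm h), if_pos h, hanti j i (Ne.symm h)]
  have h3 : (2 : R) * ∑ i, ∑ j ∈ Finset.univ.filter (· ≠ i), G i j = 0 := by
    linear_combination h2
  have h4 : IsUnit (2 : R) := by
    exact_mod_cast isUnit_natCast_of_ne_zero (R := R) two_ne_zero
  exact h4.mul_right_eq_zero.1 h3

/-- If lowering bead `i` by `s` reaches the vacuum, then `l i ≥ 0`, since otherwise `l i` would
remain as a hole. The other beads thus fill all of `-N, …, -1` except `l i - s`, so those between `l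
i - s` and `l i` occupy exactly the negative positions above `l i - s`. -/
lemma sum_between_beads {N : ℕ} {l : Fin N → ℤ} (hl : Function.Injective l) (i : Fin N)
    {s : ℤ} (hs : 0 < s) (hne : vacuumSign R (l - Pi.single i s) ≠ 0) (q : ℤ → R) :
    ∑ j ∈ Finset.univ.filter (· ≠ i), (if l i - s < l j ∧ l j < l i then q (l j) else 0)
      = ∑ c ∈ Finset.Ioo (l i - s) 0, q c := by
  have hval : ∀ j, j ≠ i → (l - Pi.single i s : Fin N → ℤ) j = l j := fun j hj => by simp [hj]
  have hi : (l - Pi.single i s : Fin N → ℤ) i = l i - s := by simp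
  have hmem := fun k => Finset.mem_Icc.1 (mem_Icc_of_vacuumSign_ne_zero hne k)
  have hi0 : 0 ≤ l i := by
    by_contra h
    have hmi := hmem i
    rw [hi] at hmi
    obtain ⟨k, hk⟩ := exists_of_vacuumSign_ne_zero hne (c := l i) (by omega) (by omega)
    by_cases hki : k = i
    · subst hki; omega
    · rw [hval k hki] at hk
      exact hki (hl hk)
  rw [← Finset.sum_filter, Finset.filter_filter]
  refine Finset.sum_bij (fun j _ => l j) ?_ (fun a _ b _ h => hl h) ?_ (fun _ _ => rfl)
  · intro j hj
    simp only [Finset.mem_filter, Finset.mem_univ, true_and] at hj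
    have := hmem j
    rw [hval j hj.1] at this
    rw [Finset.mem_Ioo]
    omega
  · intro c hc
    rw [Finset.mem_Ioo] at hc
    have hmi := hmem i
    rw [hi] at hmi
    obtain ⟨k, hk⟩ := exists_of_vacuumSign_ne_zero hne (c := c) (by omega) (by omega)
    have hki : k ≠ i := by rintro rfl; omega
    rw [hval k hki] at hk
    exact ⟨k, by simp only [Finset.mem_filter, Finset.mem_univ, true_and]; omega, hk⟩

/-- The sum over all ways of moving two beads down by `s` in total to reach the vacuum. -/
lemma sum_move_two {N : ℕ} {l : Fin N → ℤ} (hl : Function.Injective l) (q : ℤ → R) {s : ℤ}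
    (hs : 0 < s) :
    ∑ b ∈ Finset.Ioo 0 s, ∑ j, ∑ i, q ((l - Pi.single j b : Fin N → ℤ) i - (s - b)) *
        vacuumSign R (l - Pi.single j b - Pi.single i (s - b))
      = ∑ i, ((s : R) - 1) * (q (l i - s) * vacuumSign R (l - Pi.single i s))
        - ∑ i, (∑ c ∈ Finset.Ioo (l i - s) 0, (q c + q (l i - s)))
            * vacuumSign R (l - Pi.single i s) := by
  have hsplit : ∀ b i, ∑ j, q ((l - Pi.single j b : Fin N → ℤ) i - (s - b)) *
        vacuumSign R (l - Pi.single j b - Pi.single i (s - b))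
      = q (l i - s) * vacuumSign R (l - Pi.single i s)
        + ∑ j ∈ Finset.univ.filter (· ≠ i), q (l i - s + b) *
          vacuumSign R (placeTwo l i j (l i - s + b) (l i + l j - s - (l i - s + b))) := by
    intro b i
    rw [← Finset.sum_filter_add_sum_filter_not Finset.univ (· ≠ i), add_comm]
    congr 1
    · rw [Finset.sum_eq_single i]
      · rw [sub_sub l, ← Pi.single_add, add_sub_cancel, Pi.sub_apply, Pi.single_eq_same]
        congr 2
        ring
      · intro j hj hji
        simp [hji] at hj
      · simp
    · refine Finset.sum_congr rfl fun j hj => ?_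
      have hji : j ≠ i := by simpa using hj
      congr 2
      · simp [hji.symm]; ring
      · ext k
        by_cases hki : k = i
        · subst hki
          simp [placeTwo, hji.symm]
          ring
        · by_cases hkj : k = j
          · subst hkj
            simp [placeTwo, hji]
            ring
          · simp [placeTwo, hki, hkj]
  have hshift : ∀ i (F : ℤ → R), ∑ b ∈ Finset.Ioo 0 s, F (l i - s + b)
      = ∑ u ∈ Finset.Ioo (l i - s) (l i), F u := by
    intro i F
    refine Finset.sum_bij (fun b _ => l i - s + b) ?_ (fun a _ b _ h => by simpa using h) ?_
      (fun _ _ => rfl)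
    · intro b hb
      rw [Finset.mem_Ioo] at hb ⊢
      omega
    · intro u hu
      rw [Finset.mem_Ioo] at hu
      exact ⟨u - (l i - s), by rw [Finset.mem_Ioo]; omega, by ring⟩
  have h1 : ∀ b, ∑ j, ∑ i, q ((l - Pi.single j b : Fin N → ℤ) i - (s - b)) *
        vacuumSign R (l - Pi.single j b - Pi.single i (s - b))
      = ∑ i, ∑ j, q ((l - Pi.single j b : Fin N → ℤ) i - (s - b)) *
        vacuumSign R (l - Pi.single j b - Pi.single i (s - b)) := fun b => Finset.sum_comm
  simp only [h1, hsplit, Finset.sum_add_distrib]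
  rw [sub_eq_add_neg]
  congr 1
  · rw [Finset.sum_const, Int.card_Ioo, ← Finset.mul_sum, nsmul_eq_mul]
    congr 1
    have : ((s - 0 - 1).toNat : ℤ) = s - 1 := by omega
    have h2 := congrArg (Int.cast : ℤ → R) this
    push_cast at h2
    exact h2
  · rw [Finset.sum_comm]
    have h2 : ∀ i, ∑ b ∈ Finset.Ioo 0 s, ∑ j ∈ Finset.univ.filter (· ≠ i), q (l i - s + b) *
          vacuumSign R (placeTwo l i j (l i - s + b) (l i + l j - s - (l i - s + b)))
        = ∑ j ∈ Finset.univ.filter (· ≠ i),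
          (∑ u ∈ Finset.Ioo (l i - s) (l i) ∩ Finset.Ioo (l j - s) (l j),
            q u * vacuumSign R (placeTwo l i j u (l i + l j - s - u))
          - (if l i - s < l j ∧ l j < l i then q (l j) * vacuumSign R (l - Pi.single i s) else 0)
          - (if l j - s < l i ∧ l i < l j then q (l j - s) * vacuumSign R (l - Pi.single j s)
            else 0)) := by
      intro i
      rw [Finset.sum_comm]
      refine Finset.sum_congr rfl fun j hj => ?_
      have hji : j ≠ i := by simpa using hj
      rw [hshift i (fun u => q u * vacuumSign R (placeTwo l i j u (l i + l j - s - u))),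
        sum_placeTwo hl hji.symm q hs]
    rw [Finset.sum_congr rfl fun i _ => h2 i]
    simp only [Finset.sum_sub_distrib]
    rw [sum_placeTwo_inter_antisymm, zero_sub]
    have h3 : ∑ i, ∑ j ∈ Finset.univ.filter (· ≠ i),
          (if l j - s < l i ∧ l i < l j then q (l j - s) * vacuumSign R (l - Pi.single j s) else 0)
        = ∑ i, ∑ j ∈ Finset.univ.filter (· ≠ i),
          (if l i - s < l j ∧ l j < l i then q (l i - s) * vacuumSign R (l - Pi.single i s)
            else 0) := by
      simp only [Finset.sum_filter]
      rw [Finset.sum_comm]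
      refine Finset.sum_congr rfl fun i _ => Finset.sum_congr rfl fun j _ => ?_
      by_cases h : i = j
      · simp [h]
      · rw [if_pos h, if_pos (Ne.symm h)]
    rw [h3, sub_eq_add_neg, ← neg_add, ← Finset.sum_add_distrib]
    congr 1
    refine Finset.sum_congr rfl fun i _ => ?_
    rw [← Finset.sum_add_distrib]
    by_cases hne : vacuumSign R (l - Pi.single i s) = 0
    · simp [hne]
    · rw [← Finset.sum_add_distrib, ← sum_between_beads hl i hs hne (fun c => q c + q (l i - s)), Finset.sum_mul]
      refine Finset.sum_congr rfl fun j _ => ?_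
      split_ifs <;> ring

end PairSum

/-! ### Action of the lowering operators on Schur functions -/

section Action

variable {R : Type*} [CommRing R]

lemma currentPow_apply_zero (m : ℕ) (s : ℤ) : currentPow m s (0 : MvPowerSeries ℕ+ R) = 0 := by
  simpa using currentPow_smul m s (0 : R) 0

lemma constantCoeff_J_neg {b : ℤ} (hb : b < 0) (f : MvPowerSeries ℕ+ R) :
    MvPowerSeries.coeff 0 (J b f) = 0 := by
  rcases b with b | b
  · simp only [Int.ofNat_eq_natCast] at hb; omega
  · rw [coeff_J_neg]; simp

lemma wt_zero : wt 0 = 0 := by simp [wt]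

lemma constantCoeff_currentCoeff_zero (m : ℕ) (f : MvPowerSeries ℕ+ R) :
    MvPowerSeries.coeff 0 (currentCoeff m 0 f) = 0 := by
  induction m generalizing f with
  | zero => simp [currentCoeff, J_zero_index]
  | succ m ih =>
    have h := coeff_currentPow_succ (m + 1) 0 f 0
    simp only [currentPow] at h
    rw [h, ih, mul_zero, sub_zero]
    apply finsum_eq_zero_of_forall_eq_zero
    intro b
    unfold normalMul
    split_ifs with hb
    · exact constantCoeff_J_neg hb _
    · rcases eq_or_ne b 0 with rfl | hb0
      · rw [J_zero_index, sub_zero]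
        change MvPowerSeries.coeff 0 (currentPow (m + 1) 0 0) = 0
        rw [currentPow_apply_zero, map_zero]
      · exact coeff_currentCoeff_eq_zero _ _ _ _ (by rw [wt_zero]; push_cast; omega)

/-- At the origin, `b < 0` contributes a factor `t_{-b}` and `b = 0` gives zero. For `b > s` the
remaining current raises the degree, and for `b = s` it has index `0`; neither has a constant term.
-/
lemma constantCoeff_currentCoeff_succ (m : ℕ) {s : ℤ} (hs : 0 < s) (f : MvPowerSeries ℕ+ R) :
    MvPowerSeries.coeff 0 (currentCoeff (m + 1) s f)
      = ∑ b ∈ Finset.Ioo 0 s, MvPowerSeries.coeff 0 (currentCoeff m (s - b) (J b f))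
        - ((s : R) + m + 1) * MvPowerSeries.coeff 0 (currentCoeff m s f) := by
  have h := coeff_currentPow_succ (m + 1) s f 0
  simp only [currentPow] at h
  rw [h, finsum_eq_sum_of_support_subset (s := Finset.Ioo 0 s)]
  · push_cast
    rw [add_assoc]
    congr 1
    refine Finset.sum_congr rfl fun b hb => ?_
    rw [Finset.mem_Ioo] at hb
    rw [normalMul, if_neg (by omega)]
    rfl
  · intro b hb
    by_contra hn
    apply hb
    simp only
    rw [Finset.coe_Ioo, Set.mem_Ioo, not_and_or] at hn
    unfold normalMul
    split_ifs with hb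
    · exact constantCoeff_J_neg hb _
    · rcases eq_or_ne b 0 with rfl | hb0
      · rw [J_zero_index, sub_zero]
        change MvPowerSeries.coeff 0 (currentPow (m + 1) s 0) = 0
        rw [currentPow_apply_zero, map_zero]
      · rcases eq_or_ne b s with rfl | hbs
        · rw [sub_self]
          exact constantCoeff_currentCoeff_zero m _
        · exact coeff_currentCoeff_eq_zero _ _ _ _ (by rw [wt_zero]; push_cast; omega)

/-- The falling factorial `h (h - 1) ⋯ (h - m + 1)`. -/
def fallInt (m : ℕ) (h : ℤ) : ℤ := (descPochhammer ℤ m).eval h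

lemma fallInt_zero (h : ℤ) : fallInt 0 h = 1 := by simp [fallInt]

lemma fallInt_succ (m : ℕ) (h : ℤ) : fallInt (m + 1) h = fallInt m h * (h - m) :=
  descPochhammer_succ_eval m h

lemma fallInt_succ_left (m : ℕ) (h : ℤ) : fallInt (m + 1) (h + 1) = (h + 1) * fallInt m h := by
  simp [fallInt, descPochhammer_succ_left, Polynomial.eval_comp]

lemma eval_fallPoly (m : ℕ) (h : ℤ) : (fallPoly R m).eval ((h : R) + 1) = fallInt m h := by
  induction m with
  | zero => simp [fallPoly, fallInt]
  | succ m ih =>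
    rw [fallInt_succ, Int.cast_mul, ← ih, fallPoly, Finset.prod_range_succ, Polynomial.eval_mul,
      ← fallPoly]
    simp

lemma fallInt_add (m : ℕ) (r : ℕ) (h : ℤ) :
    fallInt m (h + r) = ∑ j ∈ Finset.range (m + 1),
      (m.choose j : ℤ) * r.descFactorial j * fallInt (m - j) h := by
  have h1 := Ring.descPochhammer_smeval_add (R := ℤ) (r := (r : ℤ)) (s := h) m (Commute.all _ _)
  rw [Finset.Nat.sum_antidiagonal_eq_sum_range_succ_mk] at h1
  simp only [← Polynomial.eval_eq_smeval, descPochhammer_eval_eq_descFactorial] at h1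
  rw [fallInt, add_comm, h1]
  refine Finset.sum_congr rfl fun j _ => ?_
  rw [fallInt]
  ring

/-- `fallInt (m + 1)` is a discrete antiderivative of `(m + 1) fallInt m` and vanishes at `0`, so
the sum over `-k, …, -1` telescopes to `-fallInt (m + 1) (-k) = k fallInt m (-1 - k)`. -/
lemma sum_fallInt (m : ℕ) (k : ℕ) :
    ((m : ℤ) + 1) * ∑ c ∈ Finset.Ioo (-1 - (k : ℤ)) 0, fallInt m c = k * fallInt m (-1 - k) := by
  induction k with
  | zero =>
    have h : Finset.Ioo (-1 : ℤ) 0 = ∅ := rfl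
    simp [h]
  | succ k ih =>
    have h : Finset.Ioo (-1 - ((k + 1 : ℕ) : ℤ)) 0
        = insert (-1 - (k : ℤ)) (Finset.Ioo (-1 - (k : ℤ)) 0) := by
      ext c
      simp only [Finset.mem_Ioo, Finset.mem_insert]
      push_cast
      omega
    rw [h, Finset.sum_insert (by simp), mul_add, ih]
    have h1 := fallInt_succ m (-1 - (k : ℤ))
    have h2 := fallInt_succ_left m (-1 - ((k : ℤ) + 1))
    rw [show -1 - ((k : ℤ) + 1) + 1 = -1 - k by ring, h1] at h2
    push_cast
    linear_combination -h2

variable [Algebra ℚ R]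

lemma tSchur_eq_zero_of_not_injective {N : ℕ} {l : Fin N → ℤ} (hl : ¬ Function.Injective l) :
    tSchur R l = 0 := beadSchur_eq_zero_of_not_injective _ hl

lemma coeff_zero_tSchur {N : ℕ} (l : Fin N → ℤ) :
    MvPowerSeries.coeff 0 (tSchur R l) = vacuumSign R l := rfl

lemma J_tSchur {b : ℤ} (hb : 0 < b) {N : ℕ} (l : Fin N → ℤ) :
    J b (tSchur R l) = ∑ i, tSchur R (l - Pi.single i b) := by
  lift b to ℕ using hb.le
  obtain ⟨r, rfl⟩ : ∃ r : ℕ+, (r : ℕ) = b := ⟨⟨b, by exact_mod_cast hb⟩, rfl⟩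
  rw [J_natCast, pderiv_tSchur]

/-- If two beads of `l` coincide, the terms of a one-bead move cancel. -/
lemma sum_vacuumSign_eq_zero_of_not_injective {N : ℕ} {l : Fin N → ℤ}
    (hl : ¬ Function.Injective l) (q : ℤ → R) (s : ℤ) :
    ∑ i, q (l i - s) * vacuumSign R (l - Pi.single i s) = 0 := by
  classical
  simp only [Function.Injective, not_forall] at hl
  obtain ⟨a, b, hab, hne⟩ := hl
  rw [Finset.sum_eq_add_of_mem a b (Finset.mem_univ _) (Finset.mem_univ _) hne]
  · have h : l - Pi.single b s = (l - Pi.single a s) ∘ Equiv.swap a b := by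
      ext k
      by_cases hka : k = a
      · subst hka; simp [hne, hab, Ne.symm hne]
      by_cases hkb : k = b
      · subst hkb; simp [hab]
      · simp [Equiv.swap_apply_of_ne_of_ne hka hkb, hka, hkb]
    rw [h, vacuumSign_swap _ hne, hab]
    ring
  · intro c _ hc
    rw [vacuumSign_eq_zero_of_not_injective, mul_zero]
    intro hinj
    refine hne (hinj ?_)
    simp [hc.1.symm, hc.2.symm, hab]

omit [Algebra ℚ R] in
lemma currentCoeff_sum (m : ℕ) (s : ℤ) {N : ℕ} (F : Fin N → MvPowerSeries ℕ+ R) :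
    currentCoeff m s (∑ i, F i) = ∑ i, currentCoeff m s (F i) :=
  map_sum (currentLin (m + 1) s) F Finset.univ

/-- The constant term of a current applied to a Schur function. -/
lemma constantCoeff_currentCoeff_tSchur (m : ℕ) {s : ℤ} (hs : 0 < s) {N : ℕ} (l : Fin N → ℤ) :
    MvPowerSeries.coeff 0 (currentCoeff m s (tSchur R l))
      = ((m : R) + 1) * ∑ i, (fallInt m (l i - s) : R) * vacuumSign R (l - Pi.single i s) := by
  induction m generalizing s l with
  | zero =>
    rw [currentCoeff, J_tSchur hs, map_sum]
    simp [fallInt_zero, coeff_zero_tSchur]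
  | succ m ih =>
    by_cases hl : Function.Injective l
    swap
    · rw [sum_vacuumSign_eq_zero_of_not_injective hl (fun c => (fallInt (m + 1) c : R)),
        tSchur_eq_zero_of_not_injective hl, mul_zero]
      change MvPowerSeries.coeff 0 (currentPow (m + 2) s 0) = 0
      rw [currentPow_apply_zero, map_zero]
    rw [constantCoeff_currentCoeff_succ m hs, ih hs]
    have h1 : ∀ b ∈ Finset.Ioo 0 s,
        MvPowerSeries.coeff 0 (currentCoeff m (s - b) (J b (tSchur R l)))
        = ((m : R) + 1) * ∑ j, ∑ i,
          (fallInt m ((l - Pi.single j b : Fin N → ℤ) i - (s - b)) : R) *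
            vacuumSign R (l - Pi.single j b - Pi.single i (s - b)) := by
      intro b hb
      rw [Finset.mem_Ioo] at hb
      rw [J_tSchur hb.1, currentCoeff_sum, map_sum, Finset.mul_sum]
      exact Finset.sum_congr rfl fun j _ => ih (by omega) _
    rw [Finset.sum_congr rfl h1, ← Finset.mul_sum,
      sum_move_two hl (fun c => (fallInt m c : R)) hs, ← Finset.sum_sub_distrib, Finset.mul_sum,
      Finset.mul_sum, Finset.mul_sum, Finset.mul_sum, ← Finset.sum_sub_distrib]
    refine Finset.sum_congr rfl fun i _ => ?_
    by_cases hne : vacuumSign R (l - Pi.single i s) = 0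
    · simp [hne]
    have hmem := Finset.mem_Icc.1 (mem_Icc_of_vacuumSign_ne_zero hne i)
    rw [Pi.sub_apply, Pi.single_eq_same] at hmem
    -- The bead ends at `-1 - k`, with `k` positions between it and `0`. By `sum_fallInt` the total
    -- coefficient of `fallInt m (-1 - k)` is `(m + 1) ((s - 1) - k - (s + m + 1)) - k = (m + 2) (-1
    -- - k - m)`, which is the recursion for `fallInt (m + 1)`.
    obtain ⟨k, hk⟩ : ∃ k : ℕ, l i - s = -1 - (k : ℤ) :=
      ⟨(-1 - (l i - s)).toNat, by omega⟩
    rw [hk, Finset.sum_add_distrib, Finset.sum_const, Int.card_Ioo, nsmul_eq_mul,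
      show (0 - (-1 - (k : ℤ)) - 1).toNat = k by omega, fallInt_succ]
    have h2 := congrArg (Int.cast : ℤ → R) (sum_fallInt m k)
    push_cast at h2 ⊢
    linear_combination (-vacuumSign R (l - Pi.single i s)) * h2

/-- A nonconstant coefficient of a power series over a `ℚ`-algebra is determined by the partial
derivatives. -/
lemma coeff_eq_of_pderiv {f g : MvPowerSeries ℕ+ R} (d : ℕ+ →₀ ℕ)
    (h0 : d = 0 → MvPowerSeries.coeff 0 f = MvPowerSeries.coeff 0 g)
    (h : ∀ (r : ℕ+) (e : ℕ+ →₀ ℕ), e + Finsupp.single r 1 = d →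
      MvPowerSeries.coeff e (MvPowerSeries.pderiv R r f)
        = MvPowerSeries.coeff e (MvPowerSeries.pderiv R r g)) :
    MvPowerSeries.coeff d f = MvPowerSeries.coeff d g := by
  rcases eq_or_ne d 0 with rfl | hd
  · exact h0 rfl
  obtain ⟨r, hr⟩ := Finsupp.ne_iff.1 hd
  have hle : Finsupp.single r 1 ≤ d := by
    rw [Finsupp.single_le_iff]
    exact Nat.one_le_iff_ne_zero.2 hr
  have he : d - Finsupp.single r 1 + Finsupp.single r 1 = d := tsub_add_cancel_of_le hle
  have h1 := h r _ he
  rw [MvPowerSeries.coeff_pderiv, MvPowerSeries.coeff_pderiv, he] at h1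
  refine (isUnit_natCast_of_ne_zero (R := R)
    (Nat.succ_ne_zero ((d - Finsupp.single r 1 : ℕ+ →₀ ℕ) r))).mul_right_cancel ?_
  push_cast
  exact h1

omit [Algebra ℚ R] in
-- Vandermonde convolution for falling factorials; the identity `(m + 1) C(m, j+1) = (m - j) C(m+1,
-- j+1)` turns its binomials into commutator coefficients.
lemma sum_commCoeff_fallInt (m r : ℕ) (h : ℤ) :
    ((m : R) + 1) * (fallInt m (h + r) : R) = ((m : R) + 1) * (fallInt m h : R)
      + ∑ j ∈ Finset.range m, (commCoeff r (m + 1) (j + 1) : R)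
        * (((m - (j + 1) : ℕ) : R) + 1) * (fallInt (m - (j + 1)) h : R) := by
  rw [fallInt_add, Finset.sum_range_succ']
  push_cast
  rw [mul_add, add_comm]
  congr 1
  · simp
  · rw [Finset.mul_sum]
    refine Finset.sum_congr rfl fun j hj => ?_
    have hj := Finset.mem_range.1 hj
    have h1 := Nat.choose_mul_succ_eq m (j + 1)
    have h2 := congrArg (Nat.cast : ℕ → R) h1
    rw [Nat.cast_mul, Nat.cast_mul, show m + 1 - (j + 1) = (m - (j + 1)) + 1 by omega] at h2
    push_cast at h2
    rw [commCoeff]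
    push_cast
    linear_combination (r.descFactorial (j + 1) : R) * (fallInt (m - (j + 1)) h : R) * h2

/-- Lowering currents act on Schur functions by moving one bead. -/
theorem currentCoeff_tSchur (m : ℕ) {s : ℤ} (hs : 0 < s) {N : ℕ} (l : Fin N → ℤ) :
    currentCoeff m s (tSchur R l)
      = ((m : R) + 1) • ∑ i, (fallInt m (l i - s) : R) • tSchur R (l - Pi.single i s) := by
  suffices H : ∀ (k : ℕ) (d : ℕ+ →₀ ℕ), wt d < k → ∀ (m : ℕ) (s : ℤ), 0 < s →
      ∀ (l : Fin N → ℤ), MvPowerSeries.coeff d (currentCoeff m s (tSchur R l))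
      = ((m : R) + 1) * ∑ i, (fallInt m (l i - s) : R) *
          MvPowerSeries.coeff d (tSchur R (l - Pi.single i s)) by
    ext d
    rw [H (wt d + 1) d (Nat.lt_succ_self _) m s hs l]
    simp [map_sum]
  intro k
  induction k with
  | zero => intro d hd; omega
  | succ k ih =>
    intro d hd m s hs l
    have hconv : ∀ e, ((m : R) + 1) * ∑ i, (fallInt m (l i - s) : R) *
          MvPowerSeries.coeff e (tSchur R (l - Pi.single i s))
        = MvPowerSeries.coeff e (((m : R) + 1) • ∑ i, (fallInt m (l i - s) : R) •
          tSchur R (l - Pi.single i s)) := by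
      intro e; simp [map_sum]
    rw [hconv]
    apply coeff_eq_of_pderiv
    · intro _
      rw [constantCoeff_currentCoeff_tSchur m hs, ← hconv]
      simp only [coeff_zero_tSchur]
    · intro r e he
      have hr := r.pos
      have hwt : wt e < k := by
        rw [← he, wt_add_single] at hd
        omega
      have hcomm : MvPowerSeries.pderiv R r (currentCoeff m s (tSchur R l))
          = currentCoeff m s (MvPowerSeries.pderiv R r (tSchur R l))
            + ∑ j ∈ Finset.range (m + 1), (commCoeff r (m + 1) (j + 1) : R) •
              currentPow (m + 1 - (j + 1)) (s + (r : ℕ)) (tSchur R l) :=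
        pderiv_currentPow r (m + 1) s (tSchur R l)
      have hzero : currentPow 0 (s + (r : ℕ)) (tSchur R l) = 0 := if_neg (by omega)
      rw [hcomm, pderiv_tSchur, currentCoeff_sum, Finset.sum_range_succ, Nat.sub_self, hzero, smul_zero, add_zero, map_add, map_sum, map_sum]
      have h1 : ∀ j ∈ Finset.range m, MvPowerSeries.coeff e ((commCoeff r (m + 1) (j + 1) : R) •
            currentPow (m + 1 - (j + 1)) (s + (r : ℕ)) (tSchur R l))
          = (commCoeff r (m + 1) (j + 1) : R) * ((((m - (j + 1) : ℕ) : R) + 1)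
            * ∑ i, (fallInt (m - (j + 1)) (l i - (s + (r : ℕ))) : R) *
              MvPowerSeries.coeff e (tSchur R (l - Pi.single i (s + (r : ℕ))))) := by
        intro j hj
        have hj := Finset.mem_range.1 hj
        rw [MvPowerSeries.coeff_smul, show m + 1 - (j + 1) = (m - (j + 1)) + 1 by omega,
          currentPow, ih e hwt _ _ (by omega)]
      rw [Finset.sum_congr rfl h1, Finset.sum_congr rfl fun j _ => ih e hwt m s hs _,
        Derivation.map_smul, map_sum, MvPowerSeries.coeff_smul, map_sum, ← Finset.mul_sum]
      simp only [Derivation.map_smul, pderiv_tSchur, MvPowerSeries.coeff_smul, map_sum,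
        Finset.mul_sum]
      rw [Finset.sum_comm (s := Finset.range m), Finset.sum_comm (s := Finset.univ) (t := Finset.univ),
        ← Finset.sum_add_distrib]
      refine Finset.sum_congr rfl fun i _ => ?_
      have hterm : ∀ j, (l - Pi.single j ((r : ℕ) : ℤ) - Pi.single i s : Fin N → ℤ)
          = l - Pi.single i s - Pi.single j ((r : ℕ) : ℤ) := fun j => by
        rw [sub_right_comm]
      simp only [hterm]
      -- For `j ≠ i` moving bead `j` by `r` does not affect the coefficient of bead `i`. For `j = i`
      -- it shifts the argument of the falling factorial by `r`; the commutator terms, which lower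
      -- bead `i` by `s + r` at once, compensate for this.
      rw [← Finset.add_sum_erase _ _ (Finset.mem_univ i),
        ← Finset.add_sum_erase (a := i) _ (fun j => ((m : R) + 1) * ((fallInt m (l i - s) : R) * _))
          (Finset.mem_univ i), add_right_comm]
      congr 1
      · have h2 := sum_commCoeff_fallInt (R := R) m r (l i - (s + (r : ℕ)))
        rw [show l i - (s + (r : ℕ)) + (r : ℕ) = l i - s by ring] at h2
        rw [sub_sub l, ← Pi.single_add, Pi.sub_apply, Pi.single_eq_same, sub_sub, add_comm ((r:ℕ) : ℤ) s,
          ← mul_assoc, ← mul_assoc, h2, add_mul (((m : R) + 1) * _), Finset.sum_mul]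
        congr 1
        refine Finset.sum_congr rfl fun j _ => by ring
      · refine Finset.sum_congr rfl fun j hj => ?_
        have hji : i ≠ j := (Finset.ne_of_mem_erase hj).symm
        rw [Pi.sub_apply, Pi.single_eq_of_ne hji, sub_zero]

omit [Algebra ℚ R] in
lemma rat_inv_smul_smul {M : Type*} [AddCommGroup M] [Module R M] [Module ℚ M] (m : ℕ) (x : M) :
    ((m : ℚ) + 1)⁻¹ • (((m : R) + 1) • x) = x := by
  have h : ((m : R) + 1) • x = ((m : ℚ) + 1) • x := by
    have h1 : ((m : R) + 1) = ((m + 1 : ℕ) : R) := by push_cast; rfl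
    have h2 : ((m : ℚ) + 1) = ((m + 1 : ℕ) : ℚ) := by push_cast; rfl
    rw [h1, h2, Nat.cast_smul_eq_nsmul, Nat.cast_smul_eq_nsmul]
  rw [h, inv_smul_smul₀ (by positivity)]

lemma Yhat_fallPoly (m : ℕ) (n : ℤ) :
    Yhat (Polynomial.aeval (wD R) (fallPoly R m) * wx R (-n))
      = ((m : ℚ) + 1)⁻¹ • currentCoeff m n := by
  have h := wGen_eq (R := R) m (-n - m)
  rw [show (m : ℤ) + (-n - m) = -n by ring] at h
  rw [← h, Yhat_wGen]
  congr 2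
  ring

/-- The operators `Ŷ_{p(D) x ^ (-n)}` are linear. -/
lemma exists_linearMap_Yhat (p : Polynomial R) (n : ℤ) :
    ∃ L : MvPowerSeries ℕ+ R →ₗ[R] MvPowerSeries ℕ+ R,
      ∀ f, Yhat (Polynomial.aeval (wD R) p * wx R (-n)) f = L f := by
  induction fallPoly_span p using Submodule.span_induction with
  | mem x hx =>
    obtain ⟨m, rfl⟩ := hx
    refine ⟨algebraMap ℚ R ((m : ℚ) + 1)⁻¹ • currentLin (m + 1) n, fun f => ?_⟩
    rw [Yhat_fallPoly, Pi.smul_apply, LinearMap.smul_apply, algebraMap_smul]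
    rfl
  | zero => exact ⟨0, fun f => by simp⟩
  | add x y _ _ hx hy =>
    obtain ⟨L, hL⟩ := hx
    obtain ⟨L', hL'⟩ := hy
    exact ⟨L + L', fun f => by rw [map_add, add_mul, map_add, Pi.add_apply, hL, hL']; rfl⟩
  | smul a x _ hx =>
    obtain ⟨L, hL⟩ := hx
    exact ⟨a • L, fun f => by rw [map_smul, smul_mul_assoc, map_smul, Pi.smul_apply, hL]; rfl⟩

/-- The operators `Ŷ_{p(D) x ^ (-n)}` lower the weighted degree by `n`. -/
lemma coeff_Yhat_congr (p : Polynomial R) (n : ℤ) {f g : MvPowerSeries ℕ+ R} (d : ℕ+ →₀ ℕ)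
    (h : ∀ e : ℕ+ →₀ ℕ, (wt e : ℤ) = wt d + n →
      MvPowerSeries.coeff e f = MvPowerSeries.coeff e g) :
    MvPowerSeries.coeff d (Yhat (Polynomial.aeval (wD R) p * wx R (-n)) f)
      = MvPowerSeries.coeff d (Yhat (Polynomial.aeval (wD R) p * wx R (-n)) g) := by
  induction fallPoly_span p using Submodule.span_induction with
  | mem x hx =>
    obtain ⟨m, rfl⟩ := hx
    have h1 : MvPowerSeries.coeff d (currentCoeff m n f)
        = MvPowerSeries.coeff d (currentCoeff m n g) := coeff_currentPow_congr (m + 1) n d h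
    rw [Yhat_fallPoly, Pi.smul_apply, Pi.smul_apply, ← algebraMap_smul R,
      ← algebraMap_smul R (_ : ℚ) (currentCoeff m n g), MvPowerSeries.coeff_smul,
      MvPowerSeries.coeff_smul, h1]
  | zero => simp
  | add x y _ _ hx hy =>
    rw [map_add, add_mul, map_add, Pi.add_apply, Pi.add_apply, map_add, map_add, hx, hy]
  | smul a x _ hx =>
    rw [map_smul, smul_mul_assoc, map_smul, Pi.smul_apply, Pi.smul_apply,
      MvPowerSeries.coeff_smul, MvPowerSeries.coeff_smul, hx]

/-- The lowering operators `Ŷ_{p(D) x ^ (-n)}` move one bead down by `n`. -/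
lemma Yhat_tSchur (p : Polynomial R) {n : ℤ} (hn : 0 < n) {N : ℕ} (l : Fin N → ℤ) :
    Yhat (Polynomial.aeval (wD R) p * wx R (-n)) (tSchur R l)
      = ∑ i, p.eval (((l i - n : ℤ) : R) + 1) • tSchur R (l - Pi.single i n) := by
  induction fallPoly_span p using Submodule.span_induction with
  | mem x hx =>
    obtain ⟨m, rfl⟩ := hx
    rw [Yhat_fallPoly, Pi.smul_apply, currentCoeff_tSchur m hn, rat_inv_smul_smul]
    simp only [eval_fallPoly]
  | zero => simp
  | add x y _ _ hx hy =>
    rw [map_add, add_mul, map_add, Pi.add_apply, hx, hy]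
    simp only [Polynomial.eval_add, add_smul, Finset.sum_add_distrib]
  | smul a x _ hx =>
    rw [map_smul, smul_mul_assoc, map_smul, Pi.smul_apply, hx]
    simp only [Polynomial.eval_smul, smul_eq_mul, mul_smul, Finset.smul_sum]

/-- `R̂_n` in the form `Ŷ_{p(D) x ^ (-n)}`. -/
lemma exists_Rhat_eq (β : R) (n : ℕ) : ∃ p : Polynomial R,
    Rhat β n = Yhat (Polynomial.aeval (wD R) p * wx R (-(n : ℤ))) ∧
      ∀ x : R, p.eval x = (ladderPoly β n).eval (x + n) := by
  refine ⟨(ladderPoly β n).comp (Polynomial.X - Polynomial.C ((-(n : ℤ) : ℤ) : R)), ?_, ?_⟩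
  · rw [Rhat_eq_Yhat, bmm_pow, wx_mul_aeval]
  · intro x
    simp [Polynomial.eval_comp]

/-- `R̂_n` as a linear map. -/
lemma exists_linearMap_Rhat (β : R) (n : ℕ) :
    ∃ L : MvPowerSeries ℕ+ R →ₗ[R] MvPowerSeries ℕ+ R, ∀ f, Rhat β n f = L f := by
  obtain ⟨p, hp, _⟩ := exists_Rhat_eq β n
  rw [hp]
  exact exists_linearMap_Yhat p n

lemma coeff_Rhat_congr (β : R) (n : ℕ) {f g : MvPowerSeries ℕ+ R} (d : ℕ+ →₀ ℕ)
    (h : ∀ e : ℕ+ →₀ ℕ, wt e = wt d + n → MvPowerSeries.coeff e f = MvPowerSeries.coeff e g) :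
    MvPowerSeries.coeff d (Rhat β n f) = MvPowerSeries.coeff d (Rhat β n g) := by
  obtain ⟨p, hp, _⟩ := exists_Rhat_eq β n
  rw [hp]
  exact coeff_Yhat_congr p n d fun e he => h e (by exact_mod_cast he)

lemma Rhat_tSchur (β : R) (n : ℕ+) {N : ℕ} (l : Fin N → ℤ) :
    Rhat β n (tSchur R l) = ∑ i, (∏ k ∈ Finset.range n, (1 - β * ((l i - k : ℤ) : R))) •
      tSchur R (l - Pi.single i ((n : ℕ) : ℤ)) := by
  obtain ⟨p, hp, hp'⟩ := exists_Rhat_eq β n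
  rw [hp, Yhat_tSchur p (by exact_mod_cast n.pos)]
  refine Finset.sum_congr rfl fun i _ => ?_
  rw [hp', eval_ladderPoly]
  congr 1
  rw [Finset.range_eq_Ico, Finset.prod_Ico_eq_prod_range, ← Finset.Ico_add_one_right_eq_Icc,
    Finset.prod_Ico_eq_prod_range]
  refine Finset.prod_congr (by simp) fun k _ => ?_
  push_cast
  ring

end Action

/-! ### Partitions as bead configurations up to permutation -/

section Beads

/-- The weighted degree of the Schur function with bead positions `l`. -/
def beadDegree {N : ℕ} (l : Fin N → ℤ) : ℤ := ∑ i, (l i + i + 1)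

lemma beadDegree_comp_perm {N : ℕ} (l : Fin N → ℤ) (σ : Equiv.Perm (Fin N)) :
    beadDegree (l ∘ σ) = beadDegree l := by
  simp only [beadDegree, Finset.sum_add_distrib, Function.comp_apply]
  rw [Equiv.sum_comp σ l]

lemma beadDegree_add_single {N : ℕ} (l : Fin N → ℤ) (i : Fin N) (s : ℤ) :
    beadDegree (l + Pi.single i s) = beadDegree l + s := by
  simp only [beadDegree, Finset.sum_add_distrib, Pi.add_apply]
  rw [Finset.sum_pi_single']
  simp
  ring

lemma beadDegree_sub_single {N : ℕ} (l : Fin N → ℤ) (i : Fin N) (s : ℤ) :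
    beadDegree (l - Pi.single i s) = beadDegree l - s := by
  rw [sub_eq_add_neg, ← Pi.single_neg, beadDegree_add_single, sub_eq_add_neg]

/-- Zeros stand at the end of a weakly decreasing list, so the default value `0` hides their
deletion. `Nat.Partition.ofSums` discards zeros in this way. -/
lemma getD_eq_of_sorted {L : List ℕ} (hL : L.Pairwise (· ≥ ·)) (i : ℕ) :
    (L.filter (· ≠ 0)).getD i 0 = L.getD i 0 := by
  induction L generalizing i with
  | nil => simp
  | cons a L ih =>
    rw [List.pairwise_cons] at hL
    by_cases ha : a = 0
    · subst ha
      have h0 : ∀ b ∈ L, b = 0 := fun b hb => Nat.le_zero.1 (hL.1 b hb)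
      have h1 : L.filter (· ≠ 0) = [] := by
        rw [List.filter_eq_nil_iff]
        intro b hb
        simp [h0 b hb]
      rw [List.filter_cons_of_neg (by simp), h1]
      rcases i with _ | i
      · simp
      · rw [List.getD_cons_succ, ← ih hL.2, h1]
        simp
    · rw [List.filter_cons_of_pos (by simp [ha])]
      rcases i with _ | i
      · simp
      · rw [List.getD_cons_succ, List.getD_cons_succ, ih hL.2]

lemma list_eq_of_getD {L L' : List ℕ} (hL : ∀ a ∈ L, 0 < a) (hL' : ∀ a ∈ L', 0 < a)
    (h : ∀ i, L.getD i 0 = L'.getD i 0) : L = L' := by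
  induction L generalizing L' with
  | nil =>
    rcases L' with _ | ⟨b, L'⟩
    · rfl
    · have := h 0
      have := hL' b (by simp)
      simp at *
      omega
  | cons a L ih =>
    rcases L' with _ | ⟨b, L'⟩
    · have := h 0
      have := hL a (by simp)
      simp at *
      omega
    · have h0 : a = b := by simpa using h 0
      have h1 : L = L' := ih (fun c hc => hL c (by simp [hc])) (fun c hc => hL' c (by simp [hc]))
        fun i => by simpa using h (i + 1)
      rw [h0, h1]

lemma antitone_getD {L : List ℕ} (hL : L.Pairwise (· ≥ ·)) : Antitone fun i => L.getD i 0 := by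
  intro i j hij
  rcases hij.eq_or_lt with rfl | hij
  · exact le_rfl
  simp only
  rcases lt_or_ge j L.length with hj | hj
  · rw [List.getD_eq_getElem _ _ hj, List.getD_eq_getElem _ _ (hij.trans hj)]
    exact List.pairwise_iff_getElem.1 hL i j _ _ hij
  · rw [List.getD_eq_default _ _ hj]
    exact Nat.zero_le _

lemma antitone_part {n : ℕ} (lam : n.Partition) : Antitone (part lam) :=
  antitone_getD (Multiset.pairwise_sort _ _)

lemma card_parts_le {n : ℕ} (lam : n.Partition) : Multiset.card lam.parts ≤ n := by
  have h := Multiset.card_nsmul_le_sum (s := lam.parts) (a := 1) fun x hx => lam.parts_pos hx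
  rw [lam.parts_sum] at h
  simpa using h

lemma beads_strictAnti {n : ℕ} (lam : n.Partition) (N : ℕ) : StrictAnti (beads lam N) := by
  intro i j hij
  have h := antitone_part lam (show (i : ℕ) ≤ j from hij.le)
  have h2 : (i : ℕ) < j := hij
  simp only [beads]
  omega

lemma beads_injective {n N : ℕ} (hN : n ≤ N) :
    Function.Injective fun lam : n.Partition => beads lam N := by
  intro lam mu h
  have hp : ∀ i, part lam i = part mu i := by
    intro i
    rcases lt_or_ge i N with hi | hi
    · have := congrFun h ⟨i, hi⟩
      simp only [beads] at this
      omega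
    · rw [part_eq_zero _ ((card_parts_le lam).trans (hN.trans hi)),
        part_eq_zero _ ((card_parts_le mu).trans (hN.trans hi))]
  have hs : lam.parts.sort (· ≥ ·) = mu.parts.sort (· ≥ ·) :=
    list_eq_of_getD (fun a ha => lam.parts_pos ((Multiset.mem_sort _).1 ha))
      (fun a ha => mu.parts_pos ((Multiset.mem_sort _).1 ha)) hp
  apply Nat.Partition.ext
  rw [← Multiset.sort_eq lam.parts (· ≥ ·), hs, Multiset.sort_eq]

lemma strictAnti_add_le {N : ℕ} {l : Fin N → ℤ} (hl : StrictAnti l) (k : ℕ) :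
    ∀ i : Fin N, ∀ h : (i : ℕ) + k < N, l ⟨i + k, h⟩ + k ≤ l i := by
  induction k with
  | zero => intro i h; simp
  | succ k ih =>
    intro i h
    have h1 := ih i (by omega)
    have h2 : l ⟨i + (k + 1), h⟩ < l ⟨i + k, by omega⟩ := hl (by simp [Fin.lt_def])
    push_cast
    omega

lemma exists_beads_eq_of_strictAnti {n N : ℕ} {l : Fin N → ℤ} (hl : StrictAnti l)
    (hlow : ∀ i, -(N : ℤ) ≤ l i) (hdeg : beadDegree l = n) :
    ∃ lam : n.Partition, beads lam N = l := by
  -- The lowest bead is at least `-N` and positions strictly decrease, so bead `i` is not below its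
  -- vacuum place `-(i + 1)`; the excess is the part.
  have hnn : ∀ i : Fin N, 0 ≤ l i + i + 1 := by
    intro i
    have h := strictAnti_add_le hl (N - 1 - i) i (by omega)
    have h2 := hlow ⟨i + (N - 1 - i), by omega⟩
    have : ((N - 1 - (i : ℕ) : ℕ) : ℤ) = N - 1 - i := by omega
    omega
  set L : List ℕ := List.ofFn fun i : Fin N => (l i + i + 1).toNat with hLdef
  have hLs : L.Pairwise (· ≥ ·) := by
    rw [hLdef, List.pairwise_ofFn]
    intro i j hij
    have hij' : (i : ℕ) < j := hij
    have h := strictAnti_add_le hl (j - i) i (by omega)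
    have h2 : (⟨i + (j - i), by omega⟩ : Fin N) = j := Fin.ext (by simp; omega)
    rw [h2] at h
    have : ((j - i : ℕ) : ℤ) = (j : ℤ) - i := by omega
    simp only [ge_iff_le]
    omega
  have hsum : (L : Multiset ℕ).sum = n := by
    rw [Multiset.sum_coe, hLdef, List.sum_ofFn]
    have : ((∑ i : Fin N, (l i + i + 1).toNat : ℕ) : ℤ) = n := by
      rw [← hdeg, beadDegree, Nat.cast_sum]
      exact Finset.sum_congr rfl fun i _ => Int.toNat_of_nonneg (hnn i)
    exact_mod_cast this
  refine ⟨Nat.Partition.ofSums n L hsum, ?_⟩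
  have hsort : (Nat.Partition.ofSums n (L : Multiset ℕ) hsum).parts.sort (· ≥ ·)
      = L.filter (· ≠ 0) := by
    have h1 : (Nat.Partition.ofSums n (L : Multiset ℕ) hsum).parts
        = ((L.filter (· ≠ 0) : List ℕ) : Multiset ℕ) := by
      simp [Nat.Partition.ofSums]
    rw [h1]
    exact List.Perm.eq_of_pairwise (fun a b _ _ h1 h2 => le_antisymm h2 h1)
      (Multiset.pairwise_sort _ _) (hLs.filter _)
      (Multiset.coe_eq_coe.1 (Multiset.sort_eq _ _))
  ext i
  rw [beads, part, hsort, getD_eq_of_sorted hLs, hLdef,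
    List.getD_eq_getElem _ _ (by simp), List.getElem_ofFn, Int.toNat_of_nonneg (hnn _)]
  simp

lemma exists_beads_comp_eq {n N : ℕ} {l : Fin N → ℤ} (hl : Function.Injective l)
    (hlow : ∀ i, -(N : ℤ) ≤ l i) (hdeg : beadDegree l = n) :
    ∃ (lam : n.Partition) (σ : Equiv.Perm (Fin N)), beads lam N ∘ σ = l := by
  set τ := Tuple.sort fun i => -l i
  have hmono : Monotone ((fun i => -l i) ∘ τ) := Tuple.monotone_sort _
  have hanti : StrictAnti (l ∘ τ) := by
    apply Antitone.strictAnti_of_injective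
    · intro i j hij
      have := hmono hij
      simpa using this
    · exact hl.comp τ.injective
  obtain ⟨lam, h⟩ := exists_beads_eq_of_strictAnti (n := n) hanti (fun i => hlow _)
    (by rw [beadDegree_comp_perm, hdeg])
  refine ⟨lam, τ⁻¹, ?_⟩
  rw [h]
  ext i
  simp

/-- Sums over partitions of `n` as sums over all bead configurations with `N` beads. -/
lemma finsum_beads {M : Type*} [AddCommMonoid M] {n N : ℕ} (hN : n ≤ N) (F : (Fin N → ℤ) → M)
    (hperm : ∀ l (σ : Equiv.Perm (Fin N)), F (l ∘ σ) = F l)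
    (hinj : ∀ l, ¬ Function.Injective l → F l = 0)
    (hlow : ∀ l i, l i < -(N : ℤ) → F l = 0) (hdeg : ∀ l, beadDegree l ≠ n → F l = 0) :
    ∑ᶠ l, F l = N.factorial • ∑ lam : n.Partition, F (beads lam N) := by
  classical
  -- Each configuration in the support rearranges the beads of exactly one partition in exactly one
  -- way, which accounts for `N!`. The bound `n ≤ N` makes all parts visible to the `N` beads.
  set g : n.Partition × Equiv.Perm (Fin N) → (Fin N → ℤ) := fun x => beads x.1 N ∘ x.2 with hg
  have hginj : Function.Injective g := by
    rintro ⟨lam, σ⟩ ⟨mu, τ⟩ h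
    simp only [hg] at h
    have hr : Set.range (fun i => -beads lam N i) = Set.range (fun i => -beads mu N i) := by
      have h1 := congrArg (fun f : Fin N → ℤ => Set.range fun i => -f i) h
      have h2 : ∀ (f : Fin N → ℤ) (σ : Equiv.Perm (Fin N)),
          (Set.range fun i => -(f ∘ σ) i) = Set.range fun i => -f i := fun f σ =>
        σ.surjective.range_comp fun i => -f i
      simpa only [h2] using h1
    have h1 : (fun i => -beads lam N i) = fun i => -beads mu N i :=
      (StrictMono.range_inj (fun i j hij => neg_lt_neg (beads_strictAnti lam N hij))
        (fun i j hij => neg_lt_neg (beads_strictAnti mu N hij))).1 hr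
    have h2 : beads lam N = beads mu N := by
      ext i
      exact neg_injective (congrFun h1 i)
    have h3 : lam = mu := beads_injective hN h2
    subst h3
    have h4 : σ = τ := by
      ext i
      exact congrArg Fin.val ((beads_strictAnti lam N).injective (congrFun h i))
    rw [h4]
  rw [finsum_eq_sum_of_support_subset (s := Finset.univ.map ⟨g, hginj⟩), Finset.sum_map,
    Fintype.sum_prod_type, Finset.smul_sum]
  · refine Finset.sum_congr rfl fun lam _ => ?_
    simp only [Function.Embedding.coeFn_mk, hg, hperm]
    simp [Fintype.card_perm]
  · intro l hl
    rw [Function.mem_support] at hl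
    have h1 : Function.Injective l := by
      by_contra h; exact hl (hinj l h)
    have h2 : ∀ i, -(N : ℤ) ≤ l i := by
      intro i
      by_contra h; exact hl (hlow l i (not_le.1 h))
    have h3 : beadDegree l = n := by
      by_contra h; exact hl (hdeg l h)
    obtain ⟨lam, σ, h⟩ := exists_beads_comp_eq h1 h2 h3
    simp only [Finset.coe_map, Function.Embedding.coeFn_mk, Finset.coe_univ, Set.image_univ]
    exact ⟨(lam, σ), h⟩

lemma finite_beads (N : ℕ) (n : ℤ) :
    {l : Fin N → ℤ | (∀ i, -(N : ℤ) ≤ l i) ∧ beadDegree l = n}.Finite := by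
  refine (Set.finite_Icc (fun _ : Fin N => -(N : ℤ)) (fun _ => n + N * N)).subset ?_
  rintro l ⟨h1, h2⟩
  refine ⟨fun i => h1 i, fun i => ?_⟩
  have h3 : ∑ j ∈ Finset.univ.erase i, (-(N : ℤ)) ≤ ∑ j ∈ Finset.univ.erase i, (l j + j + 1) :=
    Finset.sum_le_sum fun j _ => by have := h1 j; omega
  rw [Finset.sum_const, Finset.card_erase_of_mem (Finset.mem_univ i), Finset.card_univ,
    Fintype.card_fin, nsmul_eq_mul] at h3
  have h4 := Finset.add_sum_erase Finset.univ (fun j => l j + j + 1) (Finset.mem_univ i)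
  rw [beadDegree] at h2
  rw [h2] at h4
  have hi := i.2
  have h5 : ((N - 1 : ℕ) : ℤ) = N - 1 := by omega
  rw [h5] at h3
  simp only at h4 ⊢
  nlinarith

end Beads

/-! ### Homogeneity of Schur functions -/

section Homogeneity

variable {R : Type*} [CommRing R] [Algebra ℚ R]

lemma beadDegree_of_vacuumSign_ne_zero {N : ℕ} {l : Fin N → ℤ} (h : vacuumSign R l ≠ 0) :
    beadDegree l = 0 := by
  have hinj : Function.Injective l := by
    by_contra hn
    exact h (vacuumSign_eq_zero_of_not_injective hn)
  have hlow : ∀ i, -(N : ℤ) ≤ l i := fun i =>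
    (Finset.mem_Icc.1 (mem_Icc_of_vacuumSign_ne_zero h i)).1
  have h1 : ∑ i, l i = ∑ i : Fin N, (-((i : ℤ) + 1)) := by
    have hv : Function.Injective fun i : Fin N => (-((i : ℤ) + 1)) := by
      intro i j hij
      simp only at hij
      exact Fin.ext (by omega)
    have himg : Finset.univ.image (fun i : Fin N => (-((i : ℤ) + 1)))
        = Finset.Icc (-(N : ℤ)) (-1) := by
      apply Finset.eq_of_subset_of_card_le
      · intro x hx
        obtain ⟨i, _, rfl⟩ := Finset.mem_image.1 hx
        rw [Finset.mem_Icc]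
        omega
      · rw [Finset.card_image_of_injective _ hv]
        simp
    rw [← Finset.sum_image (f := fun x : ℤ => x) (g := l) (fun i _ j _ h => hinj h),
      image_of_vacuumSign_ne_zero h, ← himg, Finset.sum_image fun i _ j _ h => hv h]
  have h2 : beadDegree l = ∑ i, l i - ∑ i : Fin N, (-((i : ℤ) + 1)) := by
    rw [beadDegree, ← Finset.sum_sub_distrib]
    exact Finset.sum_congr rfl fun i _ => by ring
  rw [h2, h1, sub_self]

/-- Schur functions are homogeneous. -/
lemma coeff_tSchur_eq_zero {N : ℕ} (l : Fin N → ℤ) (d : ℕ+ →₀ ℕ) (h : beadDegree l ≠ wt d) :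
    MvPowerSeries.coeff d (tSchur R l) = 0 := by
  suffices H : ∀ (k : ℕ) (d : ℕ+ →₀ ℕ), wt d < k → ∀ (l : Fin N → ℤ), beadDegree l ≠ wt d →
      MvPowerSeries.coeff d (tSchur R l) = MvPowerSeries.coeff d 0 by
    simpa using H (wt d + 1) d (Nat.lt_succ_self _) l h
  intro k
  induction k with
  | zero => intro d hd; omega
  | succ k ih =>
    intro d hd l hl
    apply coeff_eq_of_pderiv
    · rintro rfl
      rw [coeff_zero_tSchur, map_zero]
      by_contra hne
      exact hl (by rw [beadDegree_of_vacuumSign_ne_zero hne, wt_zero]; rfl)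
    · intro r e he
      have hr := r.pos
      rw [← he, wt_add_single] at hd hl
      rw [pderiv_tSchur, map_zero, map_sum, map_zero]
      refine Finset.sum_eq_zero fun i _ => ?_
      rw [ih e (by omega) _ (by rw [beadDegree_sub_single]; push_cast at hl; omega), map_zero]

end Homogeneity

/-! ### Content weights as products of weights of beads -/

section Weights

variable {R : Type*} [CommRing R]

/-- The weight of a bead at position `c`: the weights satisfy `ω (c - 1) = ω c * (1 - β c)`. -/
def beadWeight (β : R) : ℤ → R
  | Int.ofNat k => ∏ c ∈ Finset.range k, Ring.inverse (1 - β * ((c : R) + 1))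
  | Int.negSucc k => ∏ c ∈ Finset.range k, (1 + β * ((c : R) + 1))

lemma isUnit_one_sub {β : R} (hβ : ∀ c : ℤ, IsUnit (1 + β * (c : R))) (c : ℤ) :
    IsUnit (1 - β * (c : R)) := by
  have := hβ (-c)
  rwa [Int.cast_neg, mul_neg, ← sub_eq_add_neg] at this

lemma beadWeight_sub_one {β : R} (hβ : ∀ c : ℤ, IsUnit (1 + β * (c : R))) (c : ℤ) :
    beadWeight β (c - 1) = beadWeight β c * (1 - β * (c : R)) := by
  rcases c with (_ | k) | k
  · change beadWeight β (Int.negSucc 0) = _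
    simp [beadWeight]
  · have h : (Int.ofNat (k + 1) - 1 : ℤ) = Int.ofNat k := by
      simp only [Int.ofNat_eq_natCast]; omega
    have hu := isUnit_one_sub hβ (k + 1)
    push_cast at hu
    rw [h, beadWeight, beadWeight, Finset.prod_range_succ, mul_assoc]
    simp only [Int.ofNat_eq_natCast, Int.cast_natCast, Nat.cast_add, Nat.cast_one, Int.cast_add,
      Int.cast_one]
    rw [Ring.inverse_mul_cancel _ hu, mul_one]
  · have h : (Int.negSucc k - 1 : ℤ) = Int.negSucc (k + 1) := by omega
    rw [h, beadWeight, beadWeight, Finset.prod_range_succ, Int.cast_negSucc]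
    push_cast
    ring

lemma beadWeight_sub {β : R} (hβ : ∀ c : ℤ, IsUnit (1 + β * (c : R))) (c : ℤ) (n : ℕ) :
    beadWeight β (c - n) = beadWeight β c * ∏ k ∈ Finset.range n, (1 - β * ((c - k : ℤ) : R)) := by
  induction n with
  | zero => simp
  | succ n ih =>
    rw [Finset.prod_range_succ, ← mul_assoc, ← ih, ← beadWeight_sub_one hβ]
    congr 1
    push_cast
    ring

lemma isUnit_beadWeight {β : R} (hβ : ∀ c : ℤ, IsUnit (1 + β * (c : R))) (c : ℤ) :
    IsUnit (beadWeight β c) := by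
  rcases c with k | k
  · refine Finset.prod_induction _ IsUnit (fun _ _ => IsUnit.mul) isUnit_one fun c _ => ?_
    have hu := isUnit_one_sub hβ (c + 1)
    push_cast at hu
    exact hu.ringInverse
  · refine Finset.prod_induction _ IsUnit (fun _ _ => IsUnit.mul) isUnit_one fun c _ => ?_
    have hu := hβ (c + 1)
    push_cast at hu
    exact hu

/-- The product of the weights of all beads. -/
def totalWeight (β : R) {N : ℕ} (l : Fin N → ℤ) : R := ∏ i, beadWeight β (l i)

lemma totalWeight_comp_perm (β : R) {N : ℕ} (l : Fin N → ℤ) (σ : Equiv.Perm (Fin N)) :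
    totalWeight β (l ∘ σ) = totalWeight β l :=
  Equiv.prod_comp σ fun i => beadWeight β (l i)

lemma totalWeight_sub_single {β : R} (hβ : ∀ c : ℤ, IsUnit (1 + β * (c : R))) {N : ℕ}
    (l : Fin N → ℤ) (i : Fin N) (n : ℕ) :
    totalWeight β (l - Pi.single i (n : ℤ))
      = totalWeight β l * ∏ k ∈ Finset.range n, (1 - β * ((l i - k : ℤ) : R)) := by
  rw [totalWeight, totalWeight, ← Finset.mul_prod_erase _ _ (Finset.mem_univ i),
    ← Finset.mul_prod_erase _ (fun i => beadWeight β (l i)) (Finset.mem_univ i), Pi.sub_apply,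
    Pi.single_eq_same, beadWeight_sub hβ, mul_right_comm]
  congr 2
  refine Finset.prod_congr rfl fun j hj => ?_
  rw [Pi.sub_apply, Pi.single_eq_of_ne (Finset.ne_of_mem_erase hj), sub_zero]

/-- The weight of the vacuum configuration. -/
def vacuumWeight (β : R) (N : ℕ) : R := ∏ i : Fin N, beadWeight β (-((i : ℤ) + 1))

lemma isUnit_vacuumWeight {β : R} (hβ : ∀ c : ℤ, IsUnit (1 + β * (c : R))) (N : ℕ) :
    IsUnit (vacuumWeight β N) :=
  Finset.prod_induction _ IsUnit (fun _ _ => IsUnit.mul) isUnit_one fun _ _ =>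
    isUnit_beadWeight hβ _

/-- Raising bead `i` from its vacuum place by `λ_i` multiplies its weight by the inverse factors of
row `i`. As the vacuum weight is a unit, content weights can be replaced by `totalWeight`, which
makes sense for every configuration. -/
lemma contentWeight_mul_vacuumWeight {β : R} (hβ : ∀ c : ℤ, IsUnit (1 + β * (c : R))) {n : ℕ}
    (lam : n.Partition) {N : ℕ} (hN : Multiset.card lam.parts ≤ N) :
    contentWeight β lam * vacuumWeight β N = totalWeight β (beads lam N) := by
  have h1 : contentWeight β lam = ∏ i ∈ Finset.range N, ∏ k ∈ Finset.range (part lam i),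
      Ring.inverse (1 + β * ((k : R) + ((i + 1 : ℕ) : R) - (part lam i : R))) := by
    rw [contentWeight, ← Finset.Ico_add_one_right_eq_Icc, Finset.prod_Ico_eq_prod_range,
      Nat.add_sub_cancel]
    rw [← Finset.prod_subset (Finset.range_subset_range.2 hN)]
    · refine Finset.prod_congr rfl fun i _ => ?_
      rw [Nat.add_sub_cancel_left, add_comm 1 i]
    · intro i _ hi
      rw [Finset.mem_range, not_lt] at hi
      rw [part_eq_zero lam hi, Finset.range_zero, Finset.prod_empty]
  rw [h1, ← Fin.prod_univ_eq_prod_range (fun i => ∏ k ∈ Finset.range (part lam i),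
      Ring.inverse (1 + β * ((k : R) + ((i + 1 : ℕ) : R) - (part lam i : R)))) N, vacuumWeight,
    totalWeight, ← Finset.prod_mul_distrib]
  refine Finset.prod_congr rfl fun i _ => ?_
  have h2 := beadWeight_sub hβ (beads lam N i) (part lam i)
  rw [beads, sub_right_comm, sub_self, zero_sub] at h2
  rw [h2, ← mul_assoc, mul_comm _ (beadWeight β _), mul_assoc, ← Finset.prod_mul_distrib]
  rw [Finset.prod_eq_one, mul_one]
  · rfl
  · intro k _
    have hu := isUnit_one_sub hβ ((part lam i : ℤ) - (i + 1) - k)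
    have h3 : (1 + β * ((k : R) + (((i : ℕ) + 1 : ℕ) : R) - (part lam i : R)))
        = 1 - β * ((((part lam i : ℤ) - (i + 1) - k : ℤ)) : R) := by
      push_cast; ring
    rw [h3, Ring.inverse_mul_cancel _ hu]

end Weights

/-! ### Reindexing of sums over configurations -/

section Tau

variable {R : Type*} [CommRing R] [Algebra ℚ R]

/-- The series `∑_λ y_λ s_λ(t)` weighted by contents. -/
def schurSeries (β : R) (y : ∀ n : ℕ, n.Partition → R) : MvPowerSeries ℕ+ R := fun d =>
  ∑ lam : (wt d).Partition,
    MvPowerSeries.coeff d (schur (fun k => (MvPowerSeries.X k : MvPowerSeries ℕ+ R)) lam) *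
      (y (wt d) lam * contentWeight β lam)

lemma beadDegree_beads {n : ℕ} (lam : n.Partition) {N : ℕ} (hN : Multiset.card lam.parts ≤ N) :
    beadDegree (beads lam N) = n := by
  have h1 : beadDegree (beads lam N) = ((∑ i ∈ Finset.range N, part lam i : ℕ) : ℤ) := by
    rw [beadDegree, Nat.cast_sum, ← Fin.sum_univ_eq_sum_range (fun i => (part lam i : ℤ))]
    refine Finset.sum_congr rfl fun i _ => ?_
    rw [beads]
    ring
  have h2 : (lam.parts.sort (· ≥ ·)).length = Multiset.card lam.parts := Multiset.length_sort _
  have h3 : ∑ i ∈ Finset.range (Multiset.card lam.parts), part lam i = n := by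
    conv_rhs => rw [← lam.parts_sum, ← Multiset.sort_eq lam.parts (· ≥ ·), Multiset.sum_coe,
      ← List.ofFn_getElem (xs := lam.parts.sort (· ≥ ·)), List.sum_ofFn]
    rw [← h2, ← Fin.sum_univ_eq_sum_range]
    exact Finset.sum_congr rfl fun i _ => List.getD_eq_getElem _ _ i.2
  rw [h1, ← Finset.sum_subset (Finset.range_subset_range.2 hN) fun i _ hi => ?_, h3]
  rw [Finset.mem_range, not_lt] at hi
  exact part_eq_zero lam hi

lemma coeff_schur_eq_zero {n : ℕ} (lam : n.Partition) (d : ℕ+ →₀ ℕ) (h : n ≠ wt d) :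
    MvPowerSeries.coeff d (schur (fun k => (MvPowerSeries.X k : MvPowerSeries ℕ+ R)) lam) = 0 := by
  rw [schur_eq_beadSchur _ lam (card_parts_le lam)]
  refine coeff_tSchur_eq_zero _ d ?_
  rw [beadDegree_beads lam (card_parts_le lam)]
  exact_mod_cast h

lemma coeff_schurSeries (β : R) (y : ∀ n : ℕ, n.Partition → R) {n : ℕ} (d : ℕ+ →₀ ℕ)
    (h : wt d = n) : MvPowerSeries.coeff d (schurSeries β y)
      = ∑ lam : n.Partition,
        MvPowerSeries.coeff d (schur (fun k => (MvPowerSeries.X k : MvPowerSeries ℕ+ R)) lam) *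
          (y n lam * contentWeight β lam) := by
  subst h
  rfl

lemma tauMM_eq_schurSeries (β : R) (t' : ℕ+ → R) :
    tauMM β t' = schurSeries β fun _ lam => schur t' lam := by
  ext d
  rw [coeff_schurSeries β _ d rfl]
  refine finsum_eq_single _ (wt d) fun n hn => ?_
  exact Finset.sum_eq_zero fun lam _ => by rw [coeff_schur_eq_zero lam d hn, zero_mul]

variable {A : Type*} [CommRing A] [Algebra ℚ A]

omit [Algebra ℚ R] [Algebra ℚ A] in
lemma map_sign_mul (φ : A →+ R) {N : ℕ} (σ : Equiv.Perm (Fin N)) (a : A) :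
    φ ((Equiv.Perm.sign σ : ℤ) * a) = (Equiv.Perm.sign σ : ℤ) * φ a := by
  rcases Int.units_eq_one_or (Equiv.Perm.sign σ) with h | h <;> simp [h]

omit [Algebra ℚ R] in
lemma sign_mul_sign {N : ℕ} (σ : Equiv.Perm (Fin N)) :
    ((Equiv.Perm.sign σ : ℤ) : R) * ((Equiv.Perm.sign σ : ℤ) : R) = 1 := by
  rcases Int.units_eq_one_or (Equiv.Perm.sign σ) with h | h <;> simp [h]

lemma sub_single_comp_perm {N : ℕ} (l : Fin N → ℤ) (σ : Equiv.Perm (Fin N)) (i : Fin N) (s : ℤ) :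
    l ∘ σ - Pi.single i s = (l - Pi.single (σ i) s) ∘ σ := by
  ext k
  by_cases h : k = i
  · subst h; simp
  · have : σ k ≠ σ i := fun h' => h (σ.injective h')
    simp [h, this]

lemma add_single_comp_perm {N : ℕ} (l : Fin N → ℤ) (σ : Equiv.Perm (Fin N)) (i : Fin N) (s : ℤ) :
    l ∘ σ + Pi.single i s = (l + Pi.single (σ i) s) ∘ σ := by
  have := sub_single_comp_perm l σ i (-s)
  simpa [Pi.single_neg] using this

/-- The terms of `sum_moveDown` for the bead configuration `l`. -/
def moveDown (β : R) (u : ℕ+ → A) (φ : A →+ R) (n : ℕ) (d : ℕ+ →₀ ℕ) {N : ℕ} (i : Fin N)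
    (l : Fin N → ℤ) : R :=
  φ (beadSchur u l) * (totalWeight β (l - Pi.single i (n : ℤ)) *
    MvPowerSeries.coeff d (tSchur R (l - Pi.single i (n : ℤ))))

/-- The term of `sum_moveUp` for the bead configuration `l`. -/
def moveUp (β : R) (u : ℕ+ → A) (φ : A →+ R) (n : ℕ) (d : ℕ+ →₀ ℕ) {N : ℕ}
    (l : Fin N → ℤ) : R :=
  φ (∑ i, beadSchur u (l + Pi.single i (n : ℤ))) *
    (totalWeight β l * MvPowerSeries.coeff d (tSchur R l))

lemma coeff_tSchur_comp_perm (d : ℕ+ →₀ ℕ) {N : ℕ} (l : Fin N → ℤ) (σ : Equiv.Perm (Fin N)) :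
    MvPowerSeries.coeff d (tSchur R (l ∘ σ))
      = (Equiv.Perm.sign σ : ℤ) * MvPowerSeries.coeff d (tSchur R l) := by
  rw [tSchur, beadSchur_comp_perm]
  exact map_sign_mul (MvPowerSeries.coeff (R := R) d).toAddMonoidHom σ _

lemma moveDown_comp_perm (β : R) (u : ℕ+ → A) (φ : A →+ R) (n : ℕ) (d : ℕ+ →₀ ℕ) {N : ℕ}
    (i : Fin N) (l : Fin N → ℤ) (σ : Equiv.Perm (Fin N)) :
    moveDown β u φ n d i (l ∘ σ) = moveDown β u φ n d (σ i) l := by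
  rw [moveDown, moveDown, sub_single_comp_perm, totalWeight_comp_perm, beadSchur_comp_perm,
    coeff_tSchur_comp_perm, map_sign_mul]
  linear_combination (φ (beadSchur u l) * totalWeight β (l - Pi.single (σ i) (n : ℤ)) *
    MvPowerSeries.coeff d (tSchur R (l - Pi.single (σ i) (n : ℤ)))) * sign_mul_sign (R := R) σ

lemma moveUp_comp_perm (β : R) (u : ℕ+ → A) (φ : A →+ R) (n : ℕ) (d : ℕ+ →₀ ℕ) {N : ℕ}
    (l : Fin N → ℤ) (σ : Equiv.Perm (Fin N)) :
    moveUp β u φ n d (l ∘ σ) = moveUp β u φ n d l := by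
  have h : ∑ i, beadSchur u (l ∘ σ + Pi.single i (n : ℤ))
      = (Equiv.Perm.sign σ : ℤ) * ∑ i, beadSchur u (l + Pi.single i (n : ℤ)) := by
    rw [Finset.mul_sum]
    refine Fintype.sum_equiv σ _ _ fun i => ?_
    rw [add_single_comp_perm, beadSchur_comp_perm]
  rw [moveUp, moveUp, h, totalWeight_comp_perm, coeff_tSchur_comp_perm, map_sign_mul]
  linear_combination (φ (∑ i, beadSchur u (l + Pi.single i (n : ℤ))) * totalWeight β l *
    MvPowerSeries.coeff d (tSchur R l)) * sign_mul_sign (R := R) σ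

lemma moveDown_eq_zero_of_lt (β : R) (u : ℕ+ → A) (φ : A →+ R) (n : ℕ) (d : ℕ+ →₀ ℕ) {N : ℕ}
    (i : Fin N) {l : Fin N → ℤ} (j : Fin N) (h : l j < -(N : ℤ)) : moveDown β u φ n d i l = 0 := by
  rw [moveDown, beadSchur_eq_zero_of_lt u j h, map_zero, zero_mul]

lemma moveDown_eq_zero_of_beadDegree (β : R) (u : ℕ+ → A) (φ : A →+ R) (n : ℕ) (d : ℕ+ →₀ ℕ)
    {N : ℕ} (i : Fin N) {l : Fin N → ℤ} (h : beadDegree l ≠ ((wt d + n : ℕ) : ℤ)) :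
    moveDown β u φ n d i l = 0 := by
  rw [moveDown, coeff_tSchur_eq_zero, mul_zero, mul_zero]
  rw [beadDegree_sub_single]
  push_cast at h
  omega

lemma sum_moveDown (β : R) (u : ℕ+ → A) (φ : A →+ R) (n : ℕ) (d : ℕ+ →₀ ℕ) {N : ℕ}
    (hN : wt d + n ≤ N) :
    ∑ᶠ l : Fin N → ℤ, ∑ i, moveDown β u φ n d i l
      = N.factorial • ∑ lam : (wt d + n).Partition, ∑ i, moveDown β u φ n d i (beads lam N) := by
  refine finsum_beads hN (fun l : Fin N → ℤ => ∑ i, moveDown β u φ n d i l)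
    (fun l σ => ?_) (fun l hl => ?_) (fun l i hl => ?_) fun l hl => ?_
  · exact Fintype.sum_equiv σ _ _ fun i => moveDown_comp_perm β u φ n d i l σ
  · refine Finset.sum_eq_zero fun i _ => ?_
    rw [moveDown, beadSchur_eq_zero_of_not_injective u hl, map_zero, zero_mul]
  · exact Finset.sum_eq_zero fun j _ => moveDown_eq_zero_of_lt β u φ n d j i hl
  · exact Finset.sum_eq_zero fun j _ => moveDown_eq_zero_of_beadDegree β u φ n d j hl

lemma sum_moveUp (β : R) (u : ℕ+ → A) (φ : A →+ R) (n : ℕ) (d : ℕ+ →₀ ℕ) {N : ℕ}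
    (hN : wt d ≤ N) :
    ∑ᶠ l : Fin N → ℤ, moveUp β u φ n d l
      = N.factorial • ∑ lam : (wt d).Partition, moveUp β u φ n d (beads lam N) := by
  refine finsum_beads hN (fun l : Fin N → ℤ => moveUp β u φ n d l)
    (fun l σ => moveUp_comp_perm β u φ n d l σ) (fun l hl => ?_) (fun l i hl => ?_)
    fun l hl => ?_
  · rw [moveUp, tSchur_eq_zero_of_not_injective hl, map_zero, mul_zero, mul_zero]
  · rw [moveUp, tSchur, beadSchur_eq_zero_of_lt _ i hl, map_zero, mul_zero, mul_zero]
  · rw [moveUp, coeff_tSchur_eq_zero _ _ hl, mul_zero, mul_zero]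

/-- Translating `l` by `n` in coordinate `i` makes the lowered configuration the summation variable.
The finite supports justify exchanging the sum over `l` with the sum over `i`. -/
lemma finsum_moveDown_eq (β : R) (u : ℕ+ → A) (φ : A →+ R) (n : ℕ) (d : ℕ+ →₀ ℕ) (N : ℕ) :
    ∑ᶠ l, ∑ i : Fin N, moveDown β u φ n d i l = ∑ᶠ l : Fin N → ℤ, moveUp β u φ n d l := by
  have hfin : ∀ i : Fin N, (Function.support (moveDown β u φ n d i)).Finite := by
    refine fun i => (finite_beads N ((wt d + n : ℕ) : ℤ)).subset fun l hl => ⟨fun j => ?_, ?_⟩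
    · by_contra h
      exact hl (moveDown_eq_zero_of_lt β u φ n d i j (not_le.1 h))
    · by_contra h
      exact hl (moveDown_eq_zero_of_beadDegree β u φ n d i h)
  have hfin2 : ∀ i : Fin N, (Function.support
      (moveDown β u φ n d i ∘ Equiv.addRight (Pi.single i (n : ℤ) : Fin N → ℤ))).Finite := by
    intro i
    rw [Function.support_comp_eq_preimage]
    exact (hfin i).preimage (Equiv.injective _).injOn
  have h1 : ∀ i : Fin N, ∑ᶠ l, moveDown β u φ n d i l
      = ∑ᶠ l, (moveDown β u φ n d i ∘ Equiv.addRight (Pi.single i (n : ℤ) : Fin N → ℤ)) l :=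
    fun i => (finsum_comp_equiv (Equiv.addRight (Pi.single i (n : ℤ) : Fin N → ℤ))).symm
  rw [finsum_sum_comm _ _ fun i _ => hfin i, Finset.sum_congr rfl fun i _ => h1 i,
    ← finsum_sum_comm _ _ fun i _ => hfin2 i]
  refine finsum_congr fun l => ?_
  rw [moveUp, map_sum, Finset.sum_mul]
  refine Finset.sum_congr rfl fun i _ => ?_
  rw [Function.comp_apply, Equiv.coe_addRight, moveDown, add_sub_cancel_right]

/-- Summing over all bead configurations, moving a bead of `s_l(t)` down amounts to moving a bead
of `s_l(u)` up. -/
lemma sum_moveDown_eq_sum_moveUp (β : R) (u : ℕ+ → A) (φ : A →+ R) (n : ℕ) (d : ℕ+ →₀ ℕ)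
    {N : ℕ} (hN : wt d + n ≤ N) :
    ∑ lam : (wt d + n).Partition, ∑ i, moveDown β u φ n d i (beads lam N)
      = ∑ lam : (wt d).Partition, moveUp β u φ n d (beads lam N) := by
  have h := finsum_moveDown_eq β u φ n d N
  rw [sum_moveDown β u φ n d hN, sum_moveUp β u φ n d (by omega), nsmul_eq_mul,
    nsmul_eq_mul] at h
  exact (isUnit_natCast_of_ne_zero N.factorial_ne_zero).mul_left_cancel h

end Tau

/-! ### Transfer of `Rhat` to the second set of times -/

section Intertwining

variable {R : Type*} [CommRing R] [Algebra ℚ R] {A : Type*} [CommRing A] [Algebra ℚ A]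

/-- The additive map `φ` covers two uses: the identity gives the equation for `tauMM`, and a
coefficient functional in formal second times gives the one for `tauCoeff`. -/
lemma vacuumWeight_mul_coeff_Rhat {β : R} (hβ : ∀ c : ℤ, IsUnit (1 + β * (c : R))) (u : ℕ+ → A)
    (φ : A →+ R) (n : ℕ+) (d : ℕ+ →₀ ℕ) :
    MvPowerSeries.coeff d (Rhat β n (schurSeries β fun _ lam => φ (schur u lam))) *
        vacuumWeight β (wt d + n)
      = ∑ lam : (wt d + n).Partition, ∑ i, moveDown β u φ n d i (beads lam (wt d + n)) := by
  have h1 : MvPowerSeries.coeff d (Rhat β n (schurSeries β fun _ lam => φ (schur u lam)))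
      = MvPowerSeries.coeff d (Rhat β n (∑ lam : (wt d + n).Partition,
        (φ (schur u lam) * contentWeight β lam) • tSchur R (beads lam (wt d + n)))) := by
    -- Only the part of degree `wt d + n` matters, so the series may be replaced by a finite sum, to
    -- which linearity applies.
    refine coeff_Rhat_congr β n d fun e he => ?_
    rw [coeff_schurSeries β _ e he, map_sum]
    refine Finset.sum_congr rfl fun lam _ => ?_
    rw [MvPowerSeries.coeff_smul, schur_eq_beadSchur _ lam (card_parts_le lam), tSchur, mul_comm]
  obtain ⟨L, hL⟩ := exists_linearMap_Rhat β n
  rw [h1, hL, map_sum, map_sum, Finset.sum_mul]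
  refine Finset.sum_congr rfl fun lam _ => ?_
  rw [map_smul, ← hL, Rhat_tSchur, MvPowerSeries.coeff_smul, map_sum, Finset.mul_sum,
    Finset.sum_mul]
  refine Finset.sum_congr rfl fun i _ => ?_
  rw [moveDown, totalWeight_sub_single hβ,
    ← contentWeight_mul_vacuumWeight hβ lam (card_parts_le lam), MvPowerSeries.coeff_smul,
    ← schur_eq_beadSchur u lam (card_parts_le lam)]
  ring

/-- The operators `R̂_n` act on the second set of times by multiplication with `n u_n`. -/
lemma Rhat_schurSeries {β : R} (hβ : ∀ c : ℤ, IsUnit (1 + β * (c : R))) (u : ℕ+ → A)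
    (φ : A →+ R) (n : ℕ+) :
    Rhat β n (schurSeries β fun _ lam => φ (schur u lam))
      = schurSeries β fun _ lam => φ ((n : A) * u n * schur u lam) := by
  ext d
  refine (isUnit_vacuumWeight hβ (wt d + n)).mul_right_cancel ?_
  rw [vacuumWeight_mul_coeff_Rhat hβ, sum_moveDown_eq_sum_moveUp β u φ n d le_rfl,
    coeff_schurSeries β _ d rfl, Finset.sum_mul]
  refine Finset.sum_congr rfl fun lam _ => ?_
  have hN : Multiset.card lam.parts ≤ wt d + n := (card_parts_le lam).trans (Nat.le_add_right _ _)
  rw [moveUp, ← contentWeight_mul_vacuumWeight hβ lam hN, schur_eq_beadSchur _ lam hN,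
    schur_eq_beadSchur u lam hN, mul_beadSchur u _ n (Nat.le_add_left _ _), tSchur]
  · ring
  -- A partition of `wt d` has at most `wt d` parts, so with `N = wt d + n` beads the last `n` are
  -- in their vacuum places.
  · intro a ha
    refine ⟨a, ?_⟩
    rw [beads, part_eq_zero lam ((card_parts_le lam).trans (by omega))]
    simp

end Intertwining

/-! ### The universal tau-function and uniqueness -/

section Uniqueness

variable {R : Type*} [CommRing R] [Algebra ℚ R]

/-- The coefficient of the monomial `e` in the second times of the universal tau-function. -/
def tauCoeff (β : R) (e : ℕ+ →₀ ℕ) : MvPowerSeries ℕ+ R :=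
  schurSeries β fun _ lam =>
    MvPowerSeries.coeff e (schur (fun k => (MvPowerSeries.X k : MvPowerSeries ℕ+ R)) lam)

/-- This is `R̂_n τ = n u_n τ` with formal second times `u`, read off at the monomial `e` in `u`. -/
lemma Rhat_tauCoeff {β : R} (hβ : ∀ c : ℤ, IsUnit (1 + β * (c : R))) (n : ℕ+) (e : ℕ+ →₀ ℕ) :
    Rhat β n (tauCoeff β e)
      = if e n = 0 then 0 else (n : R) • tauCoeff β (e - Finsupp.single n 1) := by
  have h := Rhat_schurSeries hβ (fun k => (MvPowerSeries.X k : MvPowerSeries ℕ+ R))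
    (MvPowerSeries.coeff (R := R) e).toAddMonoidHom n
  refine h.trans ?_
  have h2 : ∀ f : MvPowerSeries ℕ+ R, MvPowerSeries.coeff e ((n : MvPowerSeries ℕ+ R) *
      MvPowerSeries.X n * f) = if e n = 0 then 0 else
        (n : R) * MvPowerSeries.coeff (e - Finsupp.single n 1) f := by
    intro f
    rw [mul_assoc, ← nsmul_eq_mul, map_nsmul, MvPowerSeries.X, MvPowerSeries.coeff_monomial_mul,
      one_mul, nsmul_eq_mul]
    simp only [Finsupp.single_le_iff]
    split_ifs with h1 h2 h2
    · omega
    · rfl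
    · rw [mul_zero]
    · omega
  ext d
  rw [coeff_schurSeries β _ d rfl]
  simp only [LinearMap.toAddMonoidHom_coe, h2]
  split_ifs with h0
  · simp
  · rw [MvPowerSeries.coeff_smul, tauCoeff, coeff_schurSeries β _ d rfl, Finset.mul_sum]
    refine Finset.sum_congr rfl fun lam _ => ?_
    ring

lemma schur_partition_zero {A : Type*} [CommRing A] [Algebra ℚ A] (u : ℕ+ → A)
    (lam : (0 : ℕ).Partition) : schur u lam = 1 := by
  rw [schur_eq_beadSchur u lam (card_parts_le lam), beadSchur, beadDet]
  exact Matrix.det_isEmpty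

omit [Algebra ℚ R] in
lemma contentWeight_partition_zero (β : R) (lam : (0 : ℕ).Partition) :
    contentWeight β lam = 1 := by
  rw [contentWeight, Nat.le_zero.1 (card_parts_le lam)]
  rfl

lemma coeff_zero_schurSeries (β : R) (y : ∀ n : ℕ, n.Partition → R) :
    MvPowerSeries.coeff 0 (schurSeries β y) = y 0 default := by
  rw [coeff_schurSeries β y 0 wt_zero, Fintype.sum_unique, schur_partition_zero,
    contentWeight_partition_zero, mul_one, MvPowerSeries.coeff_zero_one, one_mul]

lemma wt_eq_zero {d : ℕ+ →₀ ℕ} (h : wt d = 0) : d = 0 := by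
  by_contra hd
  obtain ⟨n, hn⟩ := Finsupp.ne_iff.1 hd
  have := wt_sub_single hn
  have := n.pos
  omega

lemma Rhat_zero (n : ℕ+) (f : MvPowerSeries ℕ+ R) :
    Rhat (0 : R) n f = MvPowerSeries.pderiv R n f := by
  have h := Yhat_fallPoly (R := R) 0 n
  have h1 : ladderPoly (0 : R) n = 1 := by simp [ladderPoly]
  have h2 : fallPoly R 0 = 1 := by simp [fallPoly]
  rw [h2, map_one, one_mul] at h
  rw [Rhat_eq_Yhat, bmm_pow, h1, map_one, mul_one, h]
  obtain ⟨m, rfl⟩ : ∃ m : ℕ, m.succPNat = n := ⟨n.natPred, PNat.succPNat_natPred n⟩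
  simp only [Nat.cast_zero, zero_add, inv_one, one_smul]
  rfl

/-- At `β = 0` the universal series is `exp (∑ n t_n u_n)`, which contains only monomials with equal
exponents in `t` and `u`. The induction differentiates in a time that occurs in `d`, which lowers
both exponents. -/
lemma coeff_tauCoeff_zero (d e : ℕ+ →₀ ℕ) :
    (d = e → IsUnit (MvPowerSeries.coeff d (tauCoeff (0 : R) e))) ∧
      (d ≠ e → MvPowerSeries.coeff d (tauCoeff (0 : R) e) = 0) := by
  have h0 : ∀ c : ℤ, IsUnit (1 + (0 : R) * (c : R)) := fun c => by simp
  induction hk : wt d using Nat.strong_induction_on generalizing d e with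
  | _ k ih =>
    by_cases hd : d = 0
    · subst hd
      rw [tauCoeff, coeff_zero_schurSeries, schur_partition_zero]
      constructor
      · rintro rfl
        simp
      · intro h
        rw [MvPowerSeries.coeff_one, if_neg h.symm]
    · obtain ⟨n, hn⟩ := Finsupp.ne_iff.1 hd
      have hw := wt_sub_single hn
      have hpos := n.pos
      set d' := d - Finsupp.single n 1 with hd'
      have hdd : d' + Finsupp.single n 1 = d :=
        tsub_add_cancel_of_le (by simpa [Finsupp.single_le_iff] using Nat.one_le_iff_ne_zero.2 hn)
      have h1 := MvPowerSeries.coeff_pderiv (i := n) (tauCoeff (0 : R) e) d'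
      rw [hdd, ← Rhat_zero, Rhat_tauCoeff h0] at h1
      have hu : IsUnit ((d' n : R) + 1) := by
        have := isUnit_natCast_of_ne_zero (R := R) (Nat.succ_ne_zero (d' n))
        rwa [Nat.cast_succ] at this
      by_cases he : e n = 0
      · rw [if_pos he, map_zero] at h1
        have h2 : MvPowerSeries.coeff d (tauCoeff (0 : R) e) = 0 :=
          hu.mul_left_eq_zero.1 h1.symm
        refine ⟨fun h => absurd he (h ▸ hn), fun _ => h2⟩
      · have hee : e - Finsupp.single n 1 + Finsupp.single n 1 = e :=
          tsub_add_cancel_of_le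
            (by simpa [Finsupp.single_le_iff] using Nat.one_le_iff_ne_zero.2 he)
        rw [if_neg he, MvPowerSeries.coeff_smul] at h1
        obtain ⟨h2, h3⟩ := ih (wt d') (by omega) d' (e - Finsupp.single n 1) rfl
        constructor
        · intro h
          have h4 := (isUnit_natCast_of_ne_zero (R := R) n.ne_zero).mul (h2 (by rw [hd', h]))
          rw [h1] at h4
          exact isUnit_of_mul_isUnit_left h4
        · intro h
          rw [h3 fun h' => h (by rw [← hdd, h', hee]), mul_zero] at h1
          exact hu.mul_left_eq_zero.1 h1.symm

lemma sum_map_toMultiset (d : ℕ+ →₀ ℕ) :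
    ((Finsupp.toMultiset d).map ((↑) : ℕ+ → ℕ)).sum = wt d := by
  induction d using Finsupp.induction_linear with
  | zero => simp [wt_zero]
  | add f g hf hg => simp [hf, hg, wt]
  | single i m => simp [wt, Finsupp.weight_single, Multiset.map_nsmul, Multiset.sum_nsmul]

/-- Monomials of weighted degree `k` correspond to partitions of `k`. -/
def monomialPartition (k : ℕ) (d : {d : ℕ+ →₀ ℕ // wt d = k}) : k.Partition where
  parts := (Finsupp.toMultiset d.1).map (↑)
  parts_pos := by
    intro i hi
    obtain ⟨j, _, rfl⟩ := Multiset.mem_map.1 hi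
    exact j.pos
  parts_sum := by
    rw [sum_map_toMultiset, d.2]

lemma monomialPartition_bijective (k : ℕ) : Function.Bijective (monomialPartition k) := by
  constructor
  · intro d e h
    have h1 := congrArg Nat.Partition.parts h
    exact Subtype.ext ((Function.HasLeftInverse.injective ⟨_, Finsupp.toMultiset_toFinsupp⟩)
      (Multiset.map_injective PNat.coe_injective h1))
  · intro lam
    obtain ⟨s, hs⟩ : ∃ s : Multiset ℕ+, s.map (↑) = lam.parts :=
      CanLift.prf lam.parts fun i hi => lam.parts_pos hi
    have hs' : (Finsupp.toMultiset (Multiset.toFinsupp s)).map ((↑) : ℕ+ → ℕ) = lam.parts := by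
      rw [Multiset.toFinsupp_toMultiset, hs]
    refine ⟨⟨Multiset.toFinsupp s, ?_⟩, Nat.Partition.ext hs'⟩
    rw [← sum_map_toMultiset, hs', lam.parts_sum]

/-- The monomial with exponents given by a partition. -/
def partitionMonomial (k : ℕ) : k.Partition ≃ {d : ℕ+ →₀ ℕ // wt d = k} :=
  (Equiv.ofBijective _ (monomialPartition_bijective k)).symm

/-- The coefficients of Schur functions, as a square matrix. -/
def schurMatrix (R : Type*) [CommRing R] [Algebra ℚ R] (k : ℕ) :
    Matrix k.Partition k.Partition R :=
  Matrix.of fun mu lam => MvPowerSeries.coeff (partitionMonomial k mu : ℕ+ →₀ ℕ)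
    (schur (fun k => (MvPowerSeries.X k : MvPowerSeries ℕ+ R)) lam)

/-- The coefficients of the universal tau-function in degree `k`. -/
def tauMatrix (β : R) (k : ℕ) : Matrix k.Partition k.Partition R :=
  Matrix.of fun mu nu =>
    MvPowerSeries.coeff (partitionMonomial k mu : ℕ+ →₀ ℕ) (tauCoeff β (partitionMonomial k nu))

lemma tauMatrix_eq (β : R) (k : ℕ) : tauMatrix β k
    = schurMatrix R k * Matrix.diagonal (fun lam => contentWeight β lam) *
      (schurMatrix R k).transpose := by
  ext mu nu
  rw [Matrix.mul_apply]
  simp only [Matrix.mul_diagonal, Matrix.transpose_apply, tauMatrix, schurMatrix, Matrix.of_apply]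
  rw [tauCoeff, coeff_schurSeries β _ _ (partitionMonomial k mu).2]
  refine Finset.sum_congr rfl fun lam _ => ?_
  ring

/-- The Schur matrix does not depend on `β`, so it may be studied at `β = 0`, where the matrix
factored by `tauMatrix_eq` is diagonal with unit entries. -/
lemma isUnit_det_schurMatrix (k : ℕ) : IsUnit (schurMatrix R k).det := by
  have h1 : tauMatrix (0 : R) k = Matrix.diagonal fun mu =>
      MvPowerSeries.coeff (partitionMonomial k mu : ℕ+ →₀ ℕ)
        (tauCoeff (0 : R) (partitionMonomial k mu)) := by
    ext mu nu
    by_cases h : mu = nu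
    · subst h
      rw [Matrix.diagonal_apply_eq, tauMatrix, Matrix.of_apply]
    · rw [Matrix.diagonal_apply_ne _ h, tauMatrix, Matrix.of_apply]
      exact (coeff_tauCoeff_zero _ _).2 fun h' =>
        h ((partitionMonomial k).injective (Subtype.ext h'))
  have h2 : IsUnit (tauMatrix (0 : R) k).det := by
    rw [h1, Matrix.det_diagonal]
    exact Finset.prod_induction _ IsUnit (fun _ _ => IsUnit.mul) isUnit_one fun mu _ =>
      (coeff_tauCoeff_zero _ _).1 rfl
  rw [tauMatrix_eq, Matrix.det_mul, Matrix.det_mul, mul_assoc] at h2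
  exact isUnit_of_mul_isUnit_left h2

omit [Algebra ℚ R] in
lemma isUnit_contentWeight {β : R} (hβ : ∀ c : ℤ, IsUnit (1 + β * (c : R))) {n : ℕ}
    (lam : n.Partition) : IsUnit (contentWeight β lam) := by
  refine Finset.prod_induction _ IsUnit (fun _ _ => IsUnit.mul) isUnit_one fun i _ =>
    Finset.prod_induction _ IsUnit (fun _ _ => IsUnit.mul) isUnit_one fun k _ => ?_
  have h := hβ (k + i - part lam (i - 1))
  push_cast at h
  exact h.ringInverse

lemma isUnit_tauMatrix {β : R} (hβ : ∀ c : ℤ, IsUnit (1 + β * (c : R))) (k : ℕ) :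
    IsUnit (tauMatrix β k) := by
  rw [Matrix.isUnit_iff_isUnit_det, tauMatrix_eq, Matrix.det_mul, Matrix.det_mul,
    Matrix.det_transpose, Matrix.det_diagonal]
  exact ((isUnit_det_schurMatrix k).mul (Finset.prod_induction _ IsUnit (fun _ _ => IsUnit.mul)
    isUnit_one fun lam _ => isUnit_contentWeight hβ lam)).mul (isUnit_det_schurMatrix k)

lemma exists_sum_tauCoeff {β : R} (hβ : ∀ c : ℤ, IsUnit (1 + β * (c : R))) (k : ℕ)
    (f : MvPowerSeries ℕ+ R) : ∃ a : k.Partition → R, ∀ d, wt d = k →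
      MvPowerSeries.coeff d (∑ mu, a mu • tauCoeff β (partitionMonomial k mu))
        = MvPowerSeries.coeff d f := by
  obtain ⟨a, ha⟩ := Matrix.mulVec_surjective_iff_isUnit.2 (isUnit_tauMatrix hβ k)
    fun mu => MvPowerSeries.coeff (partitionMonomial k mu : ℕ+ →₀ ℕ) f
  refine ⟨a, fun d hd => ?_⟩
  have h := congrFun ha ((partitionMonomial k).symm ⟨d, hd⟩)
  rw [Matrix.mulVec, dotProduct] at h
  simp only [tauMatrix, Matrix.of_apply, Equiv.apply_symm_apply] at h
  rw [← h, map_sum]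
  exact Finset.sum_congr rfl fun mu _ => by rw [MvPowerSeries.coeff_smul, mul_comm]

lemma eq_zero_of_sum_tauCoeff {β : R} (hβ : ∀ c : ℤ, IsUnit (1 + β * (c : R))) (k : ℕ)
    (a : k.Partition → R) (h : ∀ d, wt d = k →
      ∑ mu, a mu * MvPowerSeries.coeff d (tauCoeff β (partitionMonomial k mu)) = 0) : a = 0 := by
  refine Matrix.mulVec_injective_of_isUnit (isUnit_tauMatrix hβ k) ?_
  rw [Matrix.mulVec_zero]
  ext mu
  rw [Pi.zero_apply, ← h _ (partitionMonomial k mu).2, Matrix.mulVec, dotProduct]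
  exact Finset.sum_congr rfl fun nu _ => by rw [tauMatrix, Matrix.of_apply, mul_comm]

lemma sub_single_add_single {d : ℕ+ →₀ ℕ} {n : ℕ+} (h : d n ≠ 0) :
    d - Finsupp.single n 1 + Finsupp.single n 1 = d :=
  tsub_add_cancel_of_le (by simpa [Finsupp.single_le_iff] using Nat.one_le_iff_ne_zero.2 h)

/-- Adding a part `n` to a partition. -/
def addPart {m : ℕ} (n : ℕ+) (nu : m.Partition) : (m + n).Partition :=
  (partitionMonomial (m + n)).symm ⟨(partitionMonomial m nu).1 + Finsupp.single n 1, by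
    rw [wt_add_single, (partitionMonomial m nu).2]⟩

lemma partitionMonomial_addPart {m : ℕ} (n : ℕ+) (nu : m.Partition) :
    (partitionMonomial (m + n) (addPart n nu) : ℕ+ →₀ ℕ)
      = (partitionMonomial m nu).1 + Finsupp.single n 1 := by
  rw [addPart, Equiv.apply_symm_apply]

lemma addPart_injective {m : ℕ} (n : ℕ+) :
    Function.Injective (addPart n : m.Partition → (m + n).Partition) := by
  intro mu nu h
  have h1 := partitionMonomial_addPart n mu
  rw [h, partitionMonomial_addPart] at h1
  exact (partitionMonomial m).injective (Subtype.ext (add_right_cancel h1.symm))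

lemma exists_addPart_eq {m : ℕ} {n : ℕ+} {mu : (m + n).Partition}
    (h : (partitionMonomial (m + n) mu : ℕ+ →₀ ℕ) n ≠ 0) : ∃ nu : m.Partition, addPart n nu = mu := by
  have hw := wt_sub_single h
  rw [(partitionMonomial (m + n) mu).2, Nat.add_right_cancel_iff] at hw
  refine ⟨(partitionMonomial m).symm ⟨_, hw⟩, ?_⟩
  apply (partitionMonomial (m + n)).injective
  apply Subtype.ext
  rw [partitionMonomial_addPart, Equiv.apply_symm_apply, sub_single_add_single h]

/-- `R̂_n` kills the terms without a part `n` and sends the others to `n` times distinct elements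
`tauCoeff` of degree `m`, which are linearly independent there. -/
lemma eq_zero_of_coeff_Rhat_sum {β : R} (hβ : ∀ c : ℤ, IsUnit (1 + β * (c : R))) (m : ℕ) (n : ℕ+)
    (a : (m + n).Partition → R) (h : ∀ d, wt d = m → MvPowerSeries.coeff d
      (Rhat β n (∑ mu, a mu • tauCoeff β (partitionMonomial (m + n) mu))) = 0)
    (mu : (m + n).Partition) (hmu : (partitionMonomial (m + n) mu : ℕ+ →₀ ℕ) n ≠ 0) :
    a mu = 0 := by
  obtain ⟨L, hL⟩ := exists_linearMap_Rhat β n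
  have hb : (fun nu : m.Partition => a (addPart n nu)) = 0 := by
    refine eq_zero_of_sum_tauCoeff hβ m _ fun d hd => ?_
    refine (isUnit_natCast_of_ne_zero (R := R) n.ne_zero).mul_right_eq_zero.1 ?_
    rw [← h d hd, hL, map_sum, map_sum, Finset.mul_sum]
    refine Fintype.sum_of_injective (addPart n) (addPart_injective n) _ _ (fun nu hnu => ?_)
      fun nu => ?_
    · have h0 : (partitionMonomial (m + n) nu : ℕ+ →₀ ℕ) n = 0 := by
        by_contra h0
        exact hnu (exists_addPart_eq h0)
      rw [map_smul, ← hL, Rhat_tauCoeff hβ, if_pos h0, smul_zero, map_zero]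
    · rw [map_smul, ← hL, Rhat_tauCoeff hβ, partitionMonomial_addPart, if_neg (by simp),
        add_tsub_cancel_right, MvPowerSeries.coeff_smul, MvPowerSeries.coeff_smul]
      ring
  obtain ⟨nu, rfl⟩ := exists_addPart_eq hmu
  exact congrFun hb nu

/-- Suppose `g` vanishes below degree `k > 0`. Then `R̂_n g = r n • g` vanishes in degree `k - n`,
so every coefficient of the degree `k` part at an exponent containing `n` is zero. Each nonzero
exponent contains some `n`. -/
lemma eq_zero_of_Rhat_eq_smul {β : R} (hβ : ∀ c : ℤ, IsUnit (1 + β * (c : R))) (r : ℕ+ → R)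
    {g : MvPowerSeries ℕ+ R} (h0 : MvPowerSeries.coeff 0 g = 0)
    (hg : ∀ n : ℕ+, Rhat β n g = r n • g) : g = 0 := by
  ext d
  rw [map_zero]
  induction hk : wt d using Nat.strong_induction_on generalizing d with
  | _ k ih =>
    rcases Nat.eq_zero_or_pos k with rfl | hpos
    · rw [wt_eq_zero hk, h0]
    obtain ⟨a, ha⟩ := exists_sum_tauCoeff hβ k g
    suffices ha0 : a = 0 by
      rw [← ha d hk, ha0]
      simp
    ext mu
    have hne : (partitionMonomial k mu : ℕ+ →₀ ℕ) ≠ 0 := by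
      intro h
      have := (partitionMonomial k mu).2
      rw [h, wt_zero] at this
      omega
    obtain ⟨n, hn⟩ := Finsupp.ne_iff.1 hne
    have hw := wt_sub_single hn
    rw [(partitionMonomial k mu).2] at hw
    obtain ⟨m, rfl⟩ : ∃ m : ℕ, k = m + n := ⟨_, hw.symm⟩
    refine eq_zero_of_coeff_Rhat_sum hβ m n a (fun e he => ?_) mu hn
    have hpos := n.pos
    rw [coeff_Rhat_congr β n e fun e' he' => ha e' (by rw [he', he]), hg, MvPowerSeries.coeff_smul,
      ih (wt e) (by omega) e rfl, mul_zero]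

lemma Rhat_tauMM {β : R} (hβ : ∀ c : ℤ, IsUnit (1 + β * (c : R))) (t' : ℕ+ → R) (n : ℕ+) :
    Rhat β n (tauMM β t') = ((n : R) * t' n) • tauMM β t' := by
  rw [tauMM_eq_schurSeries]
  refine (Rhat_schurSeries hβ t' (AddMonoidHom.id R) n).trans ?_
  ext d
  rw [MvPowerSeries.coeff_smul, coeff_schurSeries β _ d rfl, coeff_schurSeries β _ d rfl,
    Finset.mul_sum]
  refine Finset.sum_congr rfl fun lam _ => ?_
  rw [AddMonoidHom.id_apply]
  ring

lemma coeff_zero_tauMM (β : R) (t' : ℕ+ → R) : MvPowerSeries.coeff 0 (tauMM β t') = 1 := by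
  rw [tauMM_eq_schurSeries, coeff_zero_schurSeries, schur_partition_zero]

lemma eq_smul_tauMM {β : R} (hβ : ∀ c : ℤ, IsUnit (1 + β * (c : R))) (t' : ℕ+ → R)
    {f : MvPowerSeries ℕ+ R} (hf : ∀ n : ℕ+, Rhat β n f = ((n : R) * t' n) • f) :
    f = MvPowerSeries.coeff 0 f • tauMM β t' := by
  rw [← sub_eq_zero]
  refine eq_zero_of_Rhat_eq_smul hβ (fun n => (n : R) * t' n) ?_ fun n => ?_
  · rw [map_sub, MvPowerSeries.coeff_smul, coeff_zero_tauMM, mul_one, sub_self]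
  · obtain ⟨L, hL⟩ := exists_linearMap_Rhat β n
    rw [hL, map_sub, map_smul, ← hL, ← hL, hf, Rhat_tauMM hβ, smul_sub, smul_comm]

end Uniqueness

end MonotoneHurwitz

end

theorem mainTheorem2 {R : Type*} [CommRing R] [Algebra ℚ R] (β : R)
    (hβ : ∀ c : ℤ, IsUnit (1 + β * (c : R))) (t' : ℕ+ → R) :
    (∀ n : ℕ+, MonotoneHurwitz.Rhat β n (MonotoneHurwitz.tauMM β t')
      = ((n : R) * t' n) • MonotoneHurwitz.tauMM β t') ∧
    (∀ n : ℕ+, MonotoneHurwitz.Rhat β n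
      = MonotoneHurwitz.Yhat (MonotoneHurwitz.bmm β ^ (n : ℕ))) ∧
    (∀ f : MvPowerSeries ℕ+ R,
      (∀ n : ℕ+, MonotoneHurwitz.Rhat β n f = ((n : R) * t' n) • f) →
        ∃! c : R, f = c • MonotoneHurwitz.tauMM β t') := by
  refine ⟨MonotoneHurwitz.Rhat_tauMM hβ t', fun n => MonotoneHurwitz.Rhat_eq_Yhat β n,
    fun f hf => ⟨_, MonotoneHurwitz.eq_smul_tauMM hβ t' hf, fun c hc => ?_⟩⟩
  -- The constant term of `tauMM` is `1`, so `c` is the constant term of `f`.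
  rw [hc, MvPowerSeries.coeff_smul, MonotoneHurwitz.coeff_zero_tauMM, mul_one]
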